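/- Let $(X,dx)$ and $(Y,dy)$ be probability spaces, $n\in\mathbb N$ and $\varepsilon>0$. Let $f_1:X\times\mathbb R^n\to[0,\infty]$ and $f_2:Y\times\mathbb R^n\to[0,\infty]$ be convex normal integrands (for each $x$ the epigraph of $f_1(x,\cdot)$ is closed and convex, and $x\mapsto\operatorname{epi}f_1(x,\cdot)$ is a measurable set-valued map; likewise $f_2$) that are admissible: $f_1(x,s)<\infty$ only if $s\in[0,\infty)^n$, and there is $s\in L^1(X)^n$ with $F_1(s):=\int_X f_1(x,s(x))\,dx<\infty$; likewise $f_2$, with $F_2$. Assume that for every $x\in X$ and $y\in Y$ there are $s_1,s_2\in(0,\infty)^n$ with $f_1(x,s_1)<\infty$ and $f_2(y,s_2)<\infty$. Let $K\in L^\infty(X\times Y)^n$ be positive a.e. Put $$(\mathcal K b)_k(x)=\int_Y K_k(x,y)b_k(y)\,dy,\qquad (\mathcal K^{T}a)_k(y)=\int_X K_k(x,y)a_k(x)\,dx ,$$ with values in $[0,\infty]$, for measurable $a,b\ge 0$, and, for $s,z\in[0,\infty)^n$, $\overline{\mathrm{KL}}(s|z)=\sum_k s_k\log(s_k/z_k)-s_k+z_k$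 if $z_k=0\Rightarrow s_k=0$ for all $k$ (with $0\log(0/0)=0$), and $+\infty$ otherwise (also if $s\notin[0,\infty)^n$). Write $f^*$ for the convex conjugate in the second variable. *Dual iterates.* $v^{(0)}=0$ and, for $\ell\ge 0$, $u^{(\ell+1)}:X\to\mathbb R^n$ and $v^{(\ell+1)}:Y\to\mathbb R^n$ are measurable functions such that, for almost every $x$ and $y$, $$u^{(\ell+1)}(x)\in\operatorname*{argmax}_{u\in\mathbb R^n}\,-f_1^*(x,-u)-\varepsilon\big\langle e^{u/\varepsilon},(\mathcal K e^{v^{(\ell)}/\varepsilon})(x)\big\rangle,\qquad v^{(\ell+1)}(y)\in\operatorname*{argmax}_{v\in\mathbb R^n}\,-f_2^*(y,-v)-\varepsilon\big\langle e^{v/\varepsilon},(\mathcal K^{T} e^{u^{(\ell+1)}/\varepsilon})(y)\big\rangle .$$ *Scaling iterates.* $b^{(0)}=1$ and, for $\ell\ge0$, $a^{(\ell+1)}=p/\mathcal K b^{(\ell)}$ and $b^{(\ell+1)}=q/\mathcal K^{T}a^{(\ell+1)}$, where $\mathcal K b^{(\ell)}$ and $\mathcal K^Ta^{(\ell+1)}$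 are finite a.e. and $p,q$ are measurable functions of pointwise minimizers: for almost every $x$ and $y$, $p(x)$ minimizes $s\mapsto f_1(x,s)+\varepsilon\overline{\mathrm{KL}}(s|\mathcal K b^{(\ell)}(x))$ and $q(y)$ minimizes $s\mapsto f_2(y,s)+\varepsilon\overline{\mathrm{KL}}(s|\mathcal K^{T}a^{(\ell+1)}(y))$ over $\mathbb R^n$. By convention $u^{(0)}=0$ and $a^{(0)}=1$ (they are not used). Say that the kernel integrals are finite if, for the dual iterates (of any finite length), $\mathcal K e^{v^{(\ell)}/\varepsilon}<\infty$ a.e. and $\mathcal K^{T}e^{u^{(\ell+1)}/\varepsilon}<\infty$ a.e. 1. The kernel integrals are finite in each of the following cases: $n\le1$; $K$ is essentially bounded below by a positive constant; there is $r\in L^1(X\times Y)^n$ with $F_1\big(\int_Y r\,dy\big)+F_2\big(\int_X r\,dx\big)+\varepsilon\int_{X\times Y}\overline{\mathrm{KL}}(r|K)\,dx\,dy<\infty$. 2. If the kernel integrals are finite, then the dual iterates $(u^{(\ell)},v^{(\ell)})_{\ell\in\mathbb N}$ exist and are unique up to null sets, the scaling iterates exist and are unique up to null sets, and $(a^{(\ell)},b^{(\ell)})=(e^{u^{(\ell)}/\varepsilon},e^{v^{(\ell)}/\varepsilon})$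 a.e. for all $\ell\in\mathbb N$. Moreover the pointwise problems agree with the integral ones: with $z=\mathcal K e^{v^{(\ell)}/\varepsilon}$, if the supremum over measurable $u:X\to\mathbb R^n$ of $-\int_X f_1^*(x,-u(x))\,dx-\varepsilon\int_X\langle e^{u/\varepsilon},z\rangle\,dx$ (read as $-\infty$ where ambiguous) is finite, then $u^{(\ell+1)}$ is its a.e. unique maximizer, and if the infimum over measurable $s:X\to\mathbb R^n$ of $F_1(s)+\varepsilon\int_X\overline{\mathrm{KL}}(s|z)\,dx$ is finite, then $e^{u^{(\ell+1)}/\varepsilon}z$ is its a.e. unique minimizer; likewise on $Y$ with $z=\mathcal K^Te^{u^{(\ell+1)}/\varepsilon}$ and $v^{(\ell+1)}$. -/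

import Mathlib

open MeasureTheory
open scoped ENNReal

noncomputable section

namespace EntropicScaling

variable {X Y : Type*} [MeasurableSpace X] [MeasurableSpace Y] {n : ℕ}

/-! ### Normal integrands and admissible integral functionals -/

/-- The epigraph in `ℝⁿ × ℝ` of an extended-real-valued function. -/
def epi (g : (Fin n → ℝ) → EReal) : Set ((Fin n → ℝ) × ℝ) :=
  {p | g p.1 ≤ (p.2 : EReal)}

/-- `f` is a normal integrand: its epigraphical mapping is closed-valued and measurable
(the preimage of every open set is measurable). -/
structure IsNormalIntegrand (f : X → (Fin n → ℝ) → EReal) : Prop where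
  isClosed_epi : ∀ x, IsClosed (epi (f x))
  measurable_epi : ∀ O : Set ((Fin n → ℝ) × ℝ), IsOpen O →
    MeasurableSet {x | (epi (f x) ∩ O).Nonempty}

/-- The integral functional `I_f(s) = ∫ f(x, s(x)) dx` of a nonnegative integrand. -/
def integralFunctional (f : X → (Fin n → ℝ) → EReal) (μ : Measure X)
    (s : X → Fin n → ℝ) : ℝ≥0∞ :=
  ∫⁻ x, (f x (s x)).toENNReal ∂μ

/-- `f` is the integrand of an admissible convex integral functional. -/
structure IsAdmissible (f : X → (Fin n → ℝ) → EReal) (μ : Measure X) : Prop where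
  normal : IsNormalIntegrand f
  convex : ∀ x, Convex ℝ (epi (f x))
  nonneg : ∀ x s, 0 ≤ f x s
  dom_subset : ∀ x s, f x s < ⊤ → ∀ k, 0 ≤ s k
  feasible : ∃ s : X → Fin n → ℝ, Integrable s μ ∧ integralFunctional f μ s < ⊤

/-- The convex conjugate on `ℝⁿ`. -/
def conj (g : (Fin n → ℝ) → EReal) (p : Fin n → ℝ) : EReal :=
  ⨆ s : Fin n → ℝ, ((∑ k, s k * p k : ℝ) : EReal) - g s

/-! ### The kernel operators -/

/-- `(𝒦 b)(x)_k = ∫ K_k(x,y) b_k(y) dy`, as an element of `[0,∞]`. -/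
def gibbs (K : X × Y → Fin n → ℝ) (ν : Measure Y) (b : Y → Fin n → ℝ)
    (x : X) (k : Fin n) : ℝ≥0∞ :=
  ∫⁻ y, ENNReal.ofReal (K (x, y) k * b y k) ∂ν

/-- The transposed operator `(𝒦ᵀ a)(y)_k = ∫ K_k(x,y) a_k(x) dx`, as an element of `[0,∞]`. -/
def gibbsT (K : X × Y → Fin n → ℝ) (μ : Measure X) (a : X → Fin n → ℝ)
    (y : Y) (k : Fin n) : ℝ≥0∞ :=
  ∫⁻ x, ENNReal.ofReal (K (x, y) k * a x k) ∂μ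

/-- `e^{u/ε}`, componentwise. -/
def expScale (ε : ℝ) (u : X → Fin n → ℝ) : X → Fin n → ℝ :=
  fun x k => Real.exp (u x k / ε)

/-! ### Alternating dual maximization -/

/-- The pointwise dual objective `-g^*(-u) - ε ⟨e^{u/ε}, z⟩` for `u ∈ ℝⁿ`. -/
def dualObj (g : (Fin n → ℝ) → EReal) (ε : ℝ) (z : Fin n → ℝ≥0∞) (u : Fin n → ℝ) : EReal :=
  -conj g (-u) -
    (ε : EReal) * ((∑ k, ENNReal.ofReal (Real.exp (u k / ε)) * z k : ℝ≥0∞) : EReal)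

/-- `u` is a measurable function of pointwise maximizers of the dual objective with kernel
term `z`. -/
def IsDualStep (f : X → (Fin n → ℝ) → EReal) (ε : ℝ) (μ : Measure X)
    (z : X → Fin n → ℝ≥0∞) (u : X → Fin n → ℝ) : Prop :=
  Measurable u ∧ ∀ᵐ x ∂μ, ∀ w, dualObj (f x) ε (z x) w ≤ dualObj (f x) ε (z x) (u x)

/-- `(u^ℓ, v^ℓ)_{ℓ ≤ N}` are the first alternating dual maximization iterates from `v⁰ = 0`.
The value `u⁰ = 0` is a convention: it is not used by the iteration. -/
def IsDualRun (f₁ : X → (Fin n → ℝ) → EReal) (f₂ : Y → (Fin n → ℝ) → EReal) (ε : ℝ)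
    (K : X × Y → Fin n → ℝ) (μ : Measure X) (ν : Measure Y) (N : ℕ)
    (u : ℕ → X → Fin n → ℝ) (v : ℕ → Y → Fin n → ℝ) : Prop :=
  u 0 = 0 ∧ v 0 = 0 ∧ ∀ ℓ < N,
    IsDualStep f₁ ε μ (gibbs K ν (expScale ε (v ℓ))) (u (ℓ + 1)) ∧
    IsDualStep f₂ ε ν (gibbsT K μ (expScale ε (u (ℓ + 1)))) (v (ℓ + 1))

/-- Infinite sequences of alternating dual maximization iterates. -/
def IsDualIterates (f₁ : X → (Fin n → ℝ) → EReal) (f₂ : Y → (Fin n → ℝ) → EReal) (ε : ℝ)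
    (K : X × Y → Fin n → ℝ) (μ : Measure X) (ν : Measure Y)
    (u : ℕ → X → Fin n → ℝ) (v : ℕ → Y → Fin n → ℝ) : Prop :=
  ∀ N, IsDualRun f₁ f₂ ε K μ ν N u v

/-- The integrals `𝒦 e^{v^ℓ/ε}` and `𝒦ᵀ e^{u^{ℓ+1}/ε}` met along the iteration are finite
almost everywhere, i.e. the operators `𝒦`, `𝒦ᵀ` can be applied to the iterates. -/
def KernelFinite (f₁ : X → (Fin n → ℝ) → EReal) (f₂ : Y → (Fin n → ℝ) → EReal) (ε : ℝ)
    (K : X × Y → Fin n → ℝ) (μ : Measure X) (ν : Measure Y) : Prop :=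
  ∀ N u v, IsDualRun f₁ f₂ ε K μ ν N u v →
    (∀ᵐ x ∂μ, ∀ k, gibbs K ν (expScale ε (v N)) x k < ⊤) ∧
    ∀ u', IsDualStep f₁ ε μ (gibbs K ν (expScale ε (v N))) u' →
      ∀ᵐ y ∂ν, ∀ k, gibbsT K μ (expScale ε u') y k < ⊤

/-- Integral of an extended-real-valued function, equal to `+∞` as soon as the positive part
has infinite integral. -/
def extIntegral (μ : Measure X) (g : X → EReal) : EReal :=
  open Classical in
  if ∫⁻ x, (g x).toENNReal ∂μ = ⊤ then ⊤
  else ((∫⁻ x, (g x).toENNReal ∂μ : ℝ≥0∞) : EReal) - ((∫⁻ x, (-g x).toENNReal ∂μ : ℝ≥0∞) : EReal)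

/-- The integral dual objective `-I_{f^*}(-u) - ε ⟨e^{u/ε}, z⟩` for a function `u`; it is `-∞`
where this difference is ambiguous. -/
def dualFunctional (f : X → (Fin n → ℝ) → EReal) (ε : ℝ) (μ : Measure X)
    (z : X → Fin n → ℝ≥0∞) (u : X → Fin n → ℝ) : EReal :=
  -extIntegral μ (fun x => conj (f x) (-u x)) -
    (ε : EReal) *
      ((∫⁻ x, ∑ k, ENNReal.ofReal (Real.exp (u x k / ε)) * z x k ∂μ : ℝ≥0∞) : EReal)

/-- The supremum of the integral dual objective over measurable functions. -/
def dualValue (f : X → (Fin n → ℝ) → EReal) (ε : ℝ) (μ : Measure X)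
    (z : X → Fin n → ℝ≥0∞) : EReal :=
  ⨆ (u : X → Fin n → ℝ) (_ : Measurable u), dualFunctional f ε μ z u

/-- `u` is, up to null sets, the only maximizer of the integral dual objective among
measurable functions. -/
def IsUniqueDualMaximizer (f : X → (Fin n → ℝ) → EReal) (ε : ℝ) (μ : Measure X)
    (z : X → Fin n → ℝ≥0∞) (u : X → Fin n → ℝ) : Prop :=
  Measurable u ∧ dualFunctional f ε μ z u = dualValue f ε μ z ∧
    ∀ w, Measurable w → dualFunctional f ε μ z w = dualValue f ε μ z → w =ᵐ[μ] u

/-! ### Kullback-Leibler divergence and scaling iterations -/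

/-- The Kullback-Leibler divergence of two vectors of `ℝⁿ`. -/
def klPoint (s z : Fin n → ℝ) : EReal :=
  open Classical in
  if (∀ k, 0 ≤ s k) ∧ (∀ k, 0 ≤ z k) ∧ ∀ k, z k = 0 → s k = 0 then
    ((∑ k, (s k * Real.log (s k / z k) - s k + z k) : ℝ) : EReal)
  else ⊤

/-- `s` minimizes `g + ε KL(· | z)` on `ℝⁿ`. -/
def IsKLProx (g : (Fin n → ℝ) → EReal) (ε : ℝ) (z s : Fin n → ℝ) : Prop :=
  ∀ w, g s + (ε : EReal) * klPoint s z ≤ g w + (ε : EReal) * klPoint w z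

/-- `a = prox(z) / z`, where the KL proximal operator is computed pointwise by a measurable
function of minimizers, and `z` is finite almost everywhere. -/
def IsScalingStep (f : X → (Fin n → ℝ) → EReal) (ε : ℝ) (μ : Measure X)
    (z : X → Fin n → ℝ≥0∞) (a : X → Fin n → ℝ) : Prop :=
  Measurable a ∧ ∃ s : X → Fin n → ℝ, Measurable s ∧ ∀ᵐ x ∂μ,
    (∀ k, z x k < ⊤) ∧ IsKLProx (f x) ε (fun k => (z x k).toReal) (s x) ∧
      ∀ k, a x k = s x k / (z x k).toReal

/-- `(a^ℓ, b^ℓ)` are the scaling iterates from `b⁰ = 1`. The value `a⁰ = 1` is a convention: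
it is not used by the iteration. -/
def IsScalingIterates (f₁ : X → (Fin n → ℝ) → EReal) (f₂ : Y → (Fin n → ℝ) → EReal) (ε : ℝ)
    (K : X × Y → Fin n → ℝ) (μ : Measure X) (ν : Measure Y)
    (a : ℕ → X → Fin n → ℝ) (b : ℕ → Y → Fin n → ℝ) : Prop :=
  a 0 = 1 ∧ b 0 = 1 ∧ ∀ ℓ,
    IsScalingStep f₁ ε μ (gibbs K ν (b ℓ)) (a (ℓ + 1)) ∧
    IsScalingStep f₂ ε ν (gibbsT K μ (a (ℓ + 1))) (b (ℓ + 1))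

/-- The integral proximal objective `I_f(s) + ε KL(s | z)` for functions `s`, `z`. -/
def proxFunctional (f : X → (Fin n → ℝ) → EReal) (ε : ℝ) (μ : Measure X)
    (z s : X → Fin n → ℝ) : ℝ≥0∞ :=
  integralFunctional f μ s + ENNReal.ofReal ε * ∫⁻ x, (klPoint (s x) (z x)).toENNReal ∂μ

/-- The infimum of the integral proximal objective over measurable functions. -/
def proxValue (f : X → (Fin n → ℝ) → EReal) (ε : ℝ) (μ : Measure X)
    (z : X → Fin n → ℝ) : ℝ≥0∞ :=
  ⨅ (s : X → Fin n → ℝ) (_ : Measurable s), proxFunctional f ε μ z s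

/-- `s` is, up to null sets, the only minimizer of the integral proximal objective among
measurable functions, i.e. `s = prox^{KL}_{F/ε}(z)` for `F = I_f`. -/
def IsUniqueProx (f : X → (Fin n → ℝ) → EReal) (ε : ℝ) (μ : Measure X)
    (z s : X → Fin n → ℝ) : Prop :=
  Measurable s ∧ proxFunctional f ε μ z s = proxValue f ε μ z ∧
    ∀ w, Measurable w → proxFunctional f ε μ z w = proxValue f ε μ z → w =ᵐ[μ] s

/-- One step in integral form: if the integral dual problem with kernel term `z` has a finite
value then `u` is its unique maximizer, and if the integral proximal problem has a finite value
then `e^{u/ε} z` is its unique minimizer. -/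
def AgreesWithIntegralStep (f : X → (Fin n → ℝ) → EReal) (ε : ℝ) (μ : Measure X)
    (z : X → Fin n → ℝ≥0∞) (u : X → Fin n → ℝ) : Prop :=
  (dualValue f ε μ z ≠ ⊥ → dualValue f ε μ z ≠ ⊤ → IsUniqueDualMaximizer f ε μ z u) ∧
  (proxValue f ε μ (fun x k => (z x k).toReal) ≠ ⊤ →
    IsUniqueProx f ε μ (fun x k => (z x k).toReal)
      (fun x k => expScale ε u x k * (z x k).toReal))

/-- The primal problem `min_r F₁(P^X r) + F₂(P^Y r) + ε KL(r | K)` is feasible. -/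
def PrimalFeasible (f₁ : X → (Fin n → ℝ) → EReal) (f₂ : Y → (Fin n → ℝ) → EReal)
    (K : X × Y → Fin n → ℝ) (μ : Measure X) (ν : Measure Y) : Prop :=
  ∃ r : X × Y → Fin n → ℝ, Integrable r (μ.prod ν) ∧
    integralFunctional f₁ μ (fun x k => ∫ y, r (x, y) k ∂ν) < ⊤ ∧
    integralFunctional f₂ ν (fun y k => ∫ x, r (x, y) k ∂μ) < ⊤ ∧
    ∫⁻ p, (klPoint (r p) (K p)).toENNReal ∂(μ.prod ν) < ⊤

end EntropicScaling

end

open EntropicScaling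

/-! Everything reduces to one convex problem at a single point. For a fixed vector `z` with positive
finite entries, minimizing `g + ε KL(· | z)` and maximizing the dual objective have the same
solution, linked by `s = e^{u/ε} z` and `-u ∈ ∂g(s)`; this relation is `IsOpt`. A primal minimizer
exists by compactness (`exists_isMinOn_epiObj`). It has positive entries, because the slope of `a
log a` at `0` is `-∞` and the domain of `g` meets the open orthant (`pos_of_isMinOn`), so `u = ε log
(s / z)` is a genuine vector and stationarity gives `IsOpt`. Under `IsOpt` the gap of any
competitor, primal or dual, is at least `ε` times a KL divergence (`IsOpt.epiObj_le`,
`IsOpt.dualObj_le`). Both solutions are therefore unique, and a scaling step is exactly the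
exponential of a dual step.

The same gap bounds the squared distance of square roots, so near-minimizers determine the
minimizer; this makes the pointwise solution measurable in `x` (`measurable_of_isOpt`). Integrated
over `x`, the gap compares the pointwise and integral problems. On the dual side finiteness of the
integrals at the pointwise maximizer must be proved first, by truncation
(`lintegral_expSum_ne_top`).

What remains is finiteness of `𝒦 e^{v/ε}` and `𝒦ᵀ e^{u/ε}`, shown by an estimate that each half-step
hands to the next (`kernelFinite_of_invariant`). For `n ≤ 1`, the subgradient inequality at a
feasible point bounds `e^{u/ε} z` wherever `u` is large, and Tonelli transposes the bound. For `K`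
bounded below, integrability of the exponentials is propagated. For a feasible plan `r`, Young's
inequality bounds the positive part of `⟨u, r⟩` by integrable terms plus half of the coupling term
`ε ∫ e^{u/ε} 𝒦 e^{v/ε}`, and dual optimality against the previous iterate absorbs that half
(`PlanInvariant.step`). -/

noncomputable section

namespace EntropicScaling

section

variable {n : ℕ}

/-! ### The scalar Kullback-Leibler divergence -/

/-- The scalar Kullback-Leibler divergence. -/
def klTerm (a b : ℝ) : ℝ := a * Real.log (a / b) - a + b

/-- Fenchel's inequality for the scalar Kullback-Leibler divergence. -/
lemma mul_le_klTerm_add {a b : ℝ} (ha : 0 ≤ a) (hb : 0 < b) (p : ℝ) :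
    p * a ≤ klTerm a b + b * (Real.exp p - 1) := by
  unfold klTerm
  rcases ha.eq_or_lt with rfl | ha
  · have := mul_pos hb (Real.exp_pos p)
    simp; nlinarith
  · have h1 : Real.log (b * Real.exp p / a) ≤ b * Real.exp p / a - 1 :=
      Real.log_le_sub_one_of_pos (by positivity)
    rw [Real.log_div (by positivity) ha.ne', Real.log_mul hb.ne' (Real.exp_ne_zero _),
      Real.log_exp] at h1
    have h2 := mul_le_mul_of_nonneg_left h1 ha.le
    have h3 : a * (b * Real.exp p / a - 1) = b * Real.exp p - a := by field_simp
    rw [Real.log_div ha.ne' hb.ne']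
    nlinarith

lemma klTerm_nonneg {a b : ℝ} (ha : 0 ≤ a) (hb : 0 < b) : 0 ≤ klTerm a b := by
  have := mul_le_klTerm_add ha hb 0
  simpa using this

/-- Slope `1` in Fenchel's inequality. This is the coercivity of KL, behind the compactness of
sublevel sets and the truncation estimate. -/
lemma le_klTerm_add {a b : ℝ} (ha : 0 ≤ a) (hb : 0 < b) :
    a ≤ klTerm a b + b * (Real.exp 1 - 1) := by
  have := mul_le_klTerm_add ha hb 1
  simpa using this

/-- The bound `log t ≤ t - 1` at `t = √b / √a`, multiplied by `2a`. It turns a small KL gap into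
closeness of points, with no upper bound on `a` or `b` required. -/
lemma sq_sqrt_sub_sqrt_le_klTerm {a b : ℝ} (ha : 0 ≤ a) (hb : 0 < b) :
    (√a - √b) ^ 2 ≤ klTerm a b := by
  unfold klTerm
  rcases ha.eq_or_lt with rfl | ha
  · simp [Real.sq_sqrt hb.le]
  · have hsa := Real.sqrt_pos.2 ha
    have hsb := Real.sqrt_pos.2 hb
    have h1 : Real.log (√b / √a) ≤ √b / √a - 1 := Real.log_le_sub_one_of_pos (by positivity)
    rw [Real.log_div hsb.ne' hsa.ne', Real.log_sqrt hb.le, Real.log_sqrt ha.le] at h1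
    have h2 := mul_le_mul_of_nonneg_left h1 (mul_nonneg hsa.le hsa.le)
    have h3 : √a * √a * (√b / √a - 1) = √a * √b - √a * √a := by field_simp
    rw [h3, Real.mul_self_sqrt ha.le] at h2
    rw [Real.log_div ha.ne' hb.ne']
    have := Real.sq_sqrt ha.le
    have := Real.sq_sqrt hb.le
    nlinarith

lemma eq_of_klTerm_le_zero {a b : ℝ} (ha : 0 ≤ a) (hb : 0 < b) (h : klTerm a b ≤ 0) : a = b := by
  have h1 := sq_sqrt_sub_sqrt_le_klTerm ha hb
  have h2 : √a - √b = 0 := by nlinarith [sq_nonneg (√a - √b)]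
  exact (Real.sqrt_inj ha hb.le).1 (by linarith)

/-- The gradient inequality, at a positive point `a`. -/
lemma klTerm_sub_le {a b z : ℝ} (ha : 0 < a) (hb : 0 ≤ b) (hz : 0 < z) :
    klTerm a z - klTerm b z ≤ Real.log (a / z) * (a - b) := by
  have h := klTerm_nonneg hb ha
  unfold klTerm at *
  rcases hb.eq_or_lt with rfl | hb
  · simp; linarith
  · rw [Real.log_div ha.ne' hz.ne', Real.log_div hb.ne' hz.ne']
    rw [Real.log_div hb.ne' ha.ne'] at h
    nlinarith

/-- The three point identity. -/
lemma klTerm_sub_eq {a b z : ℝ} (ha : 0 < a) (hb : 0 ≤ b) (hz : 0 < z) :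
    klTerm b z - klTerm a z = klTerm b a + Real.log (a / z) * (b - a) := by
  unfold klTerm at *
  rcases hb.eq_or_lt with rfl | hb
  · simp; linarith
  · rw [Real.log_div ha.ne' hz.ne', Real.log_div hb.ne' hz.ne', Real.log_div hb.ne' ha.ne']
    ring

/-- In this form the function is continuous in `a` across `a = 0`, and `z` enters only through `z`
and `log z`. -/
lemma klTerm_eq_negMulLog {a z : ℝ} (hz : 0 < z) :
    klTerm a z = -Real.negMulLog a - a * Real.log z - a + z := by
  unfold klTerm Real.negMulLog
  rcases eq_or_ne a 0 with rfl | ha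
  · simp
  · rw [Real.log_div ha hz.ne']; ring

lemma continuous_klTerm_left {z : ℝ} (hz : 0 < z) : Continuous fun a => klTerm a z := by
  simp_rw [klTerm_eq_negMulLog hz]
  have := Real.continuous_negMulLog
  fun_prop

lemma klPoint_eq {s z : Fin n → ℝ} (hs : ∀ k, 0 ≤ s k) (hz : ∀ k, 0 < z k) :
    klPoint s z = ((∑ k, klTerm (s k) (z k) : ℝ) : EReal) := by
  unfold klPoint klTerm
  rw [if_pos ⟨hs, fun k => (hz k).le, fun k h => absurd h (hz k).ne'⟩]

lemma klPoint_eq_top {s z : Fin n → ℝ} (hs : ¬ ∀ k, 0 ≤ s k) : klPoint s z = ⊤ := by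
  unfold klPoint
  rw [if_neg fun h => hs h.1]

/-! ### Pointwise optimality -/

/-- Proper closed convex functions, nonnegative and finite only on the nonnegative orthant,
whose domain meets the open positive orthant. -/
structure IsPosProper (g : (Fin n → ℝ) → EReal) : Prop where
  isClosed_epi : IsClosed (epi g)
  convex_epi : Convex ℝ (epi g)
  nonneg : ∀ s, 0 ≤ g s
  dom_subset : ∀ s, g s < ⊤ → ∀ k, 0 ≤ s k
  exists_pos : ∃ s : Fin n → ℝ, (∀ k, 0 < s k) ∧ g s < ⊤

lemma IsPosProper.coe_toReal {g : (Fin n → ℝ) → EReal} (hg : IsPosProper g) {s : Fin n → ℝ}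
    (h : g s < ⊤) : (((g s).toReal : ℝ) : EReal) = g s :=
  EReal.coe_toReal h.ne ((EReal.bot_lt_zero.trans_le (hg.nonneg s)).ne')

lemma IsPosProper.mem_epi {g : (Fin n → ℝ) → EReal} (hg : IsPosProper g) {s : Fin n → ℝ}
    (h : g s < ⊤) : (s, (g s).toReal) ∈ epi g := (hg.coe_toReal h).ge

lemma IsPosProper.nonneg_of_mem {g : (Fin n → ℝ) → EReal} (hg : IsPosProper g) {p : (Fin n → ℝ) × ℝ}
    (h : p ∈ epi g) : (∀ k, 0 ≤ p.1 k) ∧ 0 ≤ p.2 :=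
  ⟨hg.dom_subset _ (lt_of_le_of_lt h (EReal.coe_lt_top _)),
    EReal.coe_nonneg.1 ((hg.nonneg _).trans h)⟩

/-- The primal point `e^{u/ε} z` attached to a dual variable `u`. -/
def primalPoint (ε : ℝ) (z u : Fin n → ℝ) : Fin n → ℝ := fun k => Real.exp (u k / ε) * z k

lemma primalPoint_pos {ε : ℝ} {z : Fin n → ℝ} (hz : ∀ k, 0 < z k) (u : Fin n → ℝ) (k : Fin n) :
    0 < primalPoint ε z u k := mul_pos (Real.exp_pos _) (hz k)

/-- The optimality conditions for `min g + ε KL(· | z)`: `-u` is a subgradient of `g` at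
`e^{u/ε} z`, where `g` takes the value `c`. -/
structure IsOpt (g : (Fin n → ℝ) → EReal) (ε : ℝ) (z u : Fin n → ℝ) (c : ℝ) : Prop where
  value_eq : g (primalPoint ε z u) = c
  le : ∀ w, ((c + ∑ k, u k * (primalPoint ε z u k - w k) : ℝ) : EReal) ≤ g w

variable {g : (Fin n → ℝ) → EReal} {ε : ℝ} {z : Fin n → ℝ}

/-- The functional `α + ε KL(s | z)` on the epigraph. -/
def epiObj (ε : ℝ) (z : Fin n → ℝ) (p : (Fin n → ℝ) × ℝ) : ℝ :=
  p.2 + ε * ∑ k, klTerm (p.1 k) (z k)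

lemma continuous_epiObj (hz : ∀ k, 0 < z k) : Continuous (epiObj ε z) := by
  unfold epiObj
  refine continuous_snd.add (continuous_const.mul (continuous_finsetSum _ fun k _ => ?_))
  exact (continuous_klTerm_left (hz k)).comp ((continuous_apply k).comp continuous_fst)

/-- Minimizing over the epigraph replaces lower semicontinuity of `g` by closedness of a set on
which the objective is continuous. A sublevel set lies in a box: nonnegativity bounds it below,
coercivity of KL bounds the point, and nonnegativity of KL bounds the height. -/
lemma IsPosProper.exists_isMinOn_epiObj (hg : IsPosProper g) (hε : 0 < ε) (hz : ∀ k, 0 < z k) :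
    ∃ p ∈ epi g, ∀ q ∈ epi g, epiObj ε z p ≤ epiObj ε z q := by
  obtain ⟨s₀, hs₀, hgs₀⟩ := hg.exists_pos
  set p₀ : (Fin n → ℝ) × ℝ := (s₀, (g s₀).toReal) with hp₀
  have hp₀m : p₀ ∈ epi g := hg.mem_epi hgs₀
  set c := epiObj ε z p₀ with hc
  have hcl : IsClosed (epi g ∩ {p | epiObj ε z p ≤ c}) :=
    hg.isClosed_epi.inter (isClosed_le (continuous_epiObj hz) continuous_const)
  have hsub : epi g ∩ {p | epiObj ε z p ≤ c} ⊆
      Set.Icc 0 ((fun k => c / ε + z k * (Real.exp 1 - 1)), c) := by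
    rintro ⟨s, α⟩ ⟨hm, hle⟩
    obtain ⟨hs, hα⟩ := hg.nonneg_of_mem hm
    simp only at hs hα
    have hle' : α + ε * ∑ k, klTerm (s k) (z k) ≤ c := hle
    have hnn : ∀ k, 0 ≤ klTerm (s k) (z k) := fun k => klTerm_nonneg (hs k) (hz k)
    refine ⟨⟨hs, hα⟩, ⟨fun k => ?_, ?_⟩⟩
    · have h1 : klTerm (s k) (z k) ≤ ∑ k, klTerm (s k) (z k) :=
        Finset.single_le_sum (fun j _ => hnn j) (Finset.mem_univ k)
      have h2 : ∑ k, klTerm (s k) (z k) ≤ c / ε := by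
        rw [le_div_iff₀ hε]; nlinarith
      have := le_klTerm_add (hs k) (hz k)
      simp only
      linarith
    · have := mul_nonneg hε.le (Finset.sum_nonneg fun k (_ : k ∈ Finset.univ) => hnn k)
      simp only
      linarith
  have hcomp : IsCompact (epi g ∩ {p | epiObj ε z p ≤ c}) :=
    isCompact_Icc.of_isClosed_subset hcl hsub
  obtain ⟨p, hp, hmin⟩ := hcomp.exists_isMinOn ⟨p₀, hp₀m, hc.ge⟩ (continuous_epiObj hz).continuousOn
  refine ⟨p, hp.1, fun q hq => ?_⟩
  by_cases h : epiObj ε z q ≤ c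
  · exact hmin ⟨hq, h⟩
  · exact le_trans hp.2 (not_le.1 h).le

/-- First order information at a minimizer, along segments. -/
lemma IsPosProper.segment_ineq (hg : IsPosProper g) (hε : 0 < ε) (hz : ∀ k, 0 < z k)
    {p q : (Fin n → ℝ) × ℝ} (hp : p ∈ epi g) (hq : q ∈ epi g)
    (hmin : ∀ q ∈ epi g, epiObj ε z p ≤ epiObj ε z q) {t : ℝ} (ht0 : 0 < t) (ht1 : t < 1)
    (hpos : ∀ k, 0 < p.1 k + t * (q.1 k - p.1 k)) :
    0 ≤ q.2 - p.2 +
      ε * ∑ k, Real.log ((p.1 k + t * (q.1 k - p.1 k)) / z k) * (q.1 k - p.1 k) := by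
  have hps := (hg.nonneg_of_mem hp).1
  have hmem : (fun k => p.1 k + t * (q.1 k - p.1 k), p.2 + t * (q.2 - p.2)) ∈ epi g := by
    have h := hg.convex_epi hp hq (by linarith : (0 : ℝ) ≤ 1 - t) ht0.le (by ring)
    convert h using 1
    ext k
    · simp; ring
    · simp; ring
  have h := hmin _ hmem
  unfold epiObj at h
  simp only at h
  -- The gradient is taken at the moved point, since coordinates of `p` may still vanish; convexity
  -- gives the inequality in the useful direction.
  have h2 : ∑ k, klTerm (p.1 k + t * (q.1 k - p.1 k)) (z k) - ∑ k, klTerm (p.1 k) (z k) ≤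
      t * ∑ k, Real.log ((p.1 k + t * (q.1 k - p.1 k)) / z k) * (q.1 k - p.1 k) := by
    rw [← Finset.sum_sub_distrib, Finset.mul_sum]
    refine Finset.sum_le_sum fun k _ => ?_
    refine (klTerm_sub_le (hpos k) (hps k) (hz k)).trans_eq ?_
    ring
  have h3 := mul_le_mul_of_nonneg_left h2 hε.le
  have h4 : 0 ≤ t * (q.2 - p.2 +
      ε * ∑ k, Real.log ((p.1 k + t * (q.1 k - p.1 k)) / z k) * (q.1 k - p.1 k)) := by
    linarith
  exact nonneg_of_mul_nonneg_right h4 ht0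

/-- If `p` had a zero coordinate, a move of size `t` towards a feasible point of the open orthant
would contribute a slope `ε s₀ log t`, which tends to `-∞` as `t → 0`, while the other terms stay
bounded above. -/
lemma IsPosProper.pos_of_isMinOn (hg : IsPosProper g) (hε : 0 < ε) (hz : ∀ k, 0 < z k)
    {p : (Fin n → ℝ) × ℝ} (hp : p ∈ epi g)
    (hmin : ∀ q ∈ epi g, epiObj ε z p ≤ epiObj ε z q) (k : Fin n) : 0 < p.1 k := by
  obtain ⟨s₀, hs₀, hgs₀⟩ := hg.exists_pos
  have hq := hg.mem_epi hgs₀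
  set α := (g s₀).toReal
  have hps := (hg.nonneg_of_mem hp).1
  by_contra hk
  have hk0 : p.1 k = 0 := le_antisymm (not_lt.1 hk) (hps k)
  have key : ∀ t : ℝ, 0 < t → t < 1 →
      0 ≤ α - p.2 + ε * (∑ j, Real.log (s₀ j / z j) * (s₀ j - p.1 j) + Real.log t * s₀ k) := by
    intro t ht0 ht1
    have hpos : ∀ j, 0 < p.1 j + t * (s₀ j - p.1 j) := fun j => by
      nlinarith [mul_pos ht0 (hs₀ j), mul_nonneg (sub_nonneg.2 ht1.le) (hps j)]
    refine (hg.segment_ineq hε hz hp hq hmin ht0 ht1 hpos).trans ?_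
    have hterm : ∀ j, Real.log ((p.1 j + t * (s₀ j - p.1 j)) / z j) * (s₀ j - p.1 j) ≤
        Real.log (s₀ j / z j) * (s₀ j - p.1 j) + if j = k then Real.log t * s₀ k else 0 := by
      intro j
      split_ifs with hjk
      · subst hjk
        rw [hk0, Real.log_div (hs₀ j).ne' (hz j).ne']
        simp only [sub_zero, zero_add]
        rw [Real.log_div (mul_pos ht0 (hs₀ j)).ne' (hz j).ne', Real.log_mul ht0.ne' (hs₀ j).ne']
        linarith
      -- The moved coordinate lies between `p.1 j` and `s₀ j`, so replacing it by `s₀ j` inside the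
      -- logarithm increases the product, whatever the sign of `s₀ j - p.1 j`.
      · rw [add_zero]
        rcases le_total (p.1 j) (s₀ j) with h | h
        · refine mul_le_mul_of_nonneg_right (Real.log_le_log (div_pos (hpos j) (hz j)) ?_)
            (sub_nonneg.2 h)
          refine div_le_div_of_nonneg_right ?_ (hz j).le
          nlinarith
        · refine mul_le_mul_of_nonpos_right (Real.log_le_log (div_pos (hs₀ j) (hz j)) ?_)
            (sub_nonpos.2 h)
          refine div_le_div_of_nonneg_right ?_ (hz j).le
          nlinarith
    have := Finset.sum_le_sum fun j (_ : j ∈ Finset.univ) => hterm j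
    rw [Finset.sum_add_distrib, Finset.sum_ite_eq' Finset.univ k] at this
    simp only [Finset.mem_univ, if_true] at this
    have := mul_le_mul_of_nonneg_left this hε.le
    linarith
  set A := α - p.2 + ε * ∑ j, Real.log (s₀ j / z j) * (s₀ j - p.1 j) with hA
  have hd : 0 < ε * s₀ k := mul_pos hε (hs₀ k)
  -- This `t` makes `ε s₀ log t` equal to `-(|A| + 1)`, which contradicts `0 ≤ A + ε s₀ log t`.
  have h1 := key (Real.exp (-(|A| + 1) / (ε * s₀ k))) (Real.exp_pos _)
    (Real.exp_lt_one_iff.2 (div_neg_of_neg_of_pos (by linarith [abs_nonneg A]) hd))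
  rw [Real.log_exp] at h1
  have h2 : ε * (-(|A| + 1) / (ε * s₀ k) * s₀ k) = -(|A| + 1) := by
    have := (hs₀ k).ne'
    field_simp
  have := le_abs_self A
  nlinarith

/-- Let `t → 0` in the segment inequality at the minimizer; positivity of `p` makes the logarithms
continuous at `t = 0`. The limit says that `-ε log (p / z)` is a subgradient. -/
theorem IsPosProper.exists_isOpt (hg : IsPosProper g) (hε : 0 < ε) (hz : ∀ k, 0 < z k) :
    ∃ u c, IsOpt g ε z u c := by
  obtain ⟨p, hp, hmin⟩ := hg.exists_isMinOn_epiObj hε hz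
  have hpos := hg.pos_of_isMinOn hε hz hp hmin
  have hlt : g p.1 < ⊤ := lt_of_le_of_lt hp (EReal.coe_lt_top _)
  have hval : g p.1 = (p.2 : EReal) := by
    refine le_antisymm hp ?_
    have h := hmin _ (hg.mem_epi hlt)
    unfold epiObj at h
    rw [← hg.coe_toReal hlt, EReal.coe_le_coe_iff]
    linarith
  have hprim : primalPoint ε z (fun k => ε * Real.log (p.1 k / z k)) = p.1 := by
    ext k
    unfold primalPoint
    rw [mul_div_cancel_left₀ _ hε.ne', Real.exp_log (div_pos (hpos k) (hz k)),
      div_mul_cancel₀ _ (hz k).ne']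
  refine ⟨fun k => ε * Real.log (p.1 k / z k), p.2, by rw [hprim, hval], fun w => ?_⟩
  rw [hprim]
  rcases eq_or_ne (g w) ⊤ with hw | hw
  · rw [hw]; exact le_top
  have hq := hg.mem_epi (lt_top_iff_ne_top.2 hw)
  rw [← hg.coe_toReal (lt_top_iff_ne_top.2 hw), EReal.coe_le_coe_iff]
  set β := (g w).toReal
  have hws := (hg.nonneg_of_mem hq).1
  have hlim : Filter.Tendsto (fun t : ℝ => β - p.2 +
      ε * ∑ k, Real.log ((p.1 k + t * (w k - p.1 k)) / z k) * (w k - p.1 k))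
      (nhdsWithin 0 (Set.Ioi 0)) (nhds (β - p.2 +
      ε * ∑ k, Real.log ((p.1 k + 0 * (w k - p.1 k)) / z k) * (w k - p.1 k))) := by
    refine Filter.Tendsto.mono_left ?_ nhdsWithin_le_nhds
    refine ContinuousAt.tendsto (f := fun t : ℝ => β - p.2 +
      ε * ∑ k, Real.log ((p.1 k + t * (w k - p.1 k)) / z k) * (w k - p.1 k)) ?_
    refine continuousAt_const.add (continuousAt_const.mul ?_)
    refine tendsto_finsetSum _ fun k _ => ?_
    refine ContinuousAt.tendsto (f := fun t : ℝ => _) ?_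
    refine ContinuousAt.mul (ContinuousAt.log ?_ ?_) continuousAt_const
    · fun_prop
    · simpa using ⟨(hpos k).ne', (hz k).ne'⟩
  have h0 : 0 ≤ β - p.2 +
      ε * ∑ k, Real.log ((p.1 k + 0 * (w k - p.1 k)) / z k) * (w k - p.1 k) := by
    refine ge_of_tendsto hlim ?_
    filter_upwards [Ioo_mem_nhdsGT (zero_lt_one' ℝ)] with t ht
    refine hg.segment_ineq hε hz hp hq hmin ht.1 ht.2 fun k => ?_
    nlinarith [mul_nonneg ht.1.le (hws k), mul_pos (sub_pos.2 ht.2) (hpos k)]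
  have h5 : ∑ k, ε * Real.log (p.1 k / z k) * (p.1 k - w k) =
      -(ε * ∑ k, Real.log ((p.1 k + 0 * (w k - p.1 k)) / z k) * (w k - p.1 k)) := by
    rw [Finset.mul_sum, ← Finset.sum_neg_distrib]
    refine Finset.sum_congr rfl fun k _ => ?_
    simp only [zero_mul, add_zero]
    ring
  rw [h5]
  linarith

/-! ### Consequences of the optimality conditions -/

variable {u : Fin n → ℝ} {c : ℝ}

lemma IsOpt.nonneg (h : IsOpt g ε z u c) (hg : IsPosProper g) : 0 ≤ c := by
  have := hg.nonneg (primalPoint ε z u)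
  rwa [h.value_eq, EReal.coe_nonneg] at this

/-- The supremum defining the conjugate is tested at the primal point. At `w = u` the subgradient
inequality makes this an equality. -/
lemma IsOpt.le_conj (h : IsOpt g ε z u c) (w : Fin n → ℝ) :
    ((-(∑ k, w k * primalPoint ε z u k) - c : ℝ) : EReal) ≤ conj g (-w) := by
  refine le_trans (le_of_eq ?_) (le_iSup _ (primalPoint ε z u))
  rw [h.value_eq, ← EReal.coe_sub]
  congr 2
  rw [← Finset.sum_neg_distrib]
  exact Finset.sum_congr rfl fun k _ => by simp [mul_comm]

lemma IsOpt.conj_eq (h : IsOpt g ε z u c) :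
    conj g (-u) = ((-(∑ k, u k * primalPoint ε z u k) - c : ℝ) : EReal) := by
  refine le_antisymm (iSup_le fun s => ?_) (h.le_conj u)
  refine (EReal.sub_le_sub le_rfl (h.le s)).trans ?_
  rw [← EReal.coe_sub, EReal.coe_le_coe_iff]
  simp only [Pi.neg_apply, mul_sub, Finset.sum_sub_distrib, mul_neg, Finset.sum_neg_distrib]
  have : ∑ k, s k * u k = ∑ k, u k * s k := Finset.sum_congr rfl fun k _ => mul_comm _ _
  linarith

/-- The weighted exponential sum `∑ e^{u_k/ε} z_k`, with weights in `[0,∞]`. -/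
def expSum (ε : ℝ) (z : Fin n → ℝ≥0∞) (u : Fin n → ℝ) : ℝ≥0∞ :=
  ∑ k, ENNReal.ofReal (Real.exp (u k / ε)) * z k

lemma expSum_ofReal (hz : ∀ k, 0 < z k) (w : Fin n → ℝ) :
    expSum ε (fun k => ENNReal.ofReal (z k)) w = ENNReal.ofReal (∑ k, primalPoint ε z w k) := by
  unfold expSum
  rw [ENNReal.ofReal_sum_of_nonneg fun k _ => (primalPoint_pos hz w k).le]
  exact Finset.sum_congr rfl fun k _ => (ENNReal.ofReal_mul (Real.exp_pos _).le).symm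

lemma dualObj_ofReal (hz : ∀ k, 0 < z k) (w : Fin n → ℝ) :
    dualObj g ε (fun k => ENNReal.ofReal (z k)) w =
      -conj g (-w) - ((ε * ∑ k, primalPoint ε z w k : ℝ) : EReal) := by
  have h := expSum_ofReal (ε := ε) hz w
  unfold expSum at h
  unfold dualObj
  rw [h, EReal.coe_ennreal_ofReal, max_eq_left, EReal.coe_mul]
  exact Finset.sum_nonneg fun k _ => (primalPoint_pos hz w k).le

/-- The Bregman identity for the weighted exponential, in terms of `KL(e^{u/ε} z | e^{w/ε} z)`. -/
lemma bregman_eq (hε : 0 < ε) (hz : ∀ k, 0 < z k) (w : Fin n → ℝ) :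
    ∑ k, w k * primalPoint ε z u k - ε * ∑ k, primalPoint ε z w k +
      ε * ∑ k, klTerm (primalPoint ε z u k) (primalPoint ε z w k) =
    ∑ k, u k * primalPoint ε z u k - ε * ∑ k, primalPoint ε z u k := by
  simp only [Finset.mul_sum, ← Finset.sum_sub_distrib, ← Finset.sum_add_distrib]
  refine Finset.sum_congr rfl fun k _ => ?_
  have h : Real.log (primalPoint ε z u k / primalPoint ε z w k) = (u k - w k) / ε := by
    unfold primalPoint
    rw [mul_div_mul_right _ _ (hz k).ne', ← Real.exp_sub, Real.log_exp]
    ring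
  unfold klTerm
  rw [h]
  field_simp
  ring

lemma IsOpt.dualObj_eq (h : IsOpt g ε z u c) (hz : ∀ k, 0 < z k) :
    dualObj g ε (fun k => ENNReal.ofReal (z k)) u =
      ((∑ k, u k * primalPoint ε z u k + c - ε * ∑ k, primalPoint ε z u k : ℝ) : EReal) := by
  rw [dualObj_ofReal hz, h.conj_eq, ← EReal.coe_neg, ← EReal.coe_sub]
  congr 1; ring

/-- The conjugate is bounded below by its affine minorant, and the exponential term is expanded
exactly by the Bregman identity. The leftover KL term yields both maximality and uniqueness of `u`.
-/
lemma IsOpt.dualObj_le (h : IsOpt g ε z u c) (hε : 0 < ε) (hz : ∀ k, 0 < z k) (w : Fin n → ℝ) :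
    dualObj g ε (fun k => ENNReal.ofReal (z k)) w ≤
      ((∑ k, u k * primalPoint ε z u k + c - ε * ∑ k, primalPoint ε z u k
        - ε * ∑ k, klTerm (primalPoint ε z u k) (primalPoint ε z w k) : ℝ) : EReal) := by
  rw [dualObj_ofReal hz]
  refine (EReal.sub_le_sub (EReal.neg_le_neg_iff.2 (h.le_conj w)) le_rfl).trans ?_
  rw [← EReal.coe_neg, ← EReal.coe_sub, EReal.coe_le_coe_iff]
  linarith [bregman_eq (u := u) hε hz w]

lemma sum_klTerm_nonneg {s t : Fin n → ℝ} (hs : ∀ k, 0 ≤ s k) (ht : ∀ k, 0 < t k) :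
    0 ≤ ∑ k, klTerm (s k) (t k) := Finset.sum_nonneg fun k _ => klTerm_nonneg (hs k) (ht k)

lemma eq_of_sum_klTerm_le_zero {s t : Fin n → ℝ} (hs : ∀ k, 0 ≤ s k) (ht : ∀ k, 0 < t k)
    (h : ∑ k, klTerm (s k) (t k) ≤ 0) : s = t := by
  ext k
  refine eq_of_klTerm_le_zero (hs k) (ht k) (le_trans ?_ h)
  exact Finset.single_le_sum (f := fun k => klTerm (s k) (t k))
    (fun j _ => klTerm_nonneg (hs j) (ht j)) (Finset.mem_univ k)

lemma primalPoint_injective (hε : 0 < ε) (hz : ∀ k, 0 < z k) {w : Fin n → ℝ}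
    (h : primalPoint ε z u = primalPoint ε z w) : u = w := by
  ext k
  have h1 := congrFun h k
  unfold primalPoint at h1
  have h2 := Real.exp_injective (mul_right_cancel₀ (hz k).ne' h1)
  field_simp at h2
  exact h2

lemma IsOpt.isMax (h : IsOpt g ε z u c) (hε : 0 < ε) (hz : ∀ k, 0 < z k) (w : Fin n → ℝ) :
    dualObj g ε (fun k => ENNReal.ofReal (z k)) w ≤
      dualObj g ε (fun k => ENNReal.ofReal (z k)) u := by
  rw [h.dualObj_eq hz]
  refine (h.dualObj_le hε hz w).trans (EReal.coe_le_coe_iff.2 ?_)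
  have := mul_nonneg hε.le (sum_klTerm_nonneg (fun k => (primalPoint_pos (ε := ε) hz u k).le)
    (primalPoint_pos (ε := ε) hz w))
  linarith

lemma IsOpt.eq_of_dualObj_le (h : IsOpt g ε z u c) (hε : 0 < ε) (hz : ∀ k, 0 < z k)
    {w : Fin n → ℝ} (hw : dualObj g ε (fun k => ENNReal.ofReal (z k)) u ≤
      dualObj g ε (fun k => ENNReal.ofReal (z k)) w) : w = u := by
  rw [h.dualObj_eq hz] at hw
  have h1 := EReal.coe_le_coe_iff.1 (hw.trans (h.dualObj_le hε hz w))
  refine (primalPoint_injective hε hz (eq_of_sum_klTerm_le_zero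
    (fun k => (primalPoint_pos (ε := ε) hz u k).le) (primalPoint_pos (ε := ε) hz w) ?_)).symm
  have : ε * ∑ k, klTerm (primalPoint ε z u k) (primalPoint ε z w k) ≤ 0 := by linarith
  exact nonpos_of_mul_nonpos_right this hε

/-- No differentiation at the maximizer is needed: an optimal point exists, and the KL gap forces
every maximizer to coincide with it. -/
lemma IsPosProper.isOpt_of_isMax (hg : IsPosProper g) (hε : 0 < ε) (hz : ∀ k, 0 < z k)
    (hu : ∀ w, dualObj g ε (fun k => ENNReal.ofReal (z k)) w ≤
      dualObj g ε (fun k => ENNReal.ofReal (z k)) u) : ∃ c, IsOpt g ε z u c := by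
  obtain ⟨u', c, h⟩ := hg.exists_isOpt hε hz
  obtain rfl := h.eq_of_dualObj_le hε hz (hu u')
  exact ⟨c, h⟩

/-- The gap in the primal objective is at least `ε KL(w | e^{u/ε} z)`. -/
lemma IsOpt.epiObj_le (h : IsOpt g ε z u c) (hg : IsPosProper g) (hε : 0 < ε) (hz : ∀ k, 0 < z k)
    {p : (Fin n → ℝ) × ℝ} (hp : p ∈ epi g) :
    epiObj ε z (primalPoint ε z u, c) + ε * ∑ k, klTerm (p.1 k) (primalPoint ε z u k) ≤
      epiObj ε z p := by
  have h1 := EReal.coe_le_coe_iff.1 ((h.le p.1).trans hp)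
  have hs := (hg.nonneg_of_mem hp).1
  unfold epiObj
  simp only
  have h2 : ε * ∑ k, klTerm (p.1 k) (z k) - ε * ∑ k, klTerm (primalPoint ε z u k) (z k) =
      ε * ∑ k, klTerm (p.1 k) (primalPoint ε z u k)
        - ∑ k, u k * (primalPoint ε z u k - p.1 k) := by
    simp only [Finset.mul_sum, ← Finset.sum_sub_distrib]
    refine Finset.sum_congr rfl fun k _ => ?_
    have hlog : ε * Real.log (primalPoint ε z u k / z k) = u k := by
      unfold primalPoint
      rw [mul_div_cancel_right₀ _ (hz k).ne', Real.log_exp, mul_div_cancel₀ _ hε.ne']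
    rw [← mul_sub, klTerm_sub_eq (primalPoint_pos hz u k) (hs k) (hz k), mul_add, ← mul_assoc,
      hlog]
    ring
  linarith

lemma epiObj_coe {s : Fin n → ℝ} {α : ℝ} (hs : ∀ k, 0 ≤ s k) (hz : ∀ k, 0 < z k) :
    (epiObj ε z (s, α) : EReal) = (α : EReal) + (ε : EReal) * klPoint s z := by
  rw [klPoint_eq hs hz, ← EReal.coe_mul, ← EReal.coe_add]; rfl

lemma IsOpt.primal_eq (h : IsOpt g ε z u c) (hz : ∀ k, 0 < z k) :
    g (primalPoint ε z u) + (ε : EReal) * klPoint (primalPoint ε z u) z =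
      (epiObj ε z (primalPoint ε z u, c) : EReal) := by
  rw [h.value_eq, epiObj_coe (fun k => (primalPoint_pos hz u k).le) hz]

lemma primal_eq_top (hε : 0 < ε) {w : Fin n → ℝ} (hw : g w = ⊤) :
    g w + (ε : EReal) * klPoint w z = ⊤ := by
  rw [hw]
  -- In `EReal` the sum `⊤ + ⊥` is `⊥`, so the KL term has to be shown different from `⊥`.
  refine EReal.top_add_of_ne_bot ?_
  unfold klPoint
  split_ifs
  · rw [← EReal.coe_mul]; exact EReal.coe_ne_bot _
  · rw [EReal.coe_mul_top_of_pos hε]; exact top_ne_bot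

lemma IsOpt.isKLProx (h : IsOpt g ε z u c) (hg : IsPosProper g) (hε : 0 < ε) (hz : ∀ k, 0 < z k) :
    IsKLProx g ε z (primalPoint ε z u) := by
  intro w
  by_cases hw : g w = ⊤
  · rw [primal_eq_top hε hw]; exact le_top
  have hw' := lt_top_iff_ne_top.2 hw
  have hm := hg.mem_epi hw'
  have hs := (hg.nonneg_of_mem hm).1
  rw [h.primal_eq hz, ← hg.coe_toReal hw', ← epiObj_coe hs hz, EReal.coe_le_coe_iff]
  have := mul_nonneg hε.le (sum_klTerm_nonneg hs (primalPoint_pos (ε := ε) hz u))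
  have := h.epiObj_le hg hε hz hm
  linarith

lemma IsOpt.eq_of_primal_le (h : IsOpt g ε z u c) (hg : IsPosProper g) (hε : 0 < ε)
    (hz : ∀ k, 0 < z k) {w : Fin n → ℝ}
    (hw : g w + (ε : EReal) * klPoint w z ≤
      g (primalPoint ε z u) + (ε : EReal) * klPoint (primalPoint ε z u) z) :
    w = primalPoint ε z u := by
  rw [h.primal_eq hz] at hw
  by_cases hw' : g w = ⊤
  · rw [primal_eq_top hε hw'] at hw
    exact absurd hw (not_le.2 (EReal.coe_lt_top _))
  have hw' := lt_top_iff_ne_top.2 hw'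
  have hm := hg.mem_epi hw'
  have hs := (hg.nonneg_of_mem hm).1
  rw [← hg.coe_toReal hw', ← epiObj_coe hs hz, EReal.coe_le_coe_iff] at hw
  have h1 := h.epiObj_le hg hε hz hm
  refine eq_of_sum_klTerm_le_zero hs (primalPoint_pos (ε := ε) hz u) ?_
  have : ε * ∑ k, klTerm (w k) (primalPoint ε z u k) ≤ 0 := by
    simp only at h1
    linarith
  exact nonpos_of_mul_nonpos_right this hε

end

section

variable {X : Type*} [MeasurableSpace X] {n : ℕ}

/-! ### Measurability of normal integrands -/

/-- An open set in the product is a countable union of boxes `A × B`; for each box the condition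
splits into "the epigraph meets `A`" and "`z x ∈ B`". All later measurability is expressed through
such hitting conditions. -/
lemma IsNormalIntegrand.measurableSet_exists_mem {f : X → (Fin n → ℝ) → EReal}
    (hf : IsNormalIntegrand f) {Z : Type*} [TopologicalSpace Z] [SecondCountableTopology Z]
    [MeasurableSpace Z] [OpensMeasurableSpace Z] {z : X → Z} (hz : Measurable z)
    {W : Set (((Fin n → ℝ) × ℝ) × Z)} (hW : IsOpen W) :
    MeasurableSet {x | ∃ p ∈ epi (f x), (p, z x) ∈ W} := by
  set 𝒜 := TopologicalSpace.countableBasis ((Fin n → ℝ) × ℝ)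
  set ℬ := TopologicalSpace.countableBasis Z
  have hA := TopologicalSpace.isBasis_countableBasis ((Fin n → ℝ) × ℝ)
  have hB := TopologicalSpace.isBasis_countableBasis Z
  have heq : {x | ∃ p ∈ epi (f x), (p, z x) ∈ W} =
      ⋃ A ∈ 𝒜, ⋃ B ∈ {B ∈ ℬ | A ×ˢ B ⊆ W}, {x | (epi (f x) ∩ A).Nonempty} ∩ z ⁻¹' B := by
    ext x
    simp only [Set.mem_ofPred_eq, Set.mem_iUnion, Set.mem_inter_iff, Set.mem_preimage]
    constructor
    · rintro ⟨p, hp, hW'⟩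
      obtain ⟨O, ⟨A, hA', B, hB', rfl⟩, hmem, hsub⟩ :=
        (hA.prod hB).exists_subset_of_mem_open hW' hW
      exact ⟨A, hA', B, ⟨hB', hsub⟩, ⟨p, hp, hmem.1⟩, hmem.2⟩
    · rintro ⟨A, _, B, ⟨_, hsub⟩, ⟨p, hp, hpA⟩, hB'⟩
      exact ⟨p, hp, hsub ⟨hpA, hB'⟩⟩
  rw [heq]
  refine MeasurableSet.biUnion (TopologicalSpace.countable_countableBasis _) fun A hA' => ?_
  refine MeasurableSet.biUnion
    ((TopologicalSpace.countable_countableBasis _).mono fun B hB' => hB'.1) fun B hB' => ?_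
  exact (hf.measurable_epi A (hA.isOpen hA')).inter (hz (hB.isOpen hB'.1).measurableSet)

lemma coe_sub_le_conj {g : (Fin n → ℝ) → EReal} {p : (Fin n → ℝ) × ℝ} (hp : p ∈ epi g)
    (w : Fin n → ℝ) : ((∑ k, p.1 k * w k - p.2 : ℝ) : EReal) ≤ conj g w := by
  refine le_trans ?_ (le_iSup _ p.1)
  rw [EReal.coe_sub]
  exact EReal.sub_le_sub le_rfl hp

/-- The conjugate as a supremum of a continuous function over the epigraph, so that its strict
superlevel sets are hitting conditions for an open set. -/
lemma lt_conj_iff {g : (Fin n → ℝ) → EReal} (hg : ∀ s, 0 ≤ g s) (w : Fin n → ℝ) (c : EReal) :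
    c < conj g w ↔ ∃ p ∈ epi g, c < ((∑ k, p.1 k * w k - p.2 : ℝ) : EReal) := by
  constructor
  · intro h
    obtain ⟨s, hs⟩ := lt_iSup_iff.1 h
    have htop : g s ≠ ⊤ := fun h' => by simp [h'] at hs
    have hbot : g s ≠ ⊥ := (EReal.bot_lt_zero.trans_le (hg s)).ne'
    have hcoe := EReal.coe_toReal htop hbot
    refine ⟨(s, (g s).toReal), hcoe.ge, ?_⟩
    rwa [EReal.coe_sub, hcoe]
  · rintro ⟨p, hp, h⟩
    exact h.trans_le (coe_sub_le_conj hp w)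

lemma IsNormalIntegrand.measurable_conj {f : X → (Fin n → ℝ) → EReal}
    (hf : IsNormalIntegrand f) (h0 : ∀ x s, 0 ≤ f x s) {w : X → Fin n → ℝ} (hw : Measurable w) :
    Measurable fun x => conj (f x) (w x) := by
  refine measurable_of_Ioi fun c => ?_
  have hW : IsOpen {q : ((Fin n → ℝ) × ℝ) × (Fin n → ℝ) |
      c < ((∑ k, q.1.1 k * q.2 k - q.1.2 : ℝ) : EReal)} :=
    isOpen_lt continuous_const (continuous_coe_real_ereal.comp (by fun_prop))
  convert hf.measurableSet_exists_mem hw hW using 1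
  ext x
  exact lt_conj_iff (h0 x) _ _

lemma IsNormalIntegrand.measurable_comp {f : X → (Fin n → ℝ) → EReal}
    (hf : IsNormalIntegrand f) (h0 : ∀ x s, 0 ≤ f x s) {w : X → Fin n → ℝ} (hw : Measurable w) :
    Measurable fun x => f x (w x) := by
  refine measurable_of_Iic fun c => ?_
  induction c using EReal.rec with
  | bot =>
    convert MeasurableSet.empty
    ext x
    simpa using (EReal.bot_lt_zero.trans_le (h0 x (w x))).ne'
  | top => convert MeasurableSet.univ; ext x; simp
  | coe c =>
    -- Since the epigraph is closed, membership of `(w x, c)` means that every ball of radius `1 /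
    -- (m + 1)` around it meets the epigraph.
    have hW : ∀ m : ℕ, IsOpen {q : ((Fin n → ℝ) × ℝ) × ((Fin n → ℝ) × ℝ) |
        dist q.1 q.2 < 1 / ((m : ℝ) + 1)} := fun m =>
      isOpen_lt (by fun_prop) continuous_const
    have hwc : Measurable fun x => (w x, c) := hw.prodMk measurable_const
    convert MeasurableSet.iInter fun m : ℕ => hf.measurableSet_exists_mem hwc (hW m) using 1
    ext x
    simp only [Set.mem_preimage, Set.mem_Iic, Set.mem_iInter, Set.mem_ofPred_eq]
    constructor
    · intro h m
      exact ⟨(w x, c), h, by rw [dist_self]; positivity⟩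
    · intro h
      have : (w x, c) ∈ closure (epi (f x)) := by
        refine Metric.mem_closure_iff.2 fun δ hδ => ?_
        obtain ⟨m, hm⟩ := exists_nat_one_div_lt hδ
        obtain ⟨p, hp, hd⟩ := h m
        exact ⟨p, hp, by rw [dist_comm]; exact hd.trans hm⟩
      rwa [(hf.isClosed_epi x).closure_eq] at this

lemma measurable_klPoint : Measurable fun p : (Fin n → ℝ) × (Fin n → ℝ) => klPoint p.1 p.2 := by
  unfold klPoint
  refine Measurable.ite ?_ ?_ measurable_const
  · refine MeasurableSet.inter ?_ (MeasurableSet.inter ?_ ?_)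
    · exact measurableSet_setOfPred.2 (Measurable.forall fun k => measurableSet_setOfPred.1
        (measurableSet_le measurable_const (by fun_prop)))
    · exact measurableSet_setOfPred.2 (Measurable.forall fun k => measurableSet_setOfPred.1
        (measurableSet_le measurable_const (by fun_prop)))
    · refine measurableSet_setOfPred.2 (Measurable.forall fun k => Measurable.imp ?_ ?_)
      · exact measurableSet_setOfPred.1 (measurableSet_eq_fun (by fun_prop) measurable_const)
      · exact measurableSet_setOfPred.1 (measurableSet_eq_fun (by fun_prop) measurable_const)
  · refine measurable_coe_real_ereal.comp ?_
    fun_prop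

/-! ### Measurable selection of the optimal dual variable -/

/-- A point with objective within `ε δ²` of the minimum has `√(p_k)` within `δ` of the square root
at the optimum, by the KL gap. Constraining near-minimizers to `p_k < a` therefore constrains the
optimum to `≤ a`. -/
lemma IsOpt.primalPoint_le_of_forall_lt {g : (Fin n → ℝ) → EReal} {ε : ℝ} {z u : Fin n → ℝ} {c : ℝ}
    (h : IsOpt g ε z u c) (hg : IsPosProper g) (hε : 0 < ε) (hz : ∀ k, 0 < z k) {k : Fin n} {a : ℝ}
    (ha : ∀ q : ℚ, epiObj ε z (primalPoint ε z u, c) < q →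
      ∃ p ∈ epi g, p.1 k < a ∧ epiObj ε z p < q) : primalPoint ε z u k ≤ a := by
  set s := primalPoint ε z u with hs
  have hspos : ∀ k, 0 < s k := primalPoint_pos hz u
  set θ := epiObj ε z (s, c)
  have hbound : ∀ δ : ℝ, 0 < δ → √(s k) ≤ √a + δ := by
    intro δ hδ
    obtain ⟨q, hq1, hq2⟩ := exists_rat_btwn (show θ < θ + ε * δ ^ 2 by
      have := mul_pos hε (pow_pos hδ 2); linarith)
    obtain ⟨p, hp, hpa, hpq⟩ := ha q hq1
    have hp0 := (hg.nonneg_of_mem hp).1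
    have h1 := h.epiObj_le hg hε hz hp
    have h2 : klTerm (p.1 k) (s k) ≤ ∑ k, klTerm (p.1 k) (s k) :=
      Finset.single_le_sum (f := fun k => klTerm (p.1 k) (s k))
        (fun j _ => klTerm_nonneg (hp0 j) (hspos j)) (Finset.mem_univ k)
    have h3 := sq_sqrt_sub_sqrt_le_klTerm (hp0 k) (hspos k)
    have h4 : (√(p.1 k) - √(s k)) ^ 2 ≤ δ ^ 2 := by
      have : ε * ∑ k, klTerm (p.1 k) (s k) < ε * δ ^ 2 := by linarith
      exact (h3.trans h2).trans (lt_of_mul_lt_mul_left this hε.le).le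
    have h5 := (abs_le_of_sq_le_sq' h4 hδ.le).1
    have h6 := Real.sqrt_le_sqrt hpa.le
    linarith
  have h7 : √(s k) ≤ √a := le_of_forall_pos_le_add hbound
  by_contra hlt
  rw [not_le] at hlt
  exact absurd (Real.sqrt_lt_sqrt_iff_of_pos (hspos k) |>.2 hlt) (not_lt.2 h7)

/-- Uniqueness replaces a selection theorem: whether a coordinate of the minimizer lies below `a`
can be read off from which rational levels of the objective are reached, with and without a
constraint on that coordinate. These are countably many hitting conditions. -/
lemma measurable_of_isOpt {f : X → (Fin n → ℝ) → EReal} (hf : IsNormalIntegrand f)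
    (hg : ∀ x, IsPosProper (f x)) {ε : ℝ} (hε : 0 < ε) {z u : X → Fin n → ℝ} {c : X → ℝ}
    (hzm : Measurable z) (hz : ∀ x k, 0 < z x k) (h : ∀ x, IsOpt (f x) ε (z x) (u x) (c x)) :
    Measurable u := by
  have hzk : ∀ k, Measurable fun x => z x k := fun k => (measurable_pi_apply k).comp hzm
  -- The parameter is the pair `(log z, z)`, so that the objective is jointly continuous on the
  -- whole space.
  have hobj : Continuous fun q : ((Fin n → ℝ) × ℝ) × ((Fin n → ℝ) × (Fin n → ℝ)) =>
      q.1.2 + ε * ∑ k, (-Real.negMulLog (q.1.1 k) - q.1.1 k * q.2.1 k - q.1.1 k + q.2.2 k) := by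
    have := Real.continuous_negMulLog
    fun_prop
  have hparam : Measurable fun x => ((fun k => Real.log (z x k)), z x) :=
    (measurable_pi_lambda _ fun k => (hzk k).log).prodMk hzm
  have hobj_eq : ∀ x p, epiObj ε (z x) p =
      p.2 + ε * ∑ k, (-Real.negMulLog (p.1 k) - p.1 k * Real.log (z x k) - p.1 k + z x k) := by
    intro x p
    unfold epiObj
    simp_rw [klTerm_eq_negMulLog (hz x _)]
  have hlev : ∀ k (a q : ℝ), MeasurableSet
      {x | ∃ p ∈ epi (f x), p.1 k < a ∧ epiObj ε (z x) p < q} := by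
    intro k a q
    have hW := (isOpen_lt (f := fun q : ((Fin n → ℝ) × ℝ) × ((Fin n → ℝ) × (Fin n → ℝ)) =>
      q.1.1 k) (by fun_prop) (continuous_const (y := a))).inter
      (isOpen_lt hobj (continuous_const (y := q)))
    convert hf.measurableSet_exists_mem hparam hW using 1
    ext x
    simp only [hobj_eq]
    rfl
  have hlev' : ∀ q : ℝ, MeasurableSet {x | ∃ p ∈ epi (f x), epiObj ε (z x) p < q} := by
    intro q
    convert hf.measurableSet_exists_mem hparam
      (isOpen_lt hobj (continuous_const (y := q))) using 1
    ext x
    simp only [hobj_eq]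
    rfl
  have hmem : ∀ x, (primalPoint ε (z x) (u x), c x) ∈ epi (f x) := fun x => (h x).value_eq.le
  have hs : ∀ k, Measurable fun x => primalPoint ε (z x) (u x) k := by
    intro k
    refine measurable_of_Iio fun a => ?_
    -- The rational `b < a` makes room between the nonstrict bound supplied by near-minimizers and
    -- the strict inequality wanted.
    have heq : (fun x => primalPoint ε (z x) (u x) k) ⁻¹' Set.Iio a =
        ⋃ b ∈ {b : ℚ | (b : ℝ) < a}, ⋂ q : ℚ,
          ({x | ∃ p ∈ epi (f x), epiObj ε (z x) p < (q : ℝ)}ᶜ ∪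
            {x | ∃ p ∈ epi (f x), p.1 k < (b : ℝ) ∧ epiObj ε (z x) p < (q : ℝ)}) := by
      ext x
      simp only [Set.mem_preimage, Set.mem_Iio, Set.mem_iUnion, Set.mem_iInter, Set.mem_union,
        Set.mem_compl_iff, Set.mem_ofPred_eq]
      constructor
      · intro hx
        obtain ⟨b, hb1, hb2⟩ := exists_rat_btwn hx
        refine ⟨b, hb2, fun q => ?_⟩
        by_cases hq : ∃ p ∈ epi (f x), epiObj ε (z x) p < (q : ℝ)
        · right
          obtain ⟨p, hp, hpq⟩ := hq
          refine ⟨_, hmem x, hb1, lt_of_le_of_lt ?_ hpq⟩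
          have := (h x).epiObj_le (hg x) hε (hz x) hp
          have := mul_nonneg hε.le (sum_klTerm_nonneg ((hg x).nonneg_of_mem hp).1
            (primalPoint_pos (ε := ε) (hz x) (u x)))
          linarith
        · exact Or.inl hq
      · rintro ⟨b, hb, hx⟩
        refine lt_of_le_of_lt ((h x).primalPoint_le_of_forall_lt (hg x) hε (hz x) fun q hq => ?_) hb
        exact (hx q).resolve_left fun hn => hn ⟨_, hmem x, hq⟩
    rw [heq]
    refine MeasurableSet.biUnion (Set.to_countable _) fun b _ => MeasurableSet.iInter fun q => ?_
    exact (hlev' q).compl.union (hlev k b q)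
  refine measurable_pi_lambda _ fun k => ?_
  have hu : (fun x => u x k) = fun x => ε * Real.log (primalPoint ε (z x) (u x) k / z x k) := by
    ext x
    unfold primalPoint
    rw [mul_div_cancel_right₀ _ (hz x k).ne', Real.log_exp, mul_div_cancel₀ _ hε.ne']
  rw [hu]
  exact measurable_const.mul ((hs k).div (hzk k)).log

lemma IsAdmissible.isPosProper {f : X → (Fin n → ℝ) → EReal} {μ : Measure X}
    (hf : IsAdmissible f μ) (hpos : ∀ x, ∃ s : Fin n → ℝ, (∀ k, 0 < s k) ∧ f x s < ⊤) (x : X) :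
    IsPosProper (f x) :=
  ⟨hf.normal.isClosed_epi x, hf.convex x, hf.nonneg x, hf.dom_subset x, hpos x⟩

lemma dualObj_eq_toReal {g : (Fin n → ℝ) → EReal} {ε : ℝ} {z : Fin n → ℝ≥0∞}
    (hz : ∀ k, z k ≠ ⊤) :
    dualObj g ε z = dualObj g ε fun k => ENNReal.ofReal (z k).toReal := by
  congr
  exact funext fun k => (ENNReal.ofReal_toReal (hz k)).symm

/-- Dual steps are the functions which are pointwise optimal. -/
lemma IsDualStep.isOpt {f : X → (Fin n → ℝ) → EReal} {μ : Measure X} {ε : ℝ} (hε : 0 < ε)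
    (hg : ∀ x, IsPosProper (f x)) {z : X → Fin n → ℝ≥0∞}
    (hz : ∀ᵐ x ∂μ, ∀ k, z x k ≠ 0 ∧ z x k ≠ ⊤) {u : X → Fin n → ℝ}
    (hu : IsDualStep f ε μ z u) :
    ∀ᵐ x ∂μ, ∃ c, IsOpt (f x) ε (fun k => (z x k).toReal) (u x) c := by
  filter_upwards [hz, hu.2] with x hzx hux
  rw [dualObj_eq_toReal fun k => (hzx k).2] at hux
  exact (hg x).isOpt_of_isMax hε (fun k => ENNReal.toReal_pos (hzx k).1 (hzx k).2) hux

lemma isDualStep_of_isOpt {f : X → (Fin n → ℝ) → EReal} {μ : Measure X} {ε : ℝ} (hε : 0 < ε)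
    {z : X → Fin n → ℝ≥0∞} (hz : ∀ᵐ x ∂μ, ∀ k, z x k ≠ 0 ∧ z x k ≠ ⊤) {u : X → Fin n → ℝ}
    (hum : Measurable u) (hu : ∀ᵐ x ∂μ, ∃ c, IsOpt (f x) ε (fun k => (z x k).toReal) (u x) c) :
    IsDualStep f ε μ z u := by
  refine ⟨hum, ?_⟩
  filter_upwards [hz, hu] with x hzx ⟨c, hc⟩
  rw [dualObj_eq_toReal fun k => (hzx k).2]
  exact hc.isMax hε fun k => ENNReal.toReal_pos (hzx k).1 (hzx k).2

lemma exists_isDualStep {f : X → (Fin n → ℝ) → EReal} {μ : Measure X} {ε : ℝ} (hε : 0 < ε)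
    (hf : IsNormalIntegrand f) (hg : ∀ x, IsPosProper (f x)) {z : X → Fin n → ℝ≥0∞}
    (hzm : Measurable z) (hz : ∀ᵐ x ∂μ, ∀ k, z x k ≠ 0 ∧ z x k ≠ ⊤) :
    ∃ u, IsDualStep f ε μ z u := by
  -- The value `1` replaces entries that are `0` or `∞`, which occur only on a null set, so that an
  -- optimal point can be chosen at every `x`.
  set ζ : X → Fin n → ℝ := fun x k => if 0 < (z x k).toReal then (z x k).toReal else 1 with hζ
  have hzk : ∀ k, Measurable fun x => (z x k).toReal := fun k =>
    ((measurable_pi_apply k).comp hzm).ennreal_toReal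
  have hζm : Measurable ζ := measurable_pi_lambda _ fun k =>
    Measurable.ite (measurableSet_lt measurable_const (hzk k)) (hzk k) measurable_const
  have hζpos : ∀ x k, 0 < ζ x k := fun x k => by
    simp only [hζ]
    split_ifs with h
    exacts [h, one_pos]
  choose u c h using fun x => (hg x).exists_isOpt hε (hζpos x)
  refine ⟨u, isDualStep_of_isOpt hε hz (measurable_of_isOpt hf hg hε hζm hζpos h) ?_⟩
  filter_upwards [hz] with x hzx
  refine ⟨c x, ?_⟩
  convert h x using 1
  ext k
  simp only [hζ]
  rw [if_pos (ENNReal.toReal_pos (hzx k).1 (hzx k).2)]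

lemma IsDualStep.ae_eq {f : X → (Fin n → ℝ) → EReal} {μ : Measure X} {ε : ℝ} (hε : 0 < ε)
    (hg : ∀ x, IsPosProper (f x)) {z : X → Fin n → ℝ≥0∞}
    (hz : ∀ᵐ x ∂μ, ∀ k, z x k ≠ 0 ∧ z x k ≠ ⊤) {u v : X → Fin n → ℝ}
    (hu : IsDualStep f ε μ z u) (hv : IsDualStep f ε μ z v) : u =ᵐ[μ] v := by
  filter_upwards [hz, hu.2, hv.isOpt hε hg hz] with x hzx hux ⟨c, hc⟩
  rw [dualObj_eq_toReal fun k => (hzx k).2] at hux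
  exact hc.eq_of_dualObj_le hε (fun k => ENNReal.toReal_pos (hzx k).1 (hzx k).2) (hux _)

/-- The exponential of a dual step is a scaling step. -/
lemma IsDualStep.isScalingStep {f : X → (Fin n → ℝ) → EReal} {μ : Measure X} {ε : ℝ} (hε : 0 < ε)
    (hg : ∀ x, IsPosProper (f x)) {z : X → Fin n → ℝ≥0∞} (hzm : Measurable z)
    (hz : ∀ᵐ x ∂μ, ∀ k, z x k ≠ 0 ∧ z x k ≠ ⊤) {u : X → Fin n → ℝ}
    (hu : IsDualStep f ε μ z u) : IsScalingStep f ε μ z (expScale ε u) := by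
  have huk : ∀ k, Measurable fun x => u x k := fun k => (measurable_pi_apply k).comp hu.1
  have ham : Measurable (expScale ε u) := measurable_pi_lambda _ fun k =>
    Real.measurable_exp.comp ((huk k).div_const ε)
  refine ⟨ham, fun x => primalPoint ε (fun k => (z x k).toReal) (u x), ?_, ?_⟩
  · exact measurable_pi_lambda _ fun k => ((measurable_pi_apply k).comp ham).mul
      ((measurable_pi_apply k).comp hzm).ennreal_toReal
  · filter_upwards [hz, hu.isOpt hε hg hz] with x hzx ⟨c, hc⟩
    have hpos : ∀ k, 0 < (z x k).toReal := fun k => ENNReal.toReal_pos (hzx k).1 (hzx k).2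
    refine ⟨fun k => lt_top_iff_ne_top.2 (hzx k).2, hc.isKLProx (hg x) hε hpos, fun k => ?_⟩
    exact (mul_div_cancel_right₀ _ (hpos k).ne').symm

/-- Scaling steps are exponentials of dual steps. -/
lemma IsScalingStep.ae_eq {f : X → (Fin n → ℝ) → EReal} {μ : Measure X} {ε : ℝ} (hε : 0 < ε)
    (hg : ∀ x, IsPosProper (f x)) {z : X → Fin n → ℝ≥0∞}
    (hz : ∀ᵐ x ∂μ, ∀ k, z x k ≠ 0 ∧ z x k ≠ ⊤) {u a : X → Fin n → ℝ}
    (hu : IsDualStep f ε μ z u) (ha : IsScalingStep f ε μ z a) : a =ᵐ[μ] expScale ε u := by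
  obtain ⟨_, s, _, hs⟩ := ha
  filter_upwards [hz, hu.isOpt hε hg hz, hs] with x hzx ⟨c, hc⟩ ⟨_, hprox, hax⟩
  have hpos : ∀ k, 0 < (z x k).toReal := fun k => ENNReal.toReal_pos (hzx k).1 (hzx k).2
  ext k
  rw [hax k, hc.eq_of_primal_le (hg x) hε hpos (hprox _)]
  exact mul_div_cancel_right₀ _ (hpos k).ne'

end

section

variable {X : Type*} [MeasurableSpace X] {n : ℕ}

/-! ### Extended integrals -/

lemma extIntegral_eq_integral {μ : Measure X} {g : X → EReal} (hg : Measurable g)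
    (hp : ∫⁻ x, (g x).toENNReal ∂μ ≠ ⊤) (hn : ∫⁻ x, (-g x).toENNReal ∂μ ≠ ⊤) :
    (∀ᵐ x ∂μ, g x = ((g x).toReal : EReal)) ∧ Integrable (fun x => (g x).toReal) μ ∧
      extIntegral μ g = ((∫ x, (g x).toReal ∂μ : ℝ) : EReal) := by
  have hpm : Measurable fun x => (g x).toENNReal := hg.ereal_toENNReal
  have hnm : Measurable fun x => (-g x).toENNReal := hg.neg.ereal_toENNReal
  have hfin : ∀ᵐ x ∂μ, g x = ((g x).toReal : EReal) := by
    filter_upwards [ae_lt_top hpm hp, ae_lt_top hnm hn] with x h1 h2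
    refine (EReal.coe_toReal ?_ ?_).symm
    · intro h; simp [h] at h1
    · intro h; simp [h] at h2
  have hpe : ∀ᵐ x ∂μ, (g x).toENNReal = ENNReal.ofReal (g x).toReal := by
    filter_upwards [hfin] with x hx
    exact EReal.toENNReal_of_ne_top (by rw [hx]; exact EReal.coe_ne_top _)
  have hne : ∀ᵐ x ∂μ, (-g x).toENNReal = ENNReal.ofReal (-(g x).toReal) := by
    filter_upwards [hfin] with x hx
    rw [hx, ← EReal.coe_neg, EReal.toENNReal_of_ne_top (EReal.coe_ne_top _)]; simp
  have hm : Measurable fun x => (g x).toReal := hg.ereal_toReal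
  have hint : Integrable (fun x => (g x).toReal) μ := by
    refine ⟨hm.aestronglyMeasurable, ?_⟩
    rw [hasFiniteIntegral_iff_norm]
    have : ∀ᵐ x ∂μ, ENNReal.ofReal ‖(g x).toReal‖ ≤ (g x).toENNReal + (-g x).toENNReal := by
      filter_upwards [hpe, hne] with x h1 h2
      rw [h1, h2, Real.norm_eq_abs]
      rcases abs_cases (g x).toReal with ⟨h, _⟩ | ⟨h, _⟩ <;> rw [h]
      · exact le_self_add
      · exact le_add_self
    refine (lintegral_mono_ae this).trans_lt ?_
    rw [lintegral_add_left hpm]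
    exact ENNReal.add_lt_top.2 ⟨hp.lt_top, hn.lt_top⟩
  refine ⟨hfin, hint, ?_⟩
  rw [integral_eq_lintegral_pos_part_sub_lintegral_neg_part hint, ← lintegral_congr_ae hpe,
    ← lintegral_congr_ae hne]
  unfold extIntegral
  rw [if_neg hp, EReal.coe_sub]
  congr 1
  · exact (EReal.coe_ennreal_toReal hp).symm
  · exact (EReal.coe_ennreal_toReal hn).symm

lemma extIntegral_ne_top {μ : Measure X} {g : X → EReal}
    (hp : ∫⁻ x, (g x).toENNReal ∂μ ≠ ⊤) : extIntegral μ g ≠ ⊤ := by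
  unfold extIntegral
  rw [if_neg hp]
  rw [sub_eq_add_neg]
  refine EReal.add_ne_top ?_ ?_
  · rwa [Ne, EReal.coe_ennreal_eq_top_iff]
  · rw [Ne, EReal.neg_eq_top_iff]
    exact EReal.coe_ennreal_ne_bot _

/-! ### The pointwise and the integral dual problems -/

lemma measurable_expSum {ε : ℝ} {z : X → Fin n → ℝ≥0∞} (hz : Measurable z) {w : X → Fin n → ℝ}
    (hw : Measurable w) : Measurable fun x => expSum ε (z x) (w x) := by
  unfold expSum
  refine Finset.measurable_sum _ fun k _ => Measurable.mul ?_ ((measurable_pi_apply k).comp hz)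
  exact (Real.measurable_exp.comp
    (((measurable_pi_apply k).comp hw).div_const ε)).ennreal_ofReal

/-- The real-valued negative dual integrand. -/
def dualIntegrand (f : X → (Fin n → ℝ) → EReal) (ε : ℝ) (z : X → Fin n → ℝ≥0∞)
    (w : X → Fin n → ℝ) (x : X) : ℝ :=
  (conj (f x) (-w x)).toReal + ε * (expSum ε (z x) (w x)).toReal

/-- All the integrals in the integral dual objective are finite. -/
structure DualFinite (f : X → (Fin n → ℝ) → EReal) (ε : ℝ) (μ : Measure X)
    (z : X → Fin n → ℝ≥0∞) (w : X → Fin n → ℝ) : Prop where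
  pos : ∫⁻ x, (conj (f x) (-w x)).toENNReal ∂μ ≠ ⊤
  neg : ∫⁻ x, (-conj (f x) (-w x)).toENNReal ∂μ ≠ ⊤
  exp : ∫⁻ x, expSum ε (z x) (w x) ∂μ ≠ ⊤

variable {f : X → (Fin n → ℝ) → EReal} {ε : ℝ} {μ : Measure X} {z : X → Fin n → ℝ≥0∞}
  {u w : X → Fin n → ℝ}

lemma dualFunctional_eq (w : X → Fin n → ℝ) : dualFunctional f ε μ z w =
    -extIntegral μ (fun x => conj (f x) (-w x)) -
      (ε : EReal) * ((∫⁻ x, expSum ε (z x) (w x) ∂μ : ℝ≥0∞) : EReal) := rfl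

lemma dualFunctional_ne_bot (hp : ∫⁻ x, (conj (f x) (-w x)).toENNReal ∂μ ≠ ⊤)
    (he : ∫⁻ x, expSum ε (z x) (w x) ∂μ ≠ ⊤) : dualFunctional f ε μ z w ≠ ⊥ := by
  rw [dualFunctional_eq, ← EReal.coe_ennreal_toReal he, ← EReal.coe_mul, sub_eq_add_neg,
    ← EReal.coe_neg, Ne, EReal.add_eq_bot_iff, not_or]
  refine ⟨?_, EReal.coe_ne_bot _⟩
  rw [EReal.neg_eq_bot_iff]
  exact extIntegral_ne_top hp

lemma dualFinite_of_ne (hε : 0 < ε) (hbot : dualFunctional f ε μ z w ≠ ⊥)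
    (htop : dualFunctional f ε μ z w ≠ ⊤) : DualFinite f ε μ z w := by
  rw [dualFunctional_eq, sub_eq_add_neg] at hbot htop
  rw [Ne, EReal.add_eq_bot_iff, not_or] at hbot
  have hp : ∫⁻ x, (conj (f x) (-w x)).toENNReal ∂μ ≠ ⊤ := by
    intro h
    refine hbot.1 ?_
    unfold extIntegral
    rw [if_pos h, EReal.neg_top]
  have he : ∫⁻ x, expSum ε (z x) (w x) ∂μ ≠ ⊤ := by
    intro h
    refine hbot.2 ?_
    rw [h, EReal.coe_ennreal_top, EReal.coe_mul_top_of_pos hε, EReal.neg_top]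
  refine ⟨hp, fun h => htop ?_, he⟩
  unfold extIntegral
  rw [if_neg hp, h, EReal.coe_ennreal_top, ← EReal.coe_ennreal_toReal hp, sub_eq_add_neg,
    EReal.neg_top, EReal.add_bot, EReal.neg_bot, ← EReal.coe_ennreal_toReal he, ← EReal.coe_mul, ← EReal.coe_neg]
  exact EReal.top_add_coe _

lemma DualFinite.integrable_expSum (h : DualFinite f ε μ z w) (hz : Measurable z)
    (hw : Measurable w) : Integrable (fun x => (expSum ε (z x) (w x)).toReal) μ :=
  integrable_toReal_of_lintegral_ne_top (measurable_expSum hz hw).aemeasurable h.exp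

lemma DualFinite.spec (h : DualFinite f ε μ z w) (hf : IsNormalIntegrand f)
    (h0 : ∀ x s, 0 ≤ f x s) (hz : Measurable z) (hw : Measurable w) :
    (∀ᵐ x ∂μ, conj (f x) (-w x) = ((conj (f x) (-w x)).toReal : EReal)) ∧
      Integrable (dualIntegrand f ε z w) μ ∧
      dualFunctional f ε μ z w = ((-∫ x, dualIntegrand f ε z w x ∂μ : ℝ) : EReal) := by
  obtain ⟨h1, h2, h3⟩ := extIntegral_eq_integral (hf.measurable_conj h0 hw.neg) h.pos h.neg
  simp only [Pi.neg_apply] at h1 h2 h3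
  have h4 := h.integrable_expSum hz hw
  refine ⟨h1, h2.add (h4.const_mul ε), ?_⟩
  have h5 : ∫ x, dualIntegrand f ε z w x ∂μ = ∫ x, (conj (f x) (-w x)).toReal ∂μ +
      ε * ∫ x, (expSum ε (z x) (w x)).toReal ∂μ := by
    unfold dualIntegrand
    rw [integral_add h2 (h4.const_mul ε), integral_const_mul]
  have h6 : ∫ x, (expSum ε (z x) (w x)).toReal ∂μ = (∫⁻ x, expSum ε (z x) (w x) ∂μ).toReal :=
    integral_toReal (measurable_expSum hz hw).aemeasurable
      (ae_lt_top (measurable_expSum hz hw) h.exp)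
  rw [dualFunctional_eq, h3, ← EReal.coe_ennreal_toReal h.exp, ← EReal.coe_mul, ← EReal.coe_neg,
    ← EReal.coe_sub, h5, h6]
  congr 1
  ring

lemma expSum_eq_ofReal {ζ : Fin n → ℝ≥0∞} (hζ : ∀ k, ζ k ≠ 0 ∧ ζ k ≠ ⊤) (v : Fin n → ℝ) :
    expSum ε ζ v = ENNReal.ofReal (∑ k, primalPoint ε (fun k => (ζ k).toReal) v k) := by
  rw [← expSum_ofReal fun k => ENNReal.toReal_pos (hζ k).1 (hζ k).2]
  congr
  exact funext fun k => (ENNReal.ofReal_toReal (hζ k).2).symm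

lemma toReal_expSum {ζ : Fin n → ℝ≥0∞} (hζ : ∀ k, ζ k ≠ 0 ∧ ζ k ≠ ⊤) (v : Fin n → ℝ) :
    (expSum ε ζ v).toReal = ∑ k, primalPoint ε (fun k => (ζ k).toReal) v k := by
  rw [expSum_eq_ofReal hζ, ENNReal.toReal_ofReal]
  exact Finset.sum_nonneg fun k _ =>
    (primalPoint_pos (fun k => ENNReal.toReal_pos (hζ k).1 (hζ k).2) v k).le

/-- The gap between the dual integrands at an arbitrary and at the optimal function. -/
lemma dualIntegrand_le {Ω : Type*} {f : Ω → (Fin n → ℝ) → EReal} {z : Ω → Fin n → ℝ≥0∞}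
    {u w : Ω → Fin n → ℝ} (hε : 0 < ε) {x : Ω} (hz : ∀ k, z x k ≠ 0 ∧ z x k ≠ ⊤) {c : ℝ}
    (hc : IsOpt (f x) ε (fun k => (z x k).toReal) (u x) c)
    (hw : conj (f x) (-w x) = ((conj (f x) (-w x)).toReal : EReal)) :
    dualIntegrand f ε z u x +
      ε * ∑ k, klTerm (primalPoint ε (fun k => (z x k).toReal) (u x) k)
        (primalPoint ε (fun k => (z x k).toReal) (w x) k) ≤ dualIntegrand f ε z w x := by
  have hpos : ∀ k, 0 < (z x k).toReal := fun k => ENNReal.toReal_pos (hz k).1 (hz k).2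
  have h1 := hc.le_conj (w x)
  rw [hw, EReal.coe_le_coe_iff] at h1
  have h2 := bregman_eq (u := u x) hε hpos (w x)
  unfold dualIntegrand
  rw [toReal_expSum hz, toReal_expSum hz, hc.conj_eq, EReal.toReal_coe]
  linarith

/-- A truncation argument: if the integral dual problem has a finite value, then the
exponential term is integrable at the pointwise maximizer. -/
lemma lintegral_expSum_ne_top [IsProbabilityMeasure μ] (hε : 0 < ε) (hf : IsNormalIntegrand f)
    (h0 : ∀ x s, 0 ≤ f x s) (hzm : Measurable z) (hz : ∀ᵐ x ∂μ, ∀ k, z x k ≠ 0 ∧ z x k ≠ ⊤)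
    (hum : Measurable u)
    (hu : ∀ᵐ x ∂μ, ∃ c, IsOpt (f x) ε (fun k => (z x k).toReal) (u x) c)
    (hwm : Measurable w) (hw : DualFinite f ε μ z w) (htop : dualValue f ε μ z ≠ ⊤) :
    ∫⁻ x, expSum ε (z x) (u x) ∂μ ≠ ⊤ := by
  classical
  have heu := measurable_expSum (ε := ε) hzm hum
  have hew := measurable_expSum (ε := ε) hzm hwm
  obtain ⟨hwr, hwi, hwD⟩ := hw.spec hf h0 hzm hwm
  -- The competitor `v m` equals `u` where the exponential term is at most `m`, and equals the
  -- admissible `w` elsewhere.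
  set A : ℕ → Set X := fun m => {x | expSum ε (z x) (u x) ≤ m} with hA
  have hAm : ∀ m, MeasurableSet (A m) := fun m => measurableSet_le heu measurable_const
  set v : ℕ → X → Fin n → ℝ := fun m => (A m).piecewise u w with hv
  have hvm : ∀ m, Measurable (v m) := fun m => hum.piecewise (hAm m) hwm
  have hvin : ∀ m x, x ∈ A m → v m x = u x := fun m x hx => Set.piecewise_eq_of_mem _ _ _ hx
  have hvout : ∀ m x, x ∉ A m → v m x = w x := fun m x hx =>
    Set.piecewise_eq_of_notMem _ _ _ hx
  set V := (dualValue f ε μ z).toReal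
  -- With `J` the negative dual integrand, the gap bound and `s ≤ KL(s | t) + (e - 1) t` give
  -- `expSum(v m) ≤ (J w - J (v m)) / ε + e · expSum(w)` pointwise, and `-∫ J (v m) ≤ V`. The
  -- constant does not depend on `m`.
  set C := (∫ x, dualIntegrand f ε z w x ∂μ + V) / ε +
    Real.exp 1 * ∫ x, (expSum ε (z x) (w x)).toReal ∂μ with hC
  have hwei := hw.integrable_expSum hzm hwm
  have hD : dualValue f ε μ z ≠ ⊥ := by
    refine ne_bot_of_le_ne_bot (dualFunctional_ne_bot hw.pos hw.exp) ?_
    exact le_iSup₂_of_le w hwm le_rfl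
  have hbound : ∀ m, ∫⁻ x, expSum ε (z x) (v m x) ∂μ ≤ ENNReal.ofReal C := by
    intro m
    have hvexp : ∫⁻ x, expSum ε (z x) (v m x) ∂μ ≠ ⊤ := by
      refine ne_top_of_le_ne_top (b := ∫⁻ x, ((m : ℝ≥0∞) + expSum ε (z x) (w x)) ∂μ) ?_ ?_
      · rw [lintegral_add_left measurable_const]
        simpa using hw.exp
      · refine lintegral_mono fun x => ?_
        by_cases hx : x ∈ A m
        · simp only [hvin m x hx]
          exact le_trans hx le_self_add
        · simp only [hvout m x hx]
          exact le_add_self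
    have hvpos : ∫⁻ x, (conj (f x) (-v m x)).toENNReal ∂μ ≠ ⊤ := by
      refine ne_top_of_le_ne_top (b := ∫⁻ x, ((conj (f x) (-w x)).toENNReal +
        ENNReal.ofReal ε * expSum ε (z x) (w x)) ∂μ) ?_ ?_
      · rw [lintegral_add_right _ (hew.const_mul _), lintegral_const_mul _ hew]
        exact ENNReal.add_ne_top.2 ⟨hw.pos, ENNReal.mul_ne_top ENNReal.ofReal_ne_top hw.exp⟩
      · refine lintegral_mono_ae ?_
        filter_upwards [hz, hu, hwr] with x hzx ⟨c, hc⟩ hwx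
        by_cases hx : x ∈ A m
        · have h1 := dualIntegrand_le (w := w) hε hzx hc hwx
          have hpos : ∀ k, 0 < (z x k).toReal := fun k => ENNReal.toReal_pos (hzx k).1 (hzx k).2
          have h2 := mul_nonneg hε.le (sum_klTerm_nonneg
            (fun k => (primalPoint_pos (ε := ε) hpos (u x) k).le)
            (primalPoint_pos (ε := ε) hpos (w x)))
          have h3 : 0 ≤ ε * (expSum ε (z x) (u x)).toReal :=
            mul_nonneg hε.le ENNReal.toReal_nonneg
          have h4 : expSum ε (z x) (w x) ≠ ⊤ := by
            rw [expSum_eq_ofReal hzx]; exact ENNReal.ofReal_ne_top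
          rw [hvin m x hx, hwx, hc.conj_eq, ← ENNReal.ofReal_toReal h4,
            ← ENNReal.ofReal_mul hε.le, EReal.toENNReal_of_ne_top (EReal.coe_ne_top _),
            EReal.toENNReal_of_ne_top (EReal.coe_ne_top _), EReal.toReal_coe, EReal.toReal_coe]
          refine le_trans (ENNReal.ofReal_le_ofReal ?_) ENNReal.ofReal_add_le
          unfold dualIntegrand at h1
          rw [hc.conj_eq, EReal.toReal_coe] at h1
          linarith
        · rw [hvout m x hx]
          exact le_self_add
    have hDle : dualFunctional f ε μ z (v m) ≤ dualValue f ε μ z :=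
      le_iSup₂_of_le (v m) (hvm m) le_rfl
    -- Integrability of the negative part of the conjugate comes only from the dual value being
    -- below `⊤`.
    have hvF : DualFinite f ε μ z (v m) := dualFinite_of_ne hε
      (dualFunctional_ne_bot hvpos hvexp) (ne_top_of_le_ne_top htop hDle)
    obtain ⟨-, hvi, hvD⟩ := hvF.spec hf h0 hzm (hvm m)
    rw [hvD, ← EReal.coe_toReal htop hD, EReal.coe_le_coe_iff] at hDle
    have hvei := hvF.integrable_expSum hzm (hvm m)
    have hpt : ∀ᵐ x ∂μ, (expSum ε (z x) (v m x)).toReal ≤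
        (dualIntegrand f ε z w x - dualIntegrand f ε z (v m) x) / ε +
          Real.exp 1 * (expSum ε (z x) (w x)).toReal := by
      filter_upwards [hz, hu, hwr] with x hzx ⟨c, hc⟩ hwx
      have hpos : ∀ k, 0 < (z x k).toReal := fun k => ENNReal.toReal_pos (hzx k).1 (hzx k).2
      by_cases hx : x ∈ A m
      · have h1 := dualIntegrand_le (w := w) hε hzx hc hwx
        have h2 : dualIntegrand f ε z (v m) x = dualIntegrand f ε z u x := by
          unfold dualIntegrand; rw [hvin m x hx]
        rw [hvin m x hx, h2]
        have h3 : ∑ k, klTerm (primalPoint ε (fun k => (z x k).toReal) (u x) k)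
            (primalPoint ε (fun k => (z x k).toReal) (w x) k) ≤
            (dualIntegrand f ε z w x - dualIntegrand f ε z u x) / ε := by
          rw [le_div_iff₀ hε]; linarith
        have h4 : ∑ k, primalPoint ε (fun k => (z x k).toReal) (u x) k ≤
            ∑ k, (klTerm (primalPoint ε (fun k => (z x k).toReal) (u x) k)
            (primalPoint ε (fun k => (z x k).toReal) (w x) k) +
            primalPoint ε (fun k => (z x k).toReal) (w x) k * (Real.exp 1 - 1)) :=
          Finset.sum_le_sum fun k _ => le_klTerm_add (primalPoint_pos hpos _ k).le
            (primalPoint_pos hpos _ k)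
        rw [Finset.sum_add_distrib, ← Finset.sum_mul, ← toReal_expSum hzx,
          ← toReal_expSum hzx] at h4
        have h5 : 0 ≤ (expSum ε (z x) (w x)).toReal := ENNReal.toReal_nonneg
        linarith
      · have h2 : dualIntegrand f ε z (v m) x = dualIntegrand f ε z w x := by
          unfold dualIntegrand; rw [hvout m x hx]
        rw [hvout m x hx, h2, sub_self, zero_div, zero_add]
        have h5 : 0 ≤ (expSum ε (z x) (w x)).toReal := ENNReal.toReal_nonneg
        have h6 : 1 ≤ Real.exp 1 := Real.one_le_exp zero_le_one
        nlinarith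
    have hdi : Integrable (fun x => dualIntegrand f ε z w x - dualIntegrand f ε z (v m) x) μ :=
      hwi.sub hvi
    have hI := integral_mono_ae hvei
      ((hdi.div_const ε).add (hwei.const_mul (Real.exp 1))) hpt
    simp only [Pi.add_apply] at hI
    rw [integral_add (hdi.div_const ε) (hwei.const_mul (Real.exp 1)), integral_div,
      integral_const_mul, integral_sub hwi hvi,
      integral_toReal (measurable_expSum hzm (hvm m)).aemeasurable
        (ae_lt_top (measurable_expSum hzm (hvm m)) hvexp)] at hI
    rw [← ENNReal.ofReal_toReal hvexp]
    refine ENNReal.ofReal_le_ofReal (hI.trans ?_)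
    rw [hC]
    gcongr
    linarith
  refine ne_top_of_le_ne_top (b := ENNReal.ofReal C) ENNReal.ofReal_ne_top ?_
  -- Fatou's lemma: at almost every point `v m` equals `u` for all large `m`.
  calc ∫⁻ x, expSum ε (z x) (u x) ∂μ
      ≤ ∫⁻ x, Filter.liminf (fun m => expSum ε (z x) (v m x)) Filter.atTop ∂μ := by
        refine lintegral_mono_ae ?_
        filter_upwards [hz] with x hzx
        obtain ⟨m, hm⟩ := ENNReal.exists_nat_gt (r := expSum ε (z x) (u x)) (by
          rw [expSum_eq_ofReal hzx]; exact ENNReal.ofReal_ne_top)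
        refine Filter.le_liminf_of_le (by isBoundedDefault) ?_
        filter_upwards [Filter.eventually_ge_atTop m] with j hj
        rw [hvin j x (hm.le.trans (by exact_mod_cast hj))]
    _ ≤ Filter.liminf (fun m => ∫⁻ x, expSum ε (z x) (v m x) ∂μ) Filter.atTop :=
        lintegral_liminf_le fun m => measurable_expSum hzm (hvm m)
    _ ≤ ENNReal.ofReal C := by
        refine Filter.liminf_le_of_le (by isBoundedDefault) fun b hb => ?_
        obtain ⟨m, hm⟩ := hb.exists
        exact hm.trans (hbound m)

/-- Once all integrals at `u` are finite, the pointwise inequality integrates. Equality of the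
integrals forces equality almost everywhere, so the pointwise KL gap vanishes. -/
theorem isUniqueDualMaximizer_of_isOpt [IsProbabilityMeasure μ] (hε : 0 < ε)
    (hf : IsNormalIntegrand f) (h0 : ∀ x s, 0 ≤ f x s) (hzm : Measurable z)
    (hz : ∀ᵐ x ∂μ, ∀ k, z x k ≠ 0 ∧ z x k ≠ ⊤) (hum : Measurable u)
    (hu : ∀ᵐ x ∂μ, ∃ c, IsOpt (f x) ε (fun k => (z x k).toReal) (u x) c)
    (hbot : dualValue f ε μ z ≠ ⊥) (htop : dualValue f ε μ z ≠ ⊤) :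
    IsUniqueDualMaximizer f ε μ z u := by
  have hle : ∀ w, Measurable w → dualFunctional f ε μ z w ≤ dualValue f ε μ z :=
    fun w hw => le_iSup₂_of_le w hw le_rfl
  have hfin : ∀ w, Measurable w → dualFunctional f ε μ z w ≠ ⊥ → DualFinite f ε μ z w :=
    fun w hw hb => dualFinite_of_ne hε hb (ne_top_of_le_ne_top htop (hle w hw))
  have hpt : ∀ w, Measurable w → DualFinite f ε μ z w →
      ∀ᵐ x ∂μ, dualIntegrand f ε z u x ≤ dualIntegrand f ε z w x := by
    intro w hwm hw
    filter_upwards [hz, hu, (hw.spec hf h0 hzm hwm).1] with x hzx ⟨c, hc⟩ hwx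
    have hpos : ∀ k, 0 < (z x k).toReal := fun k => ENNReal.toReal_pos (hzx k).1 (hzx k).2
    have h1 := dualIntegrand_le (w := w) hε hzx hc hwx
    have h2 := mul_nonneg hε.le (sum_klTerm_nonneg
      (fun k => (primalPoint_pos (ε := ε) hpos (u x) k).le)
      (primalPoint_pos (ε := ε) hpos (w x)))
    linarith
  obtain ⟨w₀, hw₀m, hw₀b⟩ : ∃ w, Measurable w ∧ dualFunctional f ε μ z w ≠ ⊥ := by
    by_contra! h
    refine hbot ?_
    unfold dualValue
    rw [iSup₂_eq_bot]
    exact h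
  have hw₀ := hfin w₀ hw₀m hw₀b
  have huF : DualFinite f ε μ z u := by
    have hexp := lintegral_expSum_ne_top hε hf h0 hzm hz hum hu hw₀m hw₀ htop
    refine hfin u hum (dualFunctional_ne_bot ?_ hexp)
    have hew := measurable_expSum (ε := ε) hzm hw₀m
    refine ne_top_of_le_ne_top (b := ∫⁻ x, ((conj (f x) (-w₀ x)).toENNReal +
      ENNReal.ofReal ε * expSum ε (z x) (w₀ x)) ∂μ) ?_ ?_
    · rw [lintegral_add_right _ (hew.const_mul _), lintegral_const_mul _ hew]
      exact ENNReal.add_ne_top.2 ⟨hw₀.pos, ENNReal.mul_ne_top ENNReal.ofReal_ne_top hw₀.exp⟩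
    · refine lintegral_mono_ae ?_
      filter_upwards [hz, hu, (hw₀.spec hf h0 hzm hw₀m).1, hpt w₀ hw₀m hw₀]
        with x hzx ⟨c, hc⟩ hwx h1
      have h3 : 0 ≤ ε * (expSum ε (z x) (u x)).toReal := mul_nonneg hε.le ENNReal.toReal_nonneg
      have h4 : expSum ε (z x) (w₀ x) ≠ ⊤ := by
        rw [expSum_eq_ofReal hzx]; exact ENNReal.ofReal_ne_top
      rw [hwx, hc.conj_eq, ← ENNReal.ofReal_toReal h4,
        ← ENNReal.ofReal_mul hε.le, EReal.toENNReal_of_ne_top (EReal.coe_ne_top _),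
        EReal.toENNReal_of_ne_top (EReal.coe_ne_top _), EReal.toReal_coe, EReal.toReal_coe]
      refine le_trans (ENNReal.ofReal_le_ofReal ?_) ENNReal.ofReal_add_le
      unfold dualIntegrand at h1
      rw [hc.conj_eq, EReal.toReal_coe] at h1
      linarith
  obtain ⟨-, hui, huD⟩ := huF.spec hf h0 hzm hum
  have hmax : dualFunctional f ε μ z u = dualValue f ε μ z := by
    refine le_antisymm (hle u hum) (iSup₂_le fun w hwm => ?_)
    by_cases hb : dualFunctional f ε μ z w = ⊥
    · rw [hb]; exact bot_le
    have hw := hfin w hwm hb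
    obtain ⟨-, hwi, hwD⟩ := hw.spec hf h0 hzm hwm
    rw [huD, hwD, EReal.coe_le_coe_iff, neg_le_neg_iff]
    exact integral_mono_ae hui hwi (hpt w hwm hw)
  refine ⟨hum, hmax, fun w hwm hwV => ?_⟩
  have hw := hfin w hwm (hwV ▸ hbot)
  obtain ⟨hwr, hwi, hwD⟩ := hw.spec hf h0 hzm hwm
  have heq : ∫ x, dualIntegrand f ε z u x ∂μ = ∫ x, dualIntegrand f ε z w x ∂μ := by
    rw [← hmax, huD, hwD, EReal.coe_eq_coe_iff] at hwV
    linarith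
  filter_upwards [hz, hu, hwr, (integral_eq_iff_of_ae_le hui hwi (hpt w hwm hw)).1 heq]
    with x hzx ⟨c, hc⟩ hwx hx
  have hpos : ∀ k, 0 < (z x k).toReal := fun k => ENNReal.toReal_pos (hzx k).1 (hzx k).2
  have h1 := dualIntegrand_le (w := w) hε hzx hc hwx
  refine (primalPoint_injective hε hpos (eq_of_sum_klTerm_le_zero
    (fun k => (primalPoint_pos (ε := ε) hpos (u x) k).le)
    (primalPoint_pos (ε := ε) hpos (w x)) ?_)).symm
  refine nonpos_of_mul_nonpos_right (a := ε) ?_ hε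
  linarith

/-! ### The pointwise and the integral proximal problems -/

lemma klPoint_nonneg {s ζ : Fin n → ℝ} (hζ : ∀ k, 0 < ζ k) : 0 ≤ klPoint s ζ := by
  by_cases hs : ∀ k, 0 ≤ s k
  · rw [klPoint_eq hs hζ, EReal.coe_nonneg]
    exact sum_klTerm_nonneg hs hζ
  · rw [klPoint_eq_top hs]; exact le_top

lemma measurable_toReal_pi (hzm : Measurable z) : Measurable fun x k => (z x k).toReal :=
  measurable_pi_lambda _ fun k => ((measurable_pi_apply k).comp hzm).ennreal_toReal

lemma proxFunctional_eq (hε : 0 < ε) (h0 : ∀ x s, 0 ≤ f x s) (hzm : Measurable z)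
    (hz : ∀ᵐ x ∂μ, ∀ k, z x k ≠ 0 ∧ z x k ≠ ⊤) (hwm : Measurable w) :
    proxFunctional f ε μ (fun x k => (z x k).toReal) w =
      ∫⁻ x, (f x (w x) + (ε : EReal) * klPoint (w x) fun k => (z x k).toReal).toENNReal ∂μ := by
  have hkm : Measurable fun x => (klPoint (w x) fun k => (z x k).toReal).toENNReal :=
    (measurable_klPoint.comp (hwm.prodMk (measurable_toReal_pi hzm))).ereal_toENNReal
  unfold proxFunctional integralFunctional
  rw [← lintegral_const_mul _ hkm, ← lintegral_add_right _ (hkm.const_mul _)]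
  refine lintegral_congr_ae ?_
  filter_upwards [hz] with x hzx
  have hk : 0 ≤ klPoint (w x) fun k => (z x k).toReal :=
    klPoint_nonneg fun k => ENNReal.toReal_pos (hzx k).1 (hzx k).2
  have hε' : (0 : EReal) ≤ (ε : EReal) := EReal.coe_nonneg.2 hε.le
  rw [EReal.toENNReal_add (h0 _ _) (mul_nonneg hε' hk), EReal.toENNReal_mul hε']
  simp [EReal.toENNReal_of_ne_top]

/-- The integrand is nonnegative, so pointwise minimality integrates directly and no truncation is
needed. A finite value makes equality of integrals imply equality almost everywhere. -/
theorem isUniqueProx_of_isOpt (hε : 0 < ε) (hf : IsNormalIntegrand f) (hg : ∀ x, IsPosProper (f x))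
    (hzm : Measurable z) (hz : ∀ᵐ x ∂μ, ∀ k, z x k ≠ 0 ∧ z x k ≠ ⊤) (hum : Measurable u)
    (hu : ∀ᵐ x ∂μ, ∃ c, IsOpt (f x) ε (fun k => (z x k).toReal) (u x) c)
    (hfin : proxValue f ε μ (fun x k => (z x k).toReal) ≠ ⊤) :
    IsUniqueProx f ε μ (fun x k => (z x k).toReal)
      (fun x k => expScale ε u x k * (z x k).toReal) := by
  have h0 : ∀ x s, 0 ≤ f x s := fun x => (hg x).nonneg
  have hζm := measurable_toReal_pi hzm
  set s : X → Fin n → ℝ := fun x k => expScale ε u x k * (z x k).toReal with hs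
  have hsm : Measurable s := measurable_pi_lambda _ fun k =>
    (Real.measurable_exp.comp (((measurable_pi_apply k).comp hum).div_const ε)).mul
      ((measurable_pi_apply k).comp hζm)
  have hε' : (0 : EReal) ≤ (ε : EReal) := EReal.coe_nonneg.2 hε.le
  have hmin : proxFunctional f ε μ (fun x k => (z x k).toReal) s =
      proxValue f ε μ fun x k => (z x k).toReal := by
    refine le_antisymm (le_iInf₂ fun w hwm => ?_) (iInf₂_le s hsm)
    rw [proxFunctional_eq hε h0 hzm hz hsm, proxFunctional_eq hε h0 hzm hz hwm]
    refine lintegral_mono_ae ?_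
    filter_upwards [hz, hu] with x hzx ⟨c, hc⟩
    exact EReal.toENNReal_le_toENNReal (hc.isKLProx (hg x) hε
      (fun k => ENNReal.toReal_pos (hzx k).1 (hzx k).2) (w x))
  refine ⟨hsm, hmin, fun w hwm hw => ?_⟩
  have hle : ∀ᵐ x ∂μ,
      (f x (s x) + (ε : EReal) * klPoint (s x) fun k => (z x k).toReal).toENNReal ≤
      (f x (w x) + (ε : EReal) * klPoint (w x) fun k => (z x k).toReal).toENNReal := by
    filter_upwards [hz, hu] with x hzx ⟨c, hc⟩
    exact EReal.toENNReal_le_toENNReal (hc.isKLProx (hg x) hε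
      (fun k => ENNReal.toReal_pos (hzx k).1 (hzx k).2) (w x))
  have hobj : Measurable fun x =>
      (f x (w x) + (ε : EReal) * klPoint (w x) fun k => (z x k).toReal).toENNReal := by
    refine ((hf.measurable_comp h0 hwm).add ?_).ereal_toENNReal
    exact measurable_const.mul (measurable_klPoint.comp (hwm.prodMk hζm))
  rw [← hmin] at hfin
  have heq := ae_eq_of_ae_le_of_lintegral_le hle
    (by rwa [← proxFunctional_eq hε h0 hzm hz hsm]) hobj.aemeasurable (by
      rw [← proxFunctional_eq hε h0 hzm hz hsm, ← proxFunctional_eq hε h0 hzm hz hwm, hw, hmin])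
  filter_upwards [hz, hu, heq] with x hzx ⟨c, hc⟩ hx
  have hpos : ∀ k, 0 < (z x k).toReal := fun k => ENNReal.toReal_pos (hzx k).1 (hzx k).2
  rw [EReal.toENNReal_eq_toENNReal (add_nonneg (h0 _ _) (mul_nonneg hε' (klPoint_nonneg hpos)))
    (add_nonneg (h0 _ _) (mul_nonneg hε' (klPoint_nonneg hpos)))] at hx
  exact hc.eq_of_primal_le (hg x) hε hpos hx.ge

theorem IsDualStep.agreesWithIntegralStep [IsProbabilityMeasure μ] (hε : 0 < ε)
    (hf : IsNormalIntegrand f) (hg : ∀ x, IsPosProper (f x)) (hzm : Measurable z)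
    (hz : ∀ᵐ x ∂μ, ∀ k, z x k ≠ 0 ∧ z x k ≠ ⊤) (hu : IsDualStep f ε μ z u) :
    AgreesWithIntegralStep f ε μ z u :=
  ⟨isUniqueDualMaximizer_of_isOpt hε hf (fun x => (hg x).nonneg) hzm hz hu.1 (hu.isOpt hε hg hz),
    isUniqueProx_of_isOpt hε hf hg hzm hz hu.1 (hu.isOpt hε hg hz)⟩

end

section

variable {X Y : Type*} [MeasurableSpace X] [MeasurableSpace Y] {n : ℕ}

/-! ### Kernels -/

/-- Measurable kernels which are positive and bounded almost everywhere. -/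
structure IsPosKernel (K : X × Y → Fin n → ℝ) (μ : Measure X) (ν : Measure Y) : Prop where
  measurable : Measurable K
  pos : ∀ᵐ p ∂(μ.prod ν), ∀ k, 0 < K p k
  bounded : ∃ C : ℝ, ∀ᵐ p ∂(μ.prod ν), ∀ k, K p k ≤ C

lemma ae_prod_swap {μ : Measure X} {ν : Measure Y} [SFinite μ] [SFinite ν] {P : X × Y → Prop}
    (h : ∀ᵐ p ∂(μ.prod ν), P p) : ∀ᵐ p ∂(ν.prod μ), P p.swap :=
  Measure.measurePreserving_swap.quasiMeasurePreserving.ae h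

variable {K : X × Y → Fin n → ℝ} {μ : Measure X} {ν : Measure Y} {ε : ℝ}

/-- `gibbsT K` is by definition `gibbs` of the swapped kernel, so every half-step on `Y` is a
half-step on `X` for swapped data. -/
lemma IsPosKernel.swap [SFinite μ] [SFinite ν] (hK : IsPosKernel K μ ν) :
    IsPosKernel (fun p : Y × X => K p.swap) ν μ :=
  ⟨hK.measurable.comp measurable_swap, ae_prod_swap hK.pos,
    hK.bounded.imp fun _ h => ae_prod_swap h⟩

lemma isPosKernel_of_memLp (hKm : Measurable K) (hK : MemLp K ⊤ (μ.prod ν))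
    (hKpos : ∀ᵐ p ∂(μ.prod ν), ∀ k, 0 < K p k) : IsPosKernel K μ ν := by
  refine ⟨hKm, hKpos, (eLpNormEssSup K (μ.prod ν)).toReal, ?_⟩
  have h := hK.2
  rw [eLpNorm_exponent_top] at h
  filter_upwards [ae_le_eLpNormEssSup (f := K) (μ := μ.prod ν)] with p hp k
  have h1 : ‖K p‖ ≤ (eLpNormEssSup K (μ.prod ν)).toReal := by
    rw [← toReal_enorm]
    exact ENNReal.toReal_mono h.ne hp
  exact (le_abs_self _).trans ((norm_le_pi_norm (K p) k).trans h1)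

lemma measurable_expScale {u : X → Fin n → ℝ} (hu : Measurable u) : Measurable (expScale ε u) :=
  measurable_pi_lambda _ fun k =>
    Real.measurable_exp.comp (((measurable_pi_apply k).comp hu).div_const ε)

lemma measurable_kernel_mul (hK : Measurable K) {b : Y → Fin n → ℝ} (hb : Measurable b)
    (k : Fin n) : Measurable fun p : X × Y => ENNReal.ofReal (K p k * b p.2 k) :=
  (((measurable_pi_apply k).comp hK).mul
    ((measurable_pi_apply k).comp (hb.comp measurable_snd))).ennreal_ofReal

lemma measurable_gibbs [SFinite ν] (hK : Measurable K) {b : Y → Fin n → ℝ} (hb : Measurable b) :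
    Measurable (gibbs K ν b) :=
  measurable_pi_lambda _ fun k => (measurable_kernel_mul hK hb k).lintegral_prod_right'

lemma gibbs_congr {Ω : Type*} {K : Ω × Y → Fin n → ℝ} {b b' : Y → Fin n → ℝ} (h : b =ᵐ[ν] b') : gibbs K ν b = gibbs K ν b' := by
  ext x k
  refine lintegral_congr_ae ?_
  filter_upwards [h] with y hy
  rw [hy]

lemma IsPosKernel.gibbs_ne_zero [SFinite ν] [NeZero ν] (hK : IsPosKernel K μ ν)
    {b : Y → Fin n → ℝ} (hb : Measurable b) (hpos : ∀ y k, 0 < b y k) :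
    ∀ᵐ x ∂μ, ∀ k, gibbs K ν b x k ≠ 0 := by
  filter_upwards [Measure.ae_ae_of_ae_prod hK.pos] with x hx k
  have hm : Measurable fun y => ENNReal.ofReal (K (x, y) k * b y k) :=
    (measurable_kernel_mul hK.measurable hb k).comp measurable_prodMk_left
  unfold gibbs
  rw [Ne, lintegral_eq_zero_iff hm]
  intro h
  have : ∀ᵐ y ∂ν, False := by
    filter_upwards [hx, h] with y h1 h2
    exact absurd h2 (ENNReal.ofReal_pos.2 (mul_pos (h1 k) (hpos y k))).ne'
  simp [NeZero.ne ν] at this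

lemma lintegral_gibbs_comm [SFinite μ] [SFinite ν] (hK : Measurable K) {a : X → Fin n → ℝ}
    {b : Y → Fin n → ℝ} (ham : Measurable a) (hbm : Measurable b) (ha : ∀ x k, 0 ≤ a x k)
    (hb : ∀ y k, 0 ≤ b y k) (k : Fin n) :
    ∫⁻ x, ENNReal.ofReal (a x k) * gibbs K ν b x k ∂μ =
      ∫⁻ y, ENNReal.ofReal (b y k) * gibbsT K μ a y k ∂ν := by
  have hak : Measurable fun x => ENNReal.ofReal (a x k) :=
    ((measurable_pi_apply k).comp ham).ennreal_ofReal
  have hbk : Measurable fun y => ENNReal.ofReal (b y k) :=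
    ((measurable_pi_apply k).comp hbm).ennreal_ofReal
  have hKk : Measurable fun p : X × Y => ENNReal.ofReal (K p k) :=
    ((measurable_pi_apply k).comp hK).ennreal_ofReal
  have h1 : ∀ x, ENNReal.ofReal (a x k) * gibbs K ν b x k =
      ∫⁻ y, ENNReal.ofReal (a x k) * (ENNReal.ofReal (K (x, y) k) * ENNReal.ofReal (b y k)) ∂ν := by
    intro x
    rw [lintegral_const_mul' _ _ ENNReal.ofReal_ne_top]
    unfold gibbs
    simp_rw [ENNReal.ofReal_mul' (hb _ k)]
  have h2 : ∀ y, ENNReal.ofReal (b y k) * gibbsT K μ a y k =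
      ∫⁻ x, ENNReal.ofReal (a x k) * (ENNReal.ofReal (K (x, y) k) * ENNReal.ofReal (b y k)) ∂μ := by
    intro y
    unfold gibbsT
    rw [← lintegral_const_mul' _ _ ENNReal.ofReal_ne_top]
    refine lintegral_congr fun x => ?_
    rw [ENNReal.ofReal_mul' (ha _ k)]
    ring
  simp_rw [h1, h2]
  refine lintegral_lintegral_swap (Measurable.aemeasurable ?_)
  exact (hak.comp measurable_fst).mul (hKk.mul (hbk.comp measurable_snd))

/-- Tonelli moves the finite coupling integral to `∫ b 𝒦ᵀ a`, and `b > 0` prevents `𝒦ᵀ a` from being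
infinite on a set of positive measure. -/
lemma gibbsT_lt_top_of_lintegral [SFinite μ] [SFinite ν] (hK : Measurable K) {a : X → Fin n → ℝ}
    {b : Y → Fin n → ℝ} (ham : Measurable a) (hbm : Measurable b) (ha : ∀ x k, 0 ≤ a x k)
    (hb : ∀ y k, 0 < b y k)
    (h : ∀ k, ∫⁻ x, ENNReal.ofReal (a x k) * gibbs K ν b x k ∂μ ≠ ⊤) :
    ∀ᵐ y ∂ν, ∀ k, gibbsT K μ a y k < ⊤ := by
  rw [ae_all_iff]
  intro k
  have hbk : Measurable fun y => ENNReal.ofReal (b y k) :=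
    ((measurable_pi_apply k).comp hbm).ennreal_ofReal
  have hm : Measurable fun y => gibbsT K μ a y k := (measurable_pi_apply k).comp
    (measurable_gibbs (K := fun p : Y × X => K p.swap) (hK.comp measurable_swap) ham)
  have h1 := h k
  rw [lintegral_gibbs_comm hK ham hbm ha (fun y k => (hb y k).le) k] at h1
  filter_upwards [ae_lt_top (hbk.mul hm) h1] with y hy
  refine lt_top_iff_ne_top.2 fun htop => ?_
  rw [Pi.mul_apply, htop, ENNReal.mul_top (ENNReal.ofReal_pos.2 (hb y k)).ne'] at hy
  exact lt_irrefl _ hy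

lemma IsPosKernel.gibbs_lt_top [SFinite ν] (hK : IsPosKernel K μ ν) {b : Y → Fin n → ℝ}
    (hb : ∀ y k, 0 ≤ b y k) (hfin : ∀ k, ∫⁻ y, ENNReal.ofReal (b y k) ∂ν ≠ ⊤) :
    ∃ C : ℝ, ∀ᵐ x ∂μ, ∀ k,
      gibbs K ν b x k ≤ ENNReal.ofReal C * ∫⁻ y, ENNReal.ofReal (b y k) ∂ν ∧
        gibbs K ν b x k < ⊤ := by
  obtain ⟨C, hC⟩ := hK.bounded
  refine ⟨C, ?_⟩
  filter_upwards [Measure.ae_ae_of_ae_prod hC] with x hx k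
  have h : gibbs K ν b x k ≤ ENNReal.ofReal C * ∫⁻ y, ENNReal.ofReal (b y k) ∂ν := by
    unfold gibbs
    rw [← lintegral_const_mul' _ _ ENNReal.ofReal_ne_top]
    refine lintegral_mono_ae ?_
    filter_upwards [hx] with y hy
    rw [← ENNReal.ofReal_mul' (hb y k)]
    exact ENNReal.ofReal_le_ofReal (mul_le_mul_of_nonneg_right (hy k) (hb y k))
  exact ⟨h, h.trans_lt (ENNReal.mul_lt_top ENNReal.ofReal_lt_top (hfin k).lt_top)⟩

lemma expScale_pos {Ω : Type*} (u : Ω → Fin n → ℝ) (x : Ω) (k : Fin n) : 0 < expScale ε u x k :=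
  Real.exp_pos _

/-- Finiteness of the kernel integrals by induction along the alternating iteration. -/
lemma kernelFinite_of_invariant {f₁ : X → (Fin n → ℝ) → EReal} {f₂ : Y → (Fin n → ℝ) → EReal}
    {P Q : (X → Fin n → ℝ) → (Y → Fin n → ℝ) → Prop} (h0 : P 0 0)
    (hP : ∀ u v, P u v → ∀ᵐ x ∂μ, ∀ k, gibbs K ν (expScale ε v) x k < ⊤)
    (hQ : ∀ u v, Q u v → ∀ᵐ y ∂ν, ∀ k, gibbsT K μ (expScale ε u) y k < ⊤)
    (hPQ : ∀ u v u', P u v → IsDualStep f₁ ε μ (gibbs K ν (expScale ε v)) u' → Q u' v)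
    (hQP : ∀ u v v', Q u v → IsDualStep f₂ ε ν (gibbsT K μ (expScale ε u)) v' → P u v') :
    KernelFinite f₁ f₂ ε K μ ν := by
  intro N u v hrun
  have key : ∀ ℓ ≤ N, P (u ℓ) (v ℓ) := by
    intro ℓ
    induction ℓ with
    | zero => intro _; rw [hrun.1, hrun.2.1]; exact h0
    | succ ℓ ih =>
      intro hℓ
      obtain ⟨h1, h2⟩ := hrun.2.2 ℓ hℓ
      exact hQP _ _ _ (hPQ _ _ _ (ih (by omega)) h1) h2
  exact ⟨hP _ _ (key N le_rfl), fun u' hu' => hQ _ _ (hPQ _ _ _ (key N le_rfl) hu')⟩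

/-! ### Feasible points -/

lemma IsAdmissible.exists_feasible {f : X → (Fin n → ℝ) → EReal} (hf : IsAdmissible f μ) :
    ∃ (s : X → Fin n → ℝ) (φ : X → ℝ), Integrable s μ ∧ Integrable φ μ ∧
      ∀ᵐ x ∂μ, f x (s x) = φ x ∧ (∀ k, 0 ≤ s x k) ∧ 0 ≤ φ x := by
  obtain ⟨s, hs, hfs⟩ := hf.feasible
  obtain ⟨t, htm, hst⟩ := hs.aestronglyMeasurable
  have hft : ∫⁻ x, (f x (t x)).toENNReal ∂μ ≠ ⊤ := by
    have : ∫⁻ x, (f x (t x)).toENNReal ∂μ = integralFunctional f μ s := by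
      refine lintegral_congr_ae ?_
      filter_upwards [hst] with x hx
      rw [hx]
    rw [this]; exact hfs.ne
  have hneg : ∫⁻ x, (-f x (t x)).toENNReal ∂μ ≠ ⊤ := by
    have : ∀ x, (-f x (t x)).toENNReal = 0 := fun x =>
      EReal.toENNReal_of_nonpos (by simpa using hf.nonneg x (t x))
    simp [this]
  obtain ⟨h1, h2, -⟩ := extIntegral_eq_integral
    (hf.normal.measurable_comp hf.nonneg htm.measurable) hft hneg
  refine ⟨t, fun x => (f x (t x)).toReal, hs.congr hst, h2, ?_⟩
  filter_upwards [h1] with x hx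
  refine ⟨hx, hf.dom_subset x _ (by rw [hx]; exact EReal.coe_lt_top _), ?_⟩
  exact EReal.toReal_nonneg (hf.nonneg _ _)

/-- The subgradient inequality at a feasible `s`, with the value `c ≥ 0` discarded. Together with
the feasible point, it is what the first two finiteness cases use about the integrand. -/
lemma IsOpt.sum_mul_sub_le {g : (Fin n → ℝ) → EReal} {z u : Fin n → ℝ} {c : ℝ}
    (h : IsOpt g ε z u c) (hg : IsPosProper g) {s : Fin n → ℝ} {φ : ℝ} (hs : g s = φ) :
    ∑ k, u k * (primalPoint ε z u k - s k) ≤ φ := by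
  have h1 := h.le s
  rw [hs, EReal.coe_le_coe_iff] at h1
  linarith [h.nonneg hg]

/-! ### Finiteness in dimension at most one -/

/-- Where `e^{u/ε} > e` one has `u ≥ ε`, and the single term `u (e^{u/ε} z - s) ≤ φ` gives `e^{u/ε}
z ≤ s + φ / ε`, which is integrable. With several components, negative terms could compensate a
large one. Where `e^{u/ε} ≤ e`, boundedness of `K` suffices. -/
lemma IsDualStep.gibbsT_lt_top_of_le_one [IsProbabilityMeasure μ] [IsProbabilityMeasure ν]
    (hn : n ≤ 1) (hε : 0 < ε) {f : X → (Fin n → ℝ) → EReal} (hf : IsAdmissible f μ)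
    (hg : ∀ x, IsPosProper (f x)) (hK : IsPosKernel K μ ν) {u : X → Fin n → ℝ} {v : Y → Fin n → ℝ}
    (hv : Measurable v) (hfin : ∀ᵐ x ∂μ, ∀ k, gibbs K ν (expScale ε v) x k < ⊤)
    (hu : IsDualStep f ε μ (gibbs K ν (expScale ε v)) u) :
    ∀ᵐ y ∂ν, ∀ k, gibbsT K μ (expScale ε u) y k < ⊤ := by
  have hbm := measurable_expScale (ε := ε) hv
  have ham := measurable_expScale (ε := ε) hu.1
  have hak : ∀ k, Measurable fun x => expScale ε u x k := fun k =>
    (measurable_pi_apply k).comp ham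
  have hz : ∀ᵐ x ∂μ, ∀ k, gibbs K ν (expScale ε v) x k ≠ 0 ∧ gibbs K ν (expScale ε v) x k ≠ ⊤ := by
    filter_upwards [hK.gibbs_ne_zero hbm (expScale_pos v), hfin] with x h1 h2 k
    exact ⟨h1 k, (h2 k).ne⟩
  obtain ⟨s, φ, hs, hφ, hsφ⟩ := hf.exists_feasible
  set a : X → Fin n → ℝ := fun x k =>
    if expScale ε u x k ≤ Real.exp 1 then 0 else expScale ε u x k with ha
  have ham' : Measurable a := measurable_pi_lambda _ fun k =>
    Measurable.ite (measurableSet_le (hak k) measurable_const) measurable_const (hak k)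
  have ha0 : ∀ x k, 0 ≤ a x k := fun x k => by
    simp only [ha]
    split_ifs
    exacts [le_rfl, (expScale_pos u x k).le]
  have hale : ∀ x k, expScale ε u x k ≤ Real.exp 1 + a x k := fun x k => by
    simp only [ha]
    split_ifs with h
    · simpa using h
    · linarith [Real.exp_pos 1]
  have hint : ∀ k, ∫⁻ x, ENNReal.ofReal (a x k) * gibbs K ν (expScale ε v) x k ∂μ ≠ ⊤ := by
    intro k
    have hI : Integrable (fun x => s x k + φ x / ε) μ := (hs.eval k).add (hφ.div_const ε)
    refine ne_top_of_le_ne_top (b := ∫⁻ x, ENNReal.ofReal (s x k + φ x / ε) ∂μ)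
      hI.lintegral_lt_top.ne (lintegral_mono_ae ?_)
    filter_upwards [hz, hu.isOpt hε hg hz, hsφ] with x hzx ⟨c, hc⟩ ⟨h1, h2, h3⟩
    have h4 := hc.sum_mul_sub_le (hg x) h1
    have : Subsingleton (Fin n) := Fin.subsingleton_iff_le_one.2 hn
    rw [Fintype.sum_subsingleton _ k] at h4
    simp only [ha]
    split_ifs with hle
    · simp
    · have hue : ε ≤ u x k := by
        rw [not_le] at hle
        have := Real.exp_lt_exp.1 hle
        rw [lt_div_iff₀ hε] at this
        linarith
      rw [← ENNReal.ofReal_toReal (hzx k).2, ← ENNReal.ofReal_mul (expScale_pos u x k).le]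
      refine ENNReal.ofReal_le_ofReal ?_
      have h5 : expScale ε u x k * (gibbs K ν (expScale ε v) x k).toReal =
        primalPoint ε (fun k => (gibbs K ν (expScale ε v) x k).toReal) (u x) k := rfl
      rw [h5]
      rcases le_total (primalPoint ε (fun k => (gibbs K ν (expScale ε v) x k).toReal) (u x) k)
        (s x k) with h6 | h6
      · exact h6.trans (le_add_of_nonneg_right (div_nonneg h3 hε.le))
      · rw [← sub_le_iff_le_add', le_div_iff₀ hε]
        nlinarith
  obtain ⟨C, hC⟩ := hK.swap.gibbs_lt_top (b := fun _ _ => Real.exp 1)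
    (fun _ _ => (Real.exp_pos 1).le) (by simp)
  filter_upwards [hC, gibbsT_lt_top_of_lintegral hK.measurable ham' hbm ha0 (expScale_pos v) hint,
    Measure.ae_ae_of_ae_prod hK.swap.pos] with y h1 h2 h3 k
  have hle : gibbsT K μ (expScale ε u) y k ≤
      gibbs (fun p : Y × X => K p.swap) μ (fun _ _ => Real.exp 1) y k + gibbsT K μ a y k := by
    unfold gibbsT gibbs
    have hm : Measurable fun x => ENNReal.ofReal (K (x, y) k * a x k) :=
      (measurable_kernel_mul (K := fun p : Y × X => K p.swap) hK.swap.measurable ham' k).comp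
        measurable_prodMk_left
    rw [← lintegral_add_right _ hm]
    refine lintegral_mono_ae ?_
    filter_upwards [h3] with x hx
    refine le_trans (ENNReal.ofReal_le_ofReal ?_) ENNReal.ofReal_add_le
    refine (mul_le_mul_of_nonneg_left (hale x k) (hx k).le).trans_eq ?_
    exact mul_add _ _ _
  exact hle.trans_lt (ENNReal.add_lt_top.2 ⟨(h1 k).2, h2 k⟩)

theorem kernelFinite_of_le_one [IsProbabilityMeasure μ] [IsProbabilityMeasure ν]
    (hn : n ≤ 1) (hε : 0 < ε) {f₁ : X → (Fin n → ℝ) → EReal} {f₂ : Y → (Fin n → ℝ) → EReal}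
    (hf₁ : IsAdmissible f₁ μ) (hf₂ : IsAdmissible f₂ ν) (hg₁ : ∀ x, IsPosProper (f₁ x))
    (hg₂ : ∀ y, IsPosProper (f₂ y)) (hK : IsPosKernel K μ ν) : KernelFinite f₁ f₂ ε K μ ν := by
  refine kernelFinite_of_invariant
    (P := fun _ v => Measurable v ∧ ∀ᵐ x ∂μ, ∀ k, gibbs K ν (expScale ε v) x k < ⊤)
    (Q := fun u _ => Measurable u ∧ ∀ᵐ y ∂ν, ∀ k, gibbsT K μ (expScale ε u) y k < ⊤)
    ⟨measurable_const, ?_⟩ (fun _ _ h => h.2) (fun _ _ h => h.2) ?_ ?_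
  · obtain ⟨C, hC⟩ := hK.gibbs_lt_top (b := expScale ε 0)
      (fun y k => (expScale_pos _ y k).le) (by simp [expScale])
    filter_upwards [hC] with x hx k
    exact (hx k).2
  · exact fun u v u' h hu' => ⟨hu'.1, hu'.gibbsT_lt_top_of_le_one hn hε hf₁ hg₁ hK h.1 h.2⟩
  · exact fun u v v' h hv' => ⟨hv'.1,
      IsDualStep.gibbsT_lt_top_of_le_one (K := fun p : Y × X => K p.swap) hn hε hf₂ hg₂ hK.swap
        h.1 h.2 hv'⟩

/-! ### Finiteness for kernels bounded below -/

/-- Two bounds are combined: `α log α ≥ 2α - e`, multiplied by `z`, and `σ log α ≤ α z + |log c|`.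
One of the two copies of `α z` pays for the second bound. -/
lemma mul_log_mul_sub_ge {α σ z c : ℝ} (hα : 0 < α) (hσ0 : 0 ≤ σ) (hσ1 : σ ≤ 1) (hc : 0 < c)
    (hcz : c ≤ z) :
    α * z - (Real.exp 1 * z + |Real.log c|) ≤ Real.log α * (α * z - σ) := by
  have hz : 0 < z := hc.trans_le hcz
  have h1 : 2 * α ≤ α * Real.log α + Real.exp 1 := by
    have h' : Real.log (Real.exp 1 / α) ≤ Real.exp 1 / α - 1 :=
      Real.log_le_sub_one_of_pos (by positivity)
    rw [Real.log_div (Real.exp_ne_zero _) hα.ne', Real.log_exp] at h'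
    have h2 := mul_le_mul_of_nonneg_left h' hα.le
    have h3 : α * (Real.exp 1 / α - 1) = Real.exp 1 - α := by field_simp
    linarith
  have h2 : Real.log α ≤ α * z + |Real.log c| := by
    have h := Real.log_le_sub_one_of_pos (mul_pos hα hc)
    rw [Real.log_mul hα.ne' hc.ne'] at h
    have := neg_abs_le (Real.log c)
    nlinarith
  have h3 : σ * Real.log α ≤ α * z + |Real.log c| := by
    have h0 : 0 ≤ α * z + |Real.log c| := by positivity
    rcases le_total 0 (Real.log α) with h | h
    · nlinarith
    · nlinarith
  nlinarith

/-- A quantitative bound on the primal point in terms of a feasible one. -/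
lemma primalPoint_le_of_sum_le {z u s c : Fin n → ℝ} {φ : ℝ} (hε : 0 < ε) (hc : ∀ k, 0 < c k)
    (hcz : ∀ k, c k ≤ z k) (hs : ∀ k, 0 ≤ s k) (hφ : 0 ≤ φ)
    (h : ∑ k, u k * (primalPoint ε z u k - s k) ≤ ε * φ) (k : Fin n) :
    primalPoint ε z u k ≤
      (1 + ∑ k, (Real.exp 1 * z k + |Real.log (c k)|)) * (1 + ∑ k, s k + φ) := by
  have hz : ∀ k, 0 < z k := fun k => (hc k).trans_le (hcz k)
  have hp : ∀ k, 0 < primalPoint ε z u k := primalPoint_pos hz u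
  set S := ∑ k, s k with hS
  set D := ∑ k, (Real.exp 1 * z k + |Real.log (c k)|) with hD
  have hS0 : 0 ≤ S := Finset.sum_nonneg fun k _ => hs k
  have hD0 : 0 ≤ D := Finset.sum_nonneg fun k _ => by
    have := hz k
    positivity
  -- Dividing by `M` normalizes `s k / M ≤ 1` and `φ / M ≤ 1`, which makes the final bound linear in
  -- `1 + S + φ`.
  set M := 1 + S + φ with hM
  have hM1 : 1 ≤ M := by linarith
  have hM0 : 0 < M := by linarith
  have hk : primalPoint ε z u k ≤ ∑ k, primalPoint ε z u k :=
    Finset.single_le_sum (fun j _ => (hp j).le) (Finset.mem_univ k)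
  refine hk.trans ?_
  -- If the total mass is at most `S` the claim is immediate; otherwise the `log M` correction from
  -- the normalization has a favourable sign.
  rcases le_total (∑ k, primalPoint ε z u k) S with hle | hle
  · nlinarith
  have hterm : ∀ k, primalPoint ε z u k / M - (Real.exp 1 * z k + |Real.log (c k)|) ≤
      (u k / ε - Real.log M) * (primalPoint ε z u k - s k) / M := by
    intro k
    have hσ1 : s k / M ≤ 1 := by
      rw [div_le_one hM0]
      have : s k ≤ S := Finset.single_le_sum (fun j _ => hs j) (Finset.mem_univ k)
      linarith
    have h1 := mul_log_mul_sub_ge (α := Real.exp (u k / ε) / M) (σ := s k / M)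
      (div_pos (Real.exp_pos _) hM0) (div_nonneg (hs k) hM0.le) hσ1 (hc k) (hcz k)
    rw [Real.log_div (Real.exp_ne_zero _) hM0.ne', Real.log_exp] at h1
    unfold primalPoint
    convert h1 using 1
    · ring
    · ring
  have hsum := Finset.sum_le_sum fun k (_ : k ∈ Finset.univ) => hterm k
  rw [Finset.sum_sub_distrib, ← Finset.sum_div, ← Finset.sum_div, ← hD] at hsum
  have h2 : ∑ k, (u k / ε - Real.log M) * (primalPoint ε z u k - s k) ≤ φ := by
    have h3 : ∑ k, (u k / ε - Real.log M) * (primalPoint ε z u k - s k) =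
        (∑ k, u k * (primalPoint ε z u k - s k)) / ε -
          Real.log M * (∑ k, primalPoint ε z u k - S) := by
      rw [hS, ← Finset.sum_sub_distrib, Finset.mul_sum, Finset.sum_div, ← Finset.sum_sub_distrib]
      exact Finset.sum_congr rfl fun k _ => by ring
    have h4 : (∑ k, u k * (primalPoint ε z u k - s k)) / ε ≤ φ := by
      rw [div_le_iff₀ hε]; linarith
    have h5 := mul_nonneg (Real.log_nonneg hM1) (sub_nonneg.2 hle)
    linarith
  have h6 : (∑ k, (u k / ε - Real.log M) * (primalPoint ε z u k - s k)) / M ≤ 1 := by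
    rw [div_le_one hM0]; linarith
  have h7 : (∑ k, primalPoint ε z u k) / M ≤ 1 + D := by linarith
  rwa [div_le_iff₀ hM0] at h7

/-- The bounds on `K` place the kernel integral between two positive multiples of `I = ∫ e^{v/ε}`.
The quantitative bound on `e^{u/ε} z` then has constant coefficients, and division by the lower
bound `m I` leaves an integrable majorant of `e^{u/ε}`. -/
lemma IsDualStep.lintegral_expScale_ne_top [IsProbabilityMeasure μ] [IsProbabilityMeasure ν]
    (hε : 0 < ε) {f : X → (Fin n → ℝ) → EReal} (hf : IsAdmissible f μ)
    (hg : ∀ x, IsPosProper (f x)) (hK : IsPosKernel K μ ν) {m : ℝ} (hm : 0 < m)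
    (hKm : ∀ᵐ p ∂(μ.prod ν), ∀ k, m ≤ K p k) {u : X → Fin n → ℝ} {v : Y → Fin n → ℝ}
    (hv : Measurable v) (hfin : ∀ k, ∫⁻ y, ENNReal.ofReal (expScale ε v y k) ∂ν ≠ ⊤)
    (hu : IsDualStep f ε μ (gibbs K ν (expScale ε v)) u) (k : Fin n) :
    ∫⁻ x, ENNReal.ofReal (expScale ε u x k) ∂μ ≠ ⊤ := by
  have hbm := measurable_expScale (ε := ε) hv
  set I : Fin n → ℝ := fun k => (∫⁻ y, ENNReal.ofReal (expScale ε v y k) ∂ν).toReal with hI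
  have hI0 : ∀ k, 0 < I k := by
    intro k
    refine ENNReal.toReal_pos ?_ (hfin k)
    have hbk : Measurable fun y => expScale ε v y k := (measurable_pi_apply k).comp hbm
    rw [Ne, lintegral_eq_zero_iff hbk.ennreal_ofReal]
    intro h
    have : ∀ᵐ y ∂ν, False := by
      filter_upwards [h] with y hy
      exact absurd hy (ENNReal.ofReal_pos.2 (expScale_pos v y k)).ne'
    simp [NeZero.ne ν] at this
  obtain ⟨C, hC⟩ := hK.gibbs_lt_top (fun y k => (expScale_pos v y k).le) hfin
  have hz : ∀ᵐ x ∂μ, ∀ k, gibbs K ν (expScale ε v) x k ≠ 0 ∧ gibbs K ν (expScale ε v) x k ≠ ⊤ := by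
    filter_upwards [hK.gibbs_ne_zero hbm (expScale_pos v), hC] with x h1 h2 k
    exact ⟨h1 k, (h2 k).2.ne⟩
  have hlow : ∀ᵐ x ∂μ, ∀ k, m * I k ≤ (gibbs K ν (expScale ε v) x k).toReal := by
    filter_upwards [hz, Measure.ae_ae_of_ae_prod hKm] with x hzx hx k
    rw [← ENNReal.toReal_ofReal hm.le, hI, ← ENNReal.toReal_mul]
    refine ENNReal.toReal_mono (hzx k).2 ?_
    unfold gibbs
    rw [← lintegral_const_mul' _ _ ENNReal.ofReal_ne_top]
    refine lintegral_mono_ae ?_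
    filter_upwards [hx] with y hy
    rw [← ENNReal.ofReal_mul hm.le]
    exact ENNReal.ofReal_le_ofReal
      (mul_le_mul_of_nonneg_right (hy k) (expScale_pos v y k).le)
  have hhigh : ∀ᵐ x ∂μ, ∀ k, (gibbs K ν (expScale ε v) x k).toReal ≤ max C 0 * I k := by
    filter_upwards [hC] with x hx k
    have h := ENNReal.toReal_mono
      (ENNReal.mul_lt_top ENNReal.ofReal_lt_top (hfin k).lt_top).ne (hx k).1
    rwa [ENNReal.toReal_mul, ENNReal.toReal_ofReal'] at h
  obtain ⟨s, φ, hs, hφ, hsφ⟩ := hf.exists_feasible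
  set D := 1 + ∑ k, (Real.exp 1 * (max C 0 * I k) + |Real.log (m * I k)|) with hD
  have hint : Integrable (fun x => D * (1 + ∑ k, s x k + φ x / ε) / (m * I k)) μ :=
    ((((integrable_const 1).add (integrable_finsetSum _ fun k _ => hs.eval k)).add
      (hφ.div_const ε)).const_mul D).div_const _
  refine ne_top_of_le_ne_top hint.lintegral_lt_top.ne (lintegral_mono_ae ?_)
  filter_upwards [hz, hu.isOpt hε hg hz, hsφ, hlow, hhigh] with x hzx ⟨c, hc⟩ ⟨h1, h2, h3⟩ hl hh
  have hmI : ∀ k, 0 < m * I k := fun k => mul_pos hm (hI0 k)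
  have h4 := hc.sum_mul_sub_le (hg x) h1
  have h5 := primalPoint_le_of_sum_le (φ := φ x / ε) hε hmI hl h2 (div_nonneg h3 hε.le)
    (by rwa [mul_div_cancel₀ _ hε.ne']) k
  refine ENNReal.ofReal_le_ofReal ?_
  rw [le_div_iff₀ (hmI k)]
  calc expScale ε u x k * (m * I k)
      ≤ expScale ε u x k * (gibbs K ν (expScale ε v) x k).toReal :=
        mul_le_mul_of_nonneg_left (hl k) (expScale_pos u x k).le
    _ ≤ _ := h5
    _ ≤ _ := by
        refine mul_le_mul_of_nonneg_right ?_ ?_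
        · rw [hD]
          gcongr with j
          exact hh j
        · have := Finset.sum_nonneg fun k (_ : k ∈ Finset.univ) => h2 k
          have := div_nonneg h3 hε.le
          linarith

theorem kernelFinite_of_bounded_below [IsProbabilityMeasure μ] [IsProbabilityMeasure ν]
    (hε : 0 < ε) {f₁ : X → (Fin n → ℝ) → EReal} {f₂ : Y → (Fin n → ℝ) → EReal}
    (hf₁ : IsAdmissible f₁ μ) (hf₂ : IsAdmissible f₂ ν) (hg₁ : ∀ x, IsPosProper (f₁ x))
    (hg₂ : ∀ y, IsPosProper (f₂ y)) (hK : IsPosKernel K μ ν) {m : ℝ} (hm : 0 < m)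
    (hKm : ∀ᵐ p ∂(μ.prod ν), ∀ k, m ≤ K p k) : KernelFinite f₁ f₂ ε K μ ν := by
  refine kernelFinite_of_invariant
    (P := fun _ v => Measurable v ∧ ∀ k, ∫⁻ y, ENNReal.ofReal (expScale ε v y k) ∂ν ≠ ⊤)
    (Q := fun u _ => Measurable u ∧ ∀ k, ∫⁻ x, ENNReal.ofReal (expScale ε u x k) ∂μ ≠ ⊤)
    ⟨measurable_const, by simp [expScale]⟩ ?_ ?_ ?_ ?_
  · intro u v h
    obtain ⟨C, hC⟩ := hK.gibbs_lt_top (fun y k => (expScale_pos v y k).le) h.2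
    filter_upwards [hC] with x hx k
    exact (hx k).2
  · intro u v h
    obtain ⟨C, hC⟩ := hK.swap.gibbs_lt_top (fun y k => (expScale_pos u y k).le) h.2
    filter_upwards [hC] with x hx k
    exact (hx k).2
  · exact fun u v u' h hu' =>
      ⟨hu'.1, hu'.lintegral_expScale_ne_top hε hf₁ hg₁ hK hm hKm h.1 h.2⟩
  · exact fun u v v' h hv' =>
      ⟨hv'.1, IsDualStep.lintegral_expScale_ne_top (K := fun p : Y × X => K p.swap) hε hf₂ hg₂
        hK.swap hm (ae_prod_swap hKm) h.1 h.2 hv'⟩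

end

section

variable {X Y : Type*} [MeasurableSpace X] [MeasurableSpace Y] {n : ℕ}
  {K : X × Y → Fin n → ℝ} {μ : Measure X} {ν : Measure Y} {ε : ℝ}

/-! ### Finiteness when the primal problem is feasible -/

/-- Measurable plans at which the primal functional is finite. -/
structure IsFeasiblePlan (f₁ : X → (Fin n → ℝ) → EReal) (f₂ : Y → (Fin n → ℝ) → EReal)
    (K : X × Y → Fin n → ℝ) (μ : Measure X) (ν : Measure Y) (r : X × Y → Fin n → ℝ) : Prop where
  measurable : Measurable r
  integrable : Integrable r (μ.prod ν)
  fst : ∫⁻ x, (f₁ x fun k => ∫ y, r (x, y) k ∂ν).toENNReal ∂μ ≠ ⊤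
  snd : ∫⁻ y, (f₂ y fun k => ∫ x, r (x, y) k ∂μ).toENNReal ∂ν ≠ ⊤
  kl : ∫⁻ p, (klPoint (r p) (K p)).toENNReal ∂(μ.prod ν) ≠ ⊤

lemma PrimalFeasible.exists_plan [SFinite μ] [SFinite ν] {f₁ : X → (Fin n → ℝ) → EReal}
    {f₂ : Y → (Fin n → ℝ) → EReal} (h : PrimalFeasible f₁ f₂ K μ ν) :
    ∃ r, IsFeasiblePlan f₁ f₂ K μ ν r := by
  obtain ⟨r, hr, h1, h2, h3⟩ := h
  obtain ⟨r', hr'm, hrr'⟩ := hr.aestronglyMeasurable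
  refine ⟨r', hr'm.measurable, hr.congr hrr', ?_, ?_, ?_⟩
  · refine ne_of_eq_of_ne ?_ h1.ne
    refine lintegral_congr_ae ?_
    filter_upwards [Measure.ae_ae_of_ae_prod hrr'] with x hx
    have : (fun k => ∫ y, r' (x, y) k ∂ν) = fun k => ∫ y, r (x, y) k ∂ν := by
      ext k
      refine integral_congr_ae ?_
      filter_upwards [hx] with y hy
      rw [hy]
    rw [this]
  · refine ne_of_eq_of_ne ?_ h2.ne
    refine lintegral_congr_ae ?_
    filter_upwards [Measure.ae_ae_of_ae_prod (ae_prod_swap hrr')] with y hy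
    have : (fun k => ∫ x, r' (x, y) k ∂μ) = fun k => ∫ x, r (x, y) k ∂μ := by
      ext k
      refine integral_congr_ae ?_
      filter_upwards [hy] with x hx
      exact (congrFun hx k).symm
    rw [this]
  · refine ne_of_eq_of_ne ?_ h3.ne
    refine lintegral_congr_ae ?_
    filter_upwards [hrr'] with p hp
    rw [hp]

lemma IsFeasiblePlan.swap [SFinite μ] [SFinite ν] {f₁ : X → (Fin n → ℝ) → EReal}
    {f₂ : Y → (Fin n → ℝ) → EReal} {r : X × Y → Fin n → ℝ} (h : IsFeasiblePlan f₁ f₂ K μ ν r) :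
    IsFeasiblePlan f₂ f₁ (fun p : Y × X => K p.swap) ν μ (fun p : Y × X => r p.swap) := by
  refine ⟨h.measurable.comp measurable_swap, h.integrable.swap, h.snd, h.fst, ?_⟩
  have := lintegral_prod_swap (μ := μ) (ν := ν)
    (fun p : X × Y => (klPoint (r p) (K p)).toENNReal)
  rw [this]
  exact h.kl

lemma IsFeasiblePlan.nonneg [SFinite μ] [SFinite ν] {f₁ : X → (Fin n → ℝ) → EReal}
    {f₂ : Y → (Fin n → ℝ) → EReal} {r : X × Y → Fin n → ℝ} (h : IsFeasiblePlan f₁ f₂ K μ ν r)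
    (hK : Measurable K) : ∀ᵐ p ∂(μ.prod ν), ∀ k, 0 ≤ r p k := by
  filter_upwards [ae_lt_top (measurable_klPoint.comp
    (h.measurable.prodMk hK)).ereal_toENNReal h.kl] with p hp
  by_contra hneg
  have h1 : klPoint (r p) (K p) = ⊤ := klPoint_eq_top hneg
  simp [h1] at hp

/-- The estimates propagated along the iteration when the primal problem is feasible. -/
structure PlanInvariant (f₁ : X → (Fin n → ℝ) → EReal) (f₂ : Y → (Fin n → ℝ) → EReal) (ε : ℝ)
    (K : X × Y → Fin n → ℝ) (μ : Measure X) (ν : Measure Y) (r : X × Y → Fin n → ℝ)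
    (u : X → Fin n → ℝ) (v : Y → Fin n → ℝ) : Prop where
  fst_measurable : Measurable u
  snd_measurable : Measurable v
  coupling : ∀ k, ∫⁻ x, ENNReal.ofReal (expScale ε u x k) * gibbs K ν (expScale ε v) x k ∂μ ≠ ⊤
  conj_fst : ∫⁻ x, (conj (f₁ x) (-u x)).toENNReal ∂μ ≠ ⊤
  conj_snd : ∫⁻ y, (conj (f₂ y) (-v y)).toENNReal ∂ν ≠ ⊤
  plan : ∀ k, ∫⁻ p, ENNReal.ofReal (|v p.2 k| * r p k) ∂(μ.prod ν) ≠ ⊤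

lemma toENNReal_coe (a : ℝ) : ((a : ℝ) : EReal).toENNReal = ENNReal.ofReal a := by
  rw [EReal.toENNReal_of_ne_top (EReal.coe_ne_top _), EReal.toReal_coe]

lemma lintegral_add_ne_top {α : Type*} [MeasurableSpace α] {m : Measure α} {g h : α → ℝ≥0∞}
    (hm : Measurable g) (hg : ∫⁻ x, g x ∂m ≠ ⊤) (hh : ∫⁻ x, h x ∂m ≠ ⊤) :
    ∫⁻ x, (g x + h x) ∂m ≠ ⊤ := by
  rw [lintegral_add_left hm]
  exact ENNReal.add_ne_top.2 ⟨hg, hh⟩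

lemma lintegral_sum_ne_top {α : Type*} [MeasurableSpace α] {m : Measure α} {g : Fin n → α → ℝ≥0∞}
    (hm : ∀ k, Measurable (g k)) (hg : ∀ k, ∫⁻ x, g k x ∂m ≠ ⊤) :
    ∫⁻ x, ∑ k, g k x ∂m ≠ ⊤ := by
  rw [lintegral_finsetSum _ fun k _ => hm k]
  exact ENNReal.sum_ne_top.2 fun k _ => hg k

/-- Young's inequality for one component of a plan. -/
lemma mul_le_of_klTerm (hε : 0 < ε) {r k U V : ℝ} (hr : 0 ≤ r) (hk : 0 < k) :
    U * r ≤ |V| * r + ε * Real.log 2 * r + ε * klTerm r k +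
      ε / 2 * Real.exp (U / ε) * (k * Real.exp (V / ε)) := by
  -- The shift by `log 2` halves the exponential term, at the cost of the integrable `ε log 2 · r`;
  -- the half left over is what allows absorption later.
  have h := mul_le_klTerm_add hr hk ((U + V) / ε - Real.log 2)
  rw [Real.exp_sub, Real.exp_log two_pos, add_div, Real.exp_add] at h
  have h1 := mul_le_mul_of_nonneg_left h hε.le
  have h2 : ε * ((U / ε + V / ε - Real.log 2) * r) = U * r + V * r - ε * Real.log 2 * r := by
    field_simp
  have h3 : -V * r ≤ |V| * r := mul_le_mul_of_nonneg_right (neg_le_abs V) hr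
  have h4 := mul_pos hε hk
  rw [h2] at h1
  linarith

/-- The integrand controlling one component of the first marginal problem. -/
def planBound (ε : ℝ) (K r : X × Y → Fin n → ℝ) (v : Y → Fin n → ℝ) (k : Fin n) (p : X × Y) :
    ℝ≥0∞ :=
  ENNReal.ofReal (|v p.2 k| * r p k) + (ENNReal.ofReal (ε * Real.log 2) * ENNReal.ofReal (r p k) +
    ENNReal.ofReal ε * (klPoint (r p) (K p)).toENNReal)

variable {f₁ : X → (Fin n → ℝ) → EReal} {f₂ : Y → (Fin n → ℝ) → EReal}
  {r : X × Y → Fin n → ℝ} {u u' : X → Fin n → ℝ} {v : Y → Fin n → ℝ}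

lemma measurable_planBound (hK : Measurable K) (hr : Measurable r) (hv : Measurable v)
    (k : Fin n) : Measurable (planBound ε K r v k) := by
  have hrk : Measurable fun p => r p k := (measurable_pi_apply k).comp hr
  have hvk : Measurable fun p : X × Y => v p.2 k :=
    (measurable_pi_apply k).comp (hv.comp measurable_snd)
  have hkl : Measurable fun p => (klPoint (r p) (K p)).toENNReal :=
    (measurable_klPoint.comp (hr.prodMk hK)).ereal_toENNReal
  have habs : Measurable fun p : X × Y => |v p.2 k| := by
    simpa only [Real.norm_eq_abs] using hvk.norm
  exact (habs.mul hrk).ennreal_ofReal.add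
    ((hrk.ennreal_ofReal.const_mul _).add (hkl.const_mul _))

lemma PlanInvariant.lintegral_planBound_ne_top [SFinite μ] [SFinite ν] (hK : Measurable K)
    (hr : IsFeasiblePlan f₁ f₂ K μ ν r) (h : PlanInvariant f₁ f₂ ε K μ ν r u v) (k : Fin n) :
    ∫⁻ x, ∫⁻ y, planBound ε K r v k (x, y) ∂ν ∂μ ≠ ⊤ := by
  rw [← lintegral_prod _ (measurable_planBound hK hr.measurable h.snd_measurable k).aemeasurable]
  have hrk : Measurable fun p => r p k := (measurable_pi_apply k).comp hr.measurable
  have hvk : Measurable fun p : X × Y => v p.2 k :=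
    (measurable_pi_apply k).comp (h.snd_measurable.comp measurable_snd)
  have habs : Measurable fun p : X × Y => |v p.2 k| := by
    simpa only [Real.norm_eq_abs] using hvk.norm
  refine lintegral_add_ne_top (habs.mul hrk).ennreal_ofReal (h.plan k) ?_
  refine lintegral_add_ne_top (hrk.ennreal_ofReal.const_mul _) ?_ ?_
  · rw [lintegral_const_mul' _ _ ENNReal.ofReal_ne_top]
    exact ENNReal.mul_ne_top ENNReal.ofReal_ne_top (hr.integrable.eval k).lintegral_lt_top.ne
  · rw [lintegral_const_mul' _ _ ENNReal.ofReal_ne_top]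
    exact ENNReal.mul_ne_top ENNReal.ofReal_ne_top hr.kl

/-- The first marginal of a plan. -/
def fstMarginal (ν : Measure Y) (r : X × Y → Fin n → ℝ) (x : X) (k : Fin n) : ℝ :=
  ∫ y, r (x, y) k ∂ν

lemma IsFeasiblePlan.fstMarginal_spec [SFinite μ] [SFinite ν] (hK : Measurable K)
    (hr : IsFeasiblePlan f₁ f₂ K μ ν r) : ∀ᵐ x ∂μ, ∀ k, 0 ≤ fstMarginal ν r x k ∧
      ENNReal.ofReal (fstMarginal ν r x k) = ∫⁻ y, ENNReal.ofReal (r (x, y) k) ∂ν := by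
  have hint : ∀ᵐ x ∂μ, ∀ k, Integrable (fun y => r (x, y) k) ν := by
    rw [ae_all_iff]
    exact fun k => (hr.integrable.eval k).prod_right_ae
  filter_upwards [hint, Measure.ae_ae_of_ae_prod (hr.nonneg hK)] with x hx h0 k
  have h0k : ∀ᵐ y ∂ν, 0 ≤ r (x, y) k := h0.mono fun y hy => hy k
  exact ⟨integral_nonneg_of_ae h0k, ofReal_integral_eq_lintegral_ofReal (hx k) h0k⟩

/-- Young's inequality integrated in `y`: the positive part of `u_k` times the marginal costs an
integrable term plus half of the coupling term. -/
lemma IsFeasiblePlan.ofReal_mul_fstMarginal_le [SFinite μ] [SFinite ν] (hε : 0 < ε)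
    (hK : IsPosKernel K μ ν) (hr : IsFeasiblePlan f₁ f₂ K μ ν r) (hv : Measurable v)
    (u : X → Fin n → ℝ) : ∀ᵐ x ∂μ, ∀ k, ENNReal.ofReal (u x k * fstMarginal ν r x k) ≤
      ∫⁻ y, planBound ε K r v k (x, y) ∂ν +
        ENNReal.ofReal (ε / 2 * expScale ε u x k) * gibbs K ν (expScale ε v) x k := by
  filter_upwards [hr.fstMarginal_spec hK.measurable, Measure.ae_ae_of_ae_prod hK.pos,
    Measure.ae_ae_of_ae_prod (hr.nonneg hK.measurable)] with x hx hKx hrx k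
  have hpm : Measurable fun y => planBound ε K r v k (x, y) :=
    (measurable_planBound hK.measurable hr.measurable hv k).comp measurable_prodMk_left
  have hstep : ENNReal.ofReal (u x k * fstMarginal ν r x k) ≤
      ∫⁻ y, ENNReal.ofReal (u x k * r (x, y) k) ∂ν := by
    rcases le_total (u x k) 0 with hle | hle
    · rw [ENNReal.ofReal_of_nonpos (mul_nonpos_of_nonpos_of_nonneg hle (hx k).1)]
      exact zero_le
    · rw [ENNReal.ofReal_mul hle, (hx k).2, ← lintegral_const_mul' _ _ ENNReal.ofReal_ne_top]
      simp_rw [ENNReal.ofReal_mul hle]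
      exact le_rfl
  refine hstep.trans ?_
  unfold gibbs
  rw [← lintegral_const_mul' _ _ ENNReal.ofReal_ne_top, ← lintegral_add_left hpm]
  refine lintegral_mono_ae ?_
  filter_upwards [hKx, hrx] with y hKy hry
  have h1 := mul_le_of_klTerm (U := u x k) (V := v y k) hε (hry k) (hKy k)
  have h2 : klTerm (r (x, y) k) (K (x, y) k) ≤ ∑ k, klTerm (r (x, y) k) (K (x, y) k) :=
    Finset.single_le_sum (f := fun k => klTerm (r (x, y) k) (K (x, y) k))
      (fun j _ => klTerm_nonneg (hry j) (hKy j)) (Finset.mem_univ k)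
  have h3 := mul_le_mul_of_nonneg_left h2 hε.le
  unfold planBound
  rw [klPoint_eq hry hKy, toENNReal_coe, ← ENNReal.ofReal_mul (by positivity),
    ← ENNReal.ofReal_mul hε.le,
    ← ENNReal.ofReal_mul (mul_nonneg (half_pos hε).le (expScale_pos u x k).le)]
  have h4 : u x k * r (x, y) k ≤ |v y k| * r (x, y) k + (ε * Real.log 2 * r (x, y) k +
      ε * ∑ k, klTerm (r (x, y) k) (K (x, y) k)) +
      ε / 2 * expScale ε u x k * (K (x, y) k * expScale ε v y k) := by
    unfold expScale
    linarith
  refine (ENNReal.ofReal_le_ofReal h4).trans ?_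
  refine ENNReal.ofReal_add_le.trans (add_le_add ?_ le_rfl)
  exact ENNReal.ofReal_add_le.trans (add_le_add le_rfl ENNReal.ofReal_add_le)

lemma ofReal_sum_le {ι : Type*} (s : Finset ι) (g : ι → ℝ) :
    ENNReal.ofReal (∑ i ∈ s, g i) ≤ ∑ i ∈ s, ENNReal.ofReal (g i) :=
  Finset.le_sum_of_subadditive _ ENNReal.ofReal_zero.le (fun _ _ => ENNReal.ofReal_add_le) _ _

/-- Optimality in the dual problem, compared with an arbitrary point `w`. -/
lemma IsOpt.conj_add_le {g : (Fin n → ℝ) → EReal} {ζ : Fin n → ℝ≥0∞} {a : Fin n → ℝ} {c : ℝ}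
    (hε : 0 < ε) (hζ : ∀ k, ζ k ≠ 0 ∧ ζ k ≠ ⊤)
    (h : IsOpt g ε (fun k => (ζ k).toReal) a c) {w : Fin n → ℝ} {ρ : ℝ}
    (hρ : conj g (-w) = ρ) :
    (-∑ k, a k * primalPoint ε (fun k => (ζ k).toReal) a k - c) +
      ε * ∑ k, primalPoint ε (fun k => (ζ k).toReal) a k ≤
    ρ + ε * ∑ k, primalPoint ε (fun k => (ζ k).toReal) w k := by
  have hpos : ∀ k, 0 < (ζ k).toReal := fun k => ENNReal.toReal_pos (hζ k).1 (hζ k).2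
  have h1 := h.le_conj w
  rw [hρ, EReal.coe_le_coe_iff] at h1
  have h2 := bregman_eq (u := a) hε hpos w
  have h3 := mul_nonneg hε.le (sum_klTerm_nonneg
    (fun k => (primalPoint_pos (ε := ε) hpos a k).le) (primalPoint_pos (ε := ε) hpos w))
  linarith

lemma conj_ne_bot {g : (Fin n → ℝ) → EReal} (hg : IsPosProper g) (w : Fin n → ℝ) :
    conj g w ≠ ⊥ := by
  obtain ⟨s, -, hs⟩ := hg.exists_pos
  exact ne_bot_of_le_ne_bot (EReal.coe_ne_bot _) (coe_sub_le_conj (hg.mem_epi hs) w)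

lemma IsOpt.conj_toENNReal_le {g : (Fin n → ℝ) → EReal} (hg : IsPosProper g) {ζ : Fin n → ℝ≥0∞}
    {a : Fin n → ℝ} {c : ℝ} (hε : 0 < ε) (hζ : ∀ k, ζ k ≠ 0 ∧ ζ k ≠ ⊤)
    (h : IsOpt g ε (fun k => (ζ k).toReal) a c) (w : Fin n → ℝ) :
    (conj g (-a)).toENNReal ≤
      (conj g (-w)).toENNReal + ENNReal.ofReal ε * expSum ε ζ w := by
  by_cases htop : conj g (-w) = ⊤
  · simp [htop]
  have hρ := (EReal.coe_toReal htop (conj_ne_bot hg _)).symm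
  have hpos : ∀ k, 0 < (ζ k).toReal := fun k => ENNReal.toReal_pos (hζ k).1 (hζ k).2
  have h1 := h.conj_add_le hε hζ hρ
  have h2 : 0 ≤ ε * ∑ k, primalPoint ε (fun k => (ζ k).toReal) a k :=
    mul_nonneg hε.le (Finset.sum_nonneg fun k _ => (primalPoint_pos hpos a k).le)
  rw [h.conj_eq, hρ, toENNReal_coe, toENNReal_coe, expSum_eq_ofReal hζ, ← ENNReal.ofReal_mul hε.le]
  refine le_trans (ENNReal.ofReal_le_ofReal ?_) ENNReal.ofReal_add_le
  linarith

/-- The sum of dual optimality against `w` and the subgradient inequality at `s`; the terms `⟨a,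
e^{a/ε} ζ⟩` and `c` cancel. -/
lemma IsOpt.mul_expSum_le {g : (Fin n → ℝ) → EReal} (hg : IsPosProper g) {ζ : Fin n → ℝ≥0∞}
    {a : Fin n → ℝ} {c : ℝ} (hε : 0 < ε) (hζ : ∀ k, ζ k ≠ 0 ∧ ζ k ≠ ⊤)
    (h : IsOpt g ε (fun k => (ζ k).toReal) a c) (w s : Fin n → ℝ) :
    ENNReal.ofReal ε * expSum ε ζ a ≤
      (conj g (-w)).toENNReal + ENNReal.ofReal ε * expSum ε ζ w + (g s).toENNReal +
        ∑ k, ENNReal.ofReal (a k * s k) := by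
  by_cases htop : conj g (-w) = ⊤
  · simp [htop]
  by_cases hs : g s = ⊤
  · simp [hs]
  have hρ := (EReal.coe_toReal htop (conj_ne_bot hg _)).symm
  have hβ := (hg.coe_toReal (lt_top_iff_ne_top.2 hs)).symm
  have h1 := h.conj_add_le hε hζ hρ
  have h2 := h.le s
  rw [hβ, EReal.coe_le_coe_iff] at h2
  simp only [mul_sub, Finset.sum_sub_distrib] at h2
  rw [hρ, hβ, toENNReal_coe, toENNReal_coe, expSum_eq_ofReal hζ, expSum_eq_ofReal hζ,
    ← ENNReal.ofReal_mul hε.le, ← ENNReal.ofReal_mul hε.le]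
  refine le_trans (ENNReal.ofReal_le_ofReal (?_ : _ ≤ (conj g (-w)).toReal +
    ε * ∑ k, primalPoint ε (fun k => (ζ k).toReal) w k + (g s).toReal + ∑ k, a k * s k)) ?_
  · linarith
  · refine ENNReal.ofReal_add_le.trans (add_le_add ?_ (ofReal_sum_le _ _))
    refine ENNReal.ofReal_add_le.trans (add_le_add ?_ le_rfl)
    exact ENNReal.ofReal_add_le

/-- A negative `a_k` is controlled by Fenchel's inequality `-⟨a, s⟩ ≤ g*(-a) + g(s)`, with the other
components moved to the right. Only positive parts of the products remain. -/
lemma IsOpt.abs_mul_le {g : (Fin n → ℝ) → EReal} (hg : IsPosProper g) {ζ a : Fin n → ℝ} {c : ℝ}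
    (h : IsOpt g ε ζ a c) {s : Fin n → ℝ} (k : Fin n) :
    ENNReal.ofReal (|a k| * s k) ≤ (conj g (-a)).toENNReal + (g s).toENNReal +
      ∑ j, ENNReal.ofReal (a j * s j) := by
  by_cases hs : g s = ⊤
  · simp [hs]
  have hβ := (hg.coe_toReal (lt_top_iff_ne_top.2 hs)).symm
  have hsingle : ENNReal.ofReal (a k * s k) ≤ ∑ j, ENNReal.ofReal (a j * s j) :=
    Finset.single_le_sum (f := fun j => ENNReal.ofReal (a j * s j)) (fun _ _ => zero_le)
      (Finset.mem_univ k)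
  rcases le_total 0 (a k) with hk | hk
  · rw [abs_of_nonneg hk]
    exact hsingle.trans le_add_self
  · have h2 := h.le s
    rw [hβ, EReal.coe_le_coe_iff] at h2
    simp only [mul_sub, Finset.sum_sub_distrib] at h2
    have h3 : ∑ j, a j * s j = a k * s k + ∑ j ∈ Finset.univ.erase k, a j * s j :=
      (Finset.add_sum_erase _ _ (Finset.mem_univ k)).symm
    rw [abs_of_nonpos hk, h.conj_eq, hβ, toENNReal_coe, toENNReal_coe]
    refine le_trans (ENNReal.ofReal_le_ofReal (?_ : _ ≤
      (-∑ k, a k * primalPoint ε ζ a k - c) + (g s).toReal +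
        ∑ j ∈ Finset.univ.erase k, a j * s j)) ?_
    · linarith
    · refine ENNReal.ofReal_add_le.trans (add_le_add ENNReal.ofReal_add_le ?_)
      exact (ofReal_sum_le _ _).trans (Finset.sum_le_sum_of_subset (Finset.erase_subset _ _))

lemma PlanInvariant.gibbs_lt_top [SFinite ν] (hK : Measurable K)
    (h : PlanInvariant f₁ f₂ ε K μ ν r u v) :
    ∀ᵐ x ∂μ, ∀ k, gibbs K ν (expScale ε v) x k < ⊤ := by
  rw [ae_all_iff]
  intro k
  have huk : Measurable fun x => expScale ε u x k :=
    (measurable_pi_apply k).comp (measurable_expScale h.fst_measurable)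
  have hzk : Measurable fun x => gibbs K ν (expScale ε v) x k :=
    (measurable_pi_apply k).comp (measurable_gibbs hK (measurable_expScale h.snd_measurable))
  filter_upwards [ae_lt_top (huk.ennreal_ofReal.mul hzk) (h.coupling k)] with x hx
  refine lt_top_iff_ne_top.2 fun htop => ?_
  rw [Pi.mul_apply, htop, ENNReal.mul_top (ENNReal.ofReal_pos.2 (expScale_pos u x k)).ne'] at hx
  exact lt_irrefl _ hx

/-- The new coupling term is at most known integrable terms plus `⟨u', marginal⟩`, which is itself
at most integrable terms plus half of the coupling term. Absorbing that half bounds the coupling;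
the remaining estimates for `u'` follow from it and the previous iterate `u`. -/
theorem PlanInvariant.step [IsProbabilityMeasure μ] [IsProbabilityMeasure ν] (hε : 0 < ε)
    (hf : IsNormalIntegrand f₁) (hg : ∀ x, IsPosProper (f₁ x)) (hK : IsPosKernel K μ ν)
    (hr : IsFeasiblePlan f₁ f₂ K μ ν r) (h : PlanInvariant f₁ f₂ ε K μ ν r u v)
    (hu : IsDualStep f₁ ε μ (gibbs K ν (expScale ε v)) u') :
    PlanInvariant f₂ f₁ ε (fun p : Y × X => K p.swap) ν μ (fun p : Y × X => r p.swap) v u' := by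
  have hbm := measurable_expScale (ε := ε) h.snd_measurable
  have ham := measurable_expScale (ε := ε) hu.1
  have hzm := measurable_gibbs (ν := ν) hK.measurable hbm
  set z := gibbs K ν (expScale ε v) with hz_def
  have hz : ∀ᵐ x ∂μ, ∀ k, z x k ≠ 0 ∧ z x k ≠ ⊤ := by
    filter_upwards [hK.gibbs_ne_zero hbm (expScale_pos v), h.gibbs_lt_top hK.measurable]
      with x h1 h2 k
    exact ⟨h1 k, (h2 k).ne⟩
  have hopt := hu.isOpt hε hg hz
  have hzk : ∀ k, Measurable fun x => z x k := fun k => (measurable_pi_apply k).comp hzm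
  have hconjm : ∀ {w : X → Fin n → ℝ}, Measurable w →
      Measurable fun x => (conj (f₁ x) (-w x)).toENNReal := fun {w} hw =>
    (hf.measurable_conj (fun x => (hg x).nonneg) hw.neg).ereal_toENNReal
  have hEu : ∫⁻ x, ENNReal.ofReal ε * expSum ε (z x) (u x) ∂μ ≠ ⊤ := by
    rw [lintegral_const_mul' _ _ ENNReal.ofReal_ne_top]
    refine ENNReal.mul_ne_top ENNReal.ofReal_ne_top ?_
    refine lintegral_sum_ne_top (fun k => Measurable.mul ?_ (hzk k)) h.coupling
    exact ((measurable_pi_apply k).comp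
      (measurable_expScale (ε := ε) h.fst_measurable)).ennreal_ofReal
  have hEum : Measurable fun x => ENNReal.ofReal ε * expSum ε (z x) (u x) :=
    (measurable_expSum hzm h.fst_measurable).const_mul _
  set G : Fin n → X → ℝ≥0∞ := fun k x => ∫⁻ y, planBound ε K r v k (x, y) ∂ν with hG
  have hGm : ∀ k, Measurable (G k) := fun k =>
    (measurable_planBound hK.measurable hr.measurable h.snd_measurable k).lintegral_prod_right'
  have hGi : ∀ k, ∫⁻ x, G k x ∂μ ≠ ⊤ := h.lintegral_planBound_ne_top hK.measurable hr
  set T : X → ℝ≥0∞ := fun x => expSum ε (z x) (u' x) with hT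
  have hTm : Measurable T := measurable_expSum hzm hu.1
  have hsum : ∀ᵐ x ∂μ, ∑ k, ENNReal.ofReal (u' x k * fstMarginal ν r x k) ≤
      ∑ k, G k x + ENNReal.ofReal (ε / 2) * T x := by
    filter_upwards [hr.ofReal_mul_fstMarginal_le hε hK h.snd_measurable u'] with x hx
    refine (Finset.sum_le_sum fun k _ => hx k).trans_eq ?_
    rw [Finset.sum_add_distrib]
    congr 1
    simp only [hT, expSum, Finset.mul_sum]
    refine Finset.sum_congr rfl fun k _ => ?_
    rw [ENNReal.ofReal_mul (half_pos hε).le, mul_assoc]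
    rfl
  have hTle : ∀ᵐ x ∂μ, ENNReal.ofReal (ε / 2) * T x ≤
      (conj (f₁ x) (-u x)).toENNReal + (ENNReal.ofReal ε * expSum ε (z x) (u x) +
        (∑ k, G k x + (f₁ x (fstMarginal ν r x)).toENNReal)) := by
    filter_upwards [hz, hopt, hsum] with x hzx ⟨c, hc⟩ hx
    have h1 := hc.mul_expSum_le (hg x) hε hzx (u x) (fstMarginal ν r x)
    have h2 : ENNReal.ofReal (ε / 2) * T x ≠ ⊤ := by
      refine ENNReal.mul_ne_top ENNReal.ofReal_ne_top ?_
      simp only [hT]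
      rw [expSum_eq_ofReal hzx]
      exact ENNReal.ofReal_ne_top
    have h3 : ENNReal.ofReal ε = ENNReal.ofReal (ε / 2) + ENNReal.ofReal (ε / 2) := by
      rw [← ENNReal.ofReal_add (half_pos hε).le (half_pos hε).le, add_halves]
    -- Cancelling half of the coupling term is legitimate because it is finite at almost every
    -- point, before anything is known about its integral.
    refine ENNReal.le_of_add_le_add_right h2 ?_
    calc ENNReal.ofReal (ε / 2) * T x + ENNReal.ofReal (ε / 2) * T x
        = ENNReal.ofReal ε * T x := by rw [h3, add_mul]
      _ ≤ _ := h1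
      _ ≤ _ := add_le_add le_rfl hx
      _ = _ := by ring
  have hTi : ∫⁻ x, ENNReal.ofReal (ε / 2) * T x ∂μ ≠ ⊤ := by
    refine ne_top_of_le_ne_top ?_ (lintegral_mono_ae hTle)
    refine lintegral_add_ne_top (hconjm h.fst_measurable) h.conj_fst ?_
    refine lintegral_add_ne_top hEum hEu ?_
    exact lintegral_add_ne_top (Finset.measurable_sum _ fun k _ => hGm k)
      (lintegral_sum_ne_top hGm hGi) hr.fst
  have hcoup : ∀ k, ∫⁻ x, ENNReal.ofReal (expScale ε u' x k) * z x k ∂μ ≠ ⊤ := by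
    intro k
    rw [lintegral_const_mul' _ _ ENNReal.ofReal_ne_top] at hTi
    have h1 : ∫⁻ x, T x ∂μ ≠ ⊤ := fun htop => hTi (by
      rw [htop, ENNReal.mul_top (ENNReal.ofReal_pos.2 (half_pos hε)).ne'])
    refine ne_top_of_le_ne_top h1 (lintegral_mono fun x => ?_)
    exact Finset.single_le_sum (f := fun k => ENNReal.ofReal (expScale ε u' x k) * z x k)
      (fun _ _ => zero_le) (Finset.mem_univ k)
  have hconj : ∫⁻ x, (conj (f₁ x) (-u' x)).toENNReal ∂μ ≠ ⊤ := by
    refine ne_top_of_le_ne_top (lintegral_add_ne_top (hconjm h.fst_measurable) h.conj_fst hEu)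
      (lintegral_mono_ae ?_)
    filter_upwards [hz, hopt] with x hzx ⟨c, hc⟩
    exact hc.conj_toENNReal_le (hg x) hε hzx (u x)
  refine ⟨h.snd_measurable, hu.1, fun k => ?_, h.conj_snd, hconj, fun k => ?_⟩
  · have h1 := hcoup k
    rw [hz_def, lintegral_gibbs_comm hK.measurable ham hbm (fun x k => (expScale_pos u' x k).le)
      (fun y k => (expScale_pos v y k).le) k] at h1
    exact h1
  · have hswap := lintegral_prod_swap (μ := μ) (ν := ν)
      (fun p : X × Y => ENNReal.ofReal (|u' p.1 k| * r p k))
    refine ne_of_eq_of_ne hswap ?_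
    have huk : Measurable fun p : X × Y => u' p.1 k :=
      (measurable_pi_apply k).comp (hu.1.comp measurable_fst)
    have habs : Measurable fun p : X × Y => |u' p.1 k| := by
      simpa only [Real.norm_eq_abs] using huk.norm
    have hrk : Measurable fun p => r p k := (measurable_pi_apply k).comp hr.measurable
    have hmul : Measurable fun p : X × Y => |u' p.1 k| * r p k := habs.mul hrk
    rw [lintegral_prod _ hmul.ennreal_ofReal.aemeasurable]
    have hle : ∀ᵐ x ∂μ, ∫⁻ y, ENNReal.ofReal (|u' x k| * r (x, y) k) ∂ν ≤
        (conj (f₁ x) (-u' x)).toENNReal + (∑ k, G k x + (ENNReal.ofReal (ε / 2) * T x +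
          (f₁ x (fstMarginal ν r x)).toENNReal)) := by
      filter_upwards [hopt, hsum, hr.fstMarginal_spec hK.measurable] with x ⟨c, hc⟩ h1 h2
      simp_rw [ENNReal.ofReal_mul (abs_nonneg (u' x k))]
      rw [lintegral_const_mul' _ _ ENNReal.ofReal_ne_top, ← (h2 k).2,
        ← ENNReal.ofReal_mul (abs_nonneg _)]
      refine (hc.abs_mul_le (hg x) k).trans ?_
      refine (add_le_add le_rfl h1).trans_eq ?_
      ring
    refine ne_top_of_le_ne_top ?_ (lintegral_mono_ae hle)
    refine lintegral_add_ne_top (hconjm hu.1) hconj ?_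
    refine lintegral_add_ne_top (Finset.measurable_sum _ fun k _ => hGm k)
      (lintegral_sum_ne_top hGm hGi) ?_
    exact lintegral_add_ne_top (hTm.const_mul _) hTi hr.fst

lemma conj_zero_nonpos {g : (Fin n → ℝ) → EReal} (hg : ∀ s, 0 ≤ g s) : conj g 0 ≤ 0 := by
  refine iSup_le fun s => ?_
  simpa using hg s

/-- At the start the conjugates are nonpositive because the integrands are nonnegative, and the
coupling is the integral of the bounded kernel. -/
lemma planInvariant_zero [IsProbabilityMeasure μ] [IsProbabilityMeasure ν]
    (hg₁ : ∀ x, IsPosProper (f₁ x)) (hg₂ : ∀ y, IsPosProper (f₂ y)) (hK : IsPosKernel K μ ν) :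
    PlanInvariant f₁ f₂ ε K μ ν r 0 0 := by
  refine ⟨measurable_const, measurable_const, fun k => ?_, ?_, ?_, ?_⟩
  · obtain ⟨C, hC⟩ := hK.gibbs_lt_top (b := expScale ε 0)
      (fun y k => (expScale_pos _ y k).le) (by simp [expScale])
    refine ne_top_of_le_ne_top (b := ∫⁻ _, ENNReal.ofReal C ∂μ) (by simp) (lintegral_mono_ae ?_)
    filter_upwards [hC] with x hx
    simpa [expScale] using (hx k).1
  · have : ∀ x, (conj (f₁ x) 0).toENNReal = 0 := fun x =>
      EReal.toENNReal_of_nonpos (conj_zero_nonpos (hg₁ x).nonneg)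
    simp [this]
  · have : ∀ y, (conj (f₂ y) 0).toENNReal = 0 := fun y =>
      EReal.toENNReal_of_nonpos (conj_zero_nonpos (hg₂ y).nonneg)
    simp [this]
  · simp

theorem kernelFinite_of_primalFeasible [IsProbabilityMeasure μ] [IsProbabilityMeasure ν]
    (hε : 0 < ε) (hf₁ : IsNormalIntegrand f₁) (hf₂ : IsNormalIntegrand f₂)
    (hg₁ : ∀ x, IsPosProper (f₁ x)) (hg₂ : ∀ y, IsPosProper (f₂ y)) (hK : IsPosKernel K μ ν)
    (h : PrimalFeasible f₁ f₂ K μ ν) : KernelFinite f₁ f₂ ε K μ ν := by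
  obtain ⟨r, hr⟩ := h.exists_plan
  exact kernelFinite_of_invariant
    (P := fun u v => PlanInvariant f₁ f₂ ε K μ ν r u v)
    (Q := fun u v => PlanInvariant f₂ f₁ ε (fun p : Y × X => K p.swap) ν μ
      (fun p : Y × X => r p.swap) v u)
    (planInvariant_zero hg₁ hg₂ hK) (fun _ _ h => h.gibbs_lt_top hK.measurable)
    (fun _ _ h => h.gibbs_lt_top hK.swap.measurable)
    (fun _ _ _ h hu => h.step hε hf₁ hg₁ hK hr hu)
    (fun _ _ _ h hv => h.step hε hf₂ hg₂ hK.swap hr.swap hv)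

end

section

variable {X Y : Type*} [MeasurableSpace X] [MeasurableSpace Y] {n : ℕ}
  {K : X × Y → Fin n → ℝ} {μ : Measure X} {ν : Measure Y} {ε : ℝ}
  {f₁ : X → (Fin n → ℝ) → EReal} {f₂ : Y → (Fin n → ℝ) → EReal}

/-! ### The iterations -/

open Classical in
/-- A choice of a dual step, whenever there is one. -/
def dualStep (f : X → (Fin n → ℝ) → EReal) (ε : ℝ) (μ : Measure X) (z : X → Fin n → ℝ≥0∞) :
    X → Fin n → ℝ :=
  if h : ∃ u, IsDualStep f ε μ z u then h.choose else 0

lemma isDualStep_dualStep {f : X → (Fin n → ℝ) → EReal} {z : X → Fin n → ℝ≥0∞}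
    (h : ∃ u, IsDualStep f ε μ z u) : IsDualStep f ε μ z (dualStep f ε μ z) := by
  unfold dualStep
  rw [dif_pos h]
  exact h.choose_spec

/-- The dual iterates, as pairs `(u^ℓ, v^ℓ)`. -/
def dualIterate (f₁ : X → (Fin n → ℝ) → EReal) (f₂ : Y → (Fin n → ℝ) → EReal) (ε : ℝ)
    (K : X × Y → Fin n → ℝ) (μ : Measure X) (ν : Measure Y) :
    ℕ → (X → Fin n → ℝ) × (Y → Fin n → ℝ)
  | 0 => (0, 0)
  | ℓ + 1 =>
    let u := dualStep f₁ ε μ (gibbs K ν (expScale ε (dualIterate f₁ f₂ ε K μ ν ℓ).2))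
    (u, dualStep f₂ ε ν (gibbsT K μ (expScale ε u)))

lemma IsPosKernel.gibbs_ne_zero_ne_top [SFinite ν] [NeZero ν] (hK : IsPosKernel K μ ν)
    {v : Y → Fin n → ℝ} (hv : Measurable v)
    (h : ∀ᵐ x ∂μ, ∀ k, gibbs K ν (expScale ε v) x k < ⊤) :
    ∀ᵐ x ∂μ, ∀ k, gibbs K ν (expScale ε v) x k ≠ 0 ∧ gibbs K ν (expScale ε v) x k ≠ ⊤ := by
  filter_upwards [hK.gibbs_ne_zero (measurable_expScale (ε := ε) hv) (expScale_pos v), h]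
    with x h1 h2 k
  exact ⟨h1 k, (h2 k).ne⟩

lemma IsDualRun.measurable {N : ℕ} {u : ℕ → X → Fin n → ℝ} {v : ℕ → Y → Fin n → ℝ}
    (h : IsDualRun f₁ f₂ ε K μ ν N u v) : Measurable (v N) := by
  cases N with
  | zero => rw [h.2.1]; exact measurable_const
  | succ N => exact (h.2.2 N (Nat.lt_succ_self N)).2.1

/-- A run of length `N` has finite kernel integrals, including after the next half-step, and this is
what is needed to extend it to length `N + 1`. -/
lemma isDualIterates_dualIterate [IsProbabilityMeasure μ] [IsProbabilityMeasure ν] (hε : 0 < ε)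
    (hf₁ : IsNormalIntegrand f₁) (hf₂ : IsNormalIntegrand f₂) (hg₁ : ∀ x, IsPosProper (f₁ x))
    (hg₂ : ∀ y, IsPosProper (f₂ y)) (hK : IsPosKernel K μ ν) (hfin : KernelFinite f₁ f₂ ε K μ ν) :
    IsDualIterates f₁ f₂ ε K μ ν (fun ℓ => (dualIterate f₁ f₂ ε K μ ν ℓ).1)
      (fun ℓ => (dualIterate f₁ f₂ ε K μ ν ℓ).2) := by
  intro N
  induction N with
  | zero => exact ⟨rfl, rfl, fun ℓ hℓ => absurd hℓ (Nat.not_lt_zero ℓ)⟩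
  | succ N ih =>
    refine ⟨rfl, rfl, fun ℓ hℓ => ?_⟩
    rcases Nat.lt_succ_iff_lt_or_eq.1 hℓ with hlt | rfl
    · exact ih.2.2 ℓ hlt
    obtain ⟨h1, h2⟩ := hfin _ _ _ ih
    have hv := ih.measurable
    have hu : IsDualStep f₁ ε μ (gibbs K ν (expScale ε (dualIterate f₁ f₂ ε K μ ν ℓ).2))
        (dualIterate f₁ f₂ ε K μ ν (ℓ + 1)).1 :=
      isDualStep_dualStep (exists_isDualStep hε hf₁ hg₁
        (measurable_gibbs hK.measurable (measurable_expScale hv)) (hK.gibbs_ne_zero_ne_top hv h1))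
    refine ⟨hu, isDualStep_dualStep (exists_isDualStep hε hf₂ hg₂ ?_ ?_)⟩
    · exact measurable_gibbs hK.swap.measurable (measurable_expScale hu.1)
    · exact hK.swap.gibbs_ne_zero_ne_top hu.1 (h2 _ hu)

lemma expScale_congr {u u' : X → Fin n → ℝ} (h : u =ᵐ[μ] u') :
    expScale ε u =ᵐ[μ] expScale ε u' := by
  filter_upwards [h] with x hx
  ext k
  simp only [expScale, hx]

lemma expScale_zero {Ω : Type*} : expScale ε (0 : Ω → Fin n → ℝ) = 1 := by
  ext x k
  simp [expScale]

/-- The kernel operators see only almost-everywhere classes, so uniqueness of one step propagates by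
induction, for dual and scaling iterates alike. -/
theorem exists_iterates [IsProbabilityMeasure μ] [IsProbabilityMeasure ν] (hε : 0 < ε)
    (hf₁ : IsNormalIntegrand f₁) (hf₂ : IsNormalIntegrand f₂) (hg₁ : ∀ x, IsPosProper (f₁ x))
    (hg₂ : ∀ y, IsPosProper (f₂ y)) (hK : IsPosKernel K μ ν) (hfin : KernelFinite f₁ f₂ ε K μ ν) :
    ∃ (u : ℕ → X → Fin n → ℝ) (v : ℕ → Y → Fin n → ℝ),
      IsDualIterates f₁ f₂ ε K μ ν u v ∧
      (∀ u' v', IsDualIterates f₁ f₂ ε K μ ν u' v' →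
        ∀ ℓ, u' ℓ =ᵐ[μ] u ℓ ∧ v' ℓ =ᵐ[ν] v ℓ) ∧
      IsScalingIterates f₁ f₂ ε K μ ν
        (fun ℓ => expScale ε (u ℓ)) (fun ℓ => expScale ε (v ℓ)) ∧
      (∀ a b, IsScalingIterates f₁ f₂ ε K μ ν a b →
        ∀ ℓ, a ℓ =ᵐ[μ] expScale ε (u ℓ) ∧ b ℓ =ᵐ[ν] expScale ε (v ℓ)) ∧
      (∀ ℓ,
        AgreesWithIntegralStep f₁ ε μ (gibbs K ν (expScale ε (v ℓ))) (u (ℓ + 1)) ∧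
        AgreesWithIntegralStep f₂ ε ν (gibbsT K μ (expScale ε (u (ℓ + 1)))) (v (ℓ + 1))) := by
  have hit := isDualIterates_dualIterate hε hf₁ hf₂ hg₁ hg₂ hK hfin
  set u : ℕ → X → Fin n → ℝ := fun ℓ => (dualIterate f₁ f₂ ε K μ ν ℓ).1
  set v : ℕ → Y → Fin n → ℝ := fun ℓ => (dualIterate f₁ f₂ ε K μ ν ℓ).2
  have hu : ∀ ℓ, IsDualStep f₁ ε μ (gibbs K ν (expScale ε (v ℓ))) (u (ℓ + 1)) :=
    fun ℓ => ((hit (ℓ + 1)).2.2 ℓ (Nat.lt_succ_self ℓ)).1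
  have hv : ∀ ℓ, IsDualStep f₂ ε ν (gibbsT K μ (expScale ε (u (ℓ + 1)))) (v (ℓ + 1)) :=
    fun ℓ => ((hit (ℓ + 1)).2.2 ℓ (Nat.lt_succ_self ℓ)).2
  have hvm : ∀ ℓ, Measurable (v ℓ) := fun ℓ => (hit ℓ).measurable
  have hzm : ∀ ℓ, Measurable (gibbs K ν (expScale ε (v ℓ))) := fun ℓ =>
    measurable_gibbs hK.measurable (measurable_expScale (hvm ℓ))
  have hzm' : ∀ ℓ, Measurable (gibbsT K μ (expScale ε (u (ℓ + 1)))) := fun ℓ =>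
    measurable_gibbs hK.swap.measurable (measurable_expScale (hu ℓ).1)
  have hz : ∀ ℓ, ∀ᵐ x ∂μ, ∀ k, gibbs K ν (expScale ε (v ℓ)) x k ≠ 0 ∧
      gibbs K ν (expScale ε (v ℓ)) x k ≠ ⊤ := fun ℓ =>
    hK.gibbs_ne_zero_ne_top (hvm ℓ) (hfin ℓ u v (hit ℓ)).1
  have hz' : ∀ ℓ, ∀ᵐ y ∂ν, ∀ k, gibbsT K μ (expScale ε (u (ℓ + 1))) y k ≠ 0 ∧
      gibbsT K μ (expScale ε (u (ℓ + 1))) y k ≠ ⊤ := fun ℓ =>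
    hK.swap.gibbs_ne_zero_ne_top (hu ℓ).1 ((hfin ℓ u v (hit ℓ)).2 _ (hu ℓ))
  refine ⟨u, v, hit, ?_, ?_, ?_, fun ℓ => ⟨?_, ?_⟩⟩
  · intro u' v' h' ℓ
    induction ℓ with
    | zero => rw [(h' 0).1, (h' 0).2.1]; exact ⟨ae_eq_refl _, ae_eq_refl _⟩
    | succ ℓ ih =>
      obtain ⟨h1, h2⟩ := (h' (ℓ + 1)).2.2 ℓ (Nat.lt_succ_self ℓ)
      rw [gibbs_congr (expScale_congr ih.2)] at h1
      have hu' := h1.ae_eq hε hg₁ (hz ℓ) (hu ℓ)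
      have h3 : gibbsT K μ (expScale ε (u' (ℓ + 1))) = gibbsT K μ (expScale ε (u (ℓ + 1))) :=
        gibbs_congr (K := fun p : Y × X => K p.swap) (expScale_congr hu')
      rw [h3] at h2
      exact ⟨hu', h2.ae_eq hε hg₂ (hz' ℓ) (hv ℓ)⟩
  · exact ⟨expScale_zero, expScale_zero, fun ℓ => ⟨(hu ℓ).isScalingStep hε hg₁ (hzm ℓ) (hz ℓ),
      (hv ℓ).isScalingStep hε hg₂ (hzm' ℓ) (hz' ℓ)⟩⟩
  · intro a b hab ℓ
    induction ℓ with
    | zero =>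
      rw [hab.1, hab.2.1]
      exact ⟨Filter.EventuallyEq.of_eq expScale_zero.symm, Filter.EventuallyEq.of_eq expScale_zero.symm⟩
    | succ ℓ ih =>
      obtain ⟨h1, h2⟩ := hab.2.2 ℓ
      rw [gibbs_congr ih.2] at h1
      have ha := h1.ae_eq hε hg₁ (hz ℓ) (hu ℓ)
      have h3 : gibbsT K μ (a (ℓ + 1)) = gibbsT K μ (expScale ε (u (ℓ + 1))) :=
        gibbs_congr (K := fun p : Y × X => K p.swap) ha
      rw [h3] at h2
      exact ⟨ha, h2.ae_eq hε hg₂ (hz' ℓ) (hv ℓ)⟩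
  · exact (hu ℓ).agreesWithIntegralStep hε hf₁ hg₁ (hzm ℓ) (hz ℓ)
  · exact (hv ℓ).agreesWithIntegralStep hε hf₂ hg₂ (hzm' ℓ) (hz' ℓ)

end

end EntropicScaling

end

/-! ### Assembly of the finiteness cases and the properties of the iterates. -/

theorem theorem3p8 {X Y : Type*} [MeasurableSpace X] [MeasurableSpace Y]
    (μ : Measure X) [IsProbabilityMeasure μ] (ν : Measure Y) [IsProbabilityMeasure ν]
    {n : ℕ} (ε : ℝ) (hε : 0 < ε)
    (f₁ : X → (Fin n → ℝ) → EReal) (f₂ : Y → (Fin n → ℝ) → EReal)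
    (hf₁ : IsAdmissible f₁ μ) (hf₂ : IsAdmissible f₂ ν)
    (hpos₁ : ∀ x, ∃ s : Fin n → ℝ, (∀ k, 0 < s k) ∧ f₁ x s < ⊤)
    (hpos₂ : ∀ y, ∃ s : Fin n → ℝ, (∀ k, 0 < s k) ∧ f₂ y s < ⊤)
    (K : X × Y → Fin n → ℝ) (hKm : Measurable K) (hK : MemLp K ⊤ (μ.prod ν))
    (hKpos : ∀ᵐ p ∂(μ.prod ν), ∀ k, 0 < K p k) :
    -- the integrals `𝒦 e^{v/ε}`, `𝒦ᵀ e^{u/ε}` are automatically finite in the following cases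
    ((n ≤ 1 ∨ (∃ m : ℝ, 0 < m ∧ ∀ᵐ p ∂(μ.prod ν), ∀ k, m ≤ K p k) ∨
        PrimalFeasible f₁ f₂ K μ ν) →
      KernelFinite f₁ f₂ ε K μ ν) ∧
    -- whenever they are finite, the iterates are well defined, unique, and agree
    (KernelFinite f₁ f₂ ε K μ ν →
      ∃ (u : ℕ → X → Fin n → ℝ) (v : ℕ → Y → Fin n → ℝ),
        IsDualIterates f₁ f₂ ε K μ ν u v ∧
        (∀ u' v', IsDualIterates f₁ f₂ ε K μ ν u' v' →
          ∀ ℓ, u' ℓ =ᵐ[μ] u ℓ ∧ v' ℓ =ᵐ[ν] v ℓ) ∧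
        IsScalingIterates f₁ f₂ ε K μ ν
          (fun ℓ => expScale ε (u ℓ)) (fun ℓ => expScale ε (v ℓ)) ∧
        (∀ a b, IsScalingIterates f₁ f₂ ε K μ ν a b →
          ∀ ℓ, a ℓ =ᵐ[μ] expScale ε (u ℓ) ∧ b ℓ =ᵐ[ν] expScale ε (v ℓ)) ∧
        (∀ ℓ,
          AgreesWithIntegralStep f₁ ε μ (gibbs K ν (expScale ε (v ℓ))) (u (ℓ + 1)) ∧
          AgreesWithIntegralStep f₂ ε ν (gibbsT K μ (expScale ε (u (ℓ + 1)))) (v (ℓ + 1)))) := by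
  have hg₁ := hf₁.isPosProper hpos₁
  have hg₂ := hf₂.isPosProper hpos₂
  have hK' := isPosKernel_of_memLp hKm hK hKpos
  refine ⟨?_, exists_iterates hε hf₁.normal hf₂.normal hg₁ hg₂ hK'⟩
  rintro (hn | ⟨m, hm, hKlow⟩ | hfeas)
  · exact kernelFinite_of_le_one hn hε hf₁ hf₂ hg₁ hg₂ hK'
  · exact kernelFinite_of_bounded_below hε hf₁ hf₂ hg₁ hg₂ hK' hm hKlow
  · exact kernelFinite_of_primalFeasible hε hf₁.normal hf₂.normal hg₁ hg₂ hK' hfeas
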